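/- **Conventions.** The ground field is $k=\mathbb R$ or $\mathbb C$, all spaces are complete Hausdorff locally convex, $\widehat\otimes=\widehat\otimes_\pi$ is the completed projective tensor product, and $E^\circ$ is the strong dual of $E$. A space is *well-behaved* if it is nuclear and is either a Fréchet space or the strong dual of a Fréchet space. A *topological Hopf algebra* is a Hopf algebra $H$ in this setting, with $\Delta:H\to H\widehat\otimes H$ and all other structure maps continuous (multiplication $H\widehat\otimes H\to H$, i.e. jointly continuous; the antipode $S$ is not assumed to be bijective). A *topological right $H$-module* $V$ has a unital, associative and jointly continuous action $V\times H\to V$; a *topological left $H$-comodule* has a counital, coassociative, continuous coaction $\nabla:V\to H\widehat\otimes V$, $\nabla(v)=v_{-1}\otimes v_0$. A *right-left AYD module* is a topological right module and left comodule $V$ with $$\nabla(v\cdot h)=S(h_3)\,v_{-1}\,h_1\otimes v_0\cdot h_2\qquad(v\in V,\ h\in H).$$ **Proposition.** Let $H$ be a topological Hopf algebra and $V$ a space, both well-behaved. Let $H^\circ$ carry the convolution product $(\varphi\psi)(x)=\varphi(x_1)\psi(x_2)$. (0) There is exactly one separately continuous bilinear multiplication on $B:=B^{top}_{AYD}(H)=H^\circ\widehat\otimes_\pi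 H$ with $$(\varphi\otimes h)(\varphi'\otimes h')=\varphi'_1(S(h_3))\,\varphi'_3(h_1)\;\varphi\varphi'_2\otimes h_2h',$$ where $\varphi'_1(S(c))\,\varphi'_3(a)\,\varphi'_2$ denotes the functional $x\mapsto\varphi'(S(c)\,x\,a)$. With it $B$ is an associative algebra with unit $\varepsilon\otimes 1$. There is exactly one $\rho=\sum_i f^i\otimes x_i\in B$ with $\lambda(\rho)=\mathrm{Id}_H$, where $\lambda:B\to\mathrm{End}(H)$ is given by $\lambda(\varphi\otimes h)(x)=\varphi(x)h$. Below, a *right $B$-module* structure on $V$ is a unital, associative, separately continuous bilinear action $V\times B\to V$. (1) If $V$ is a right-left AYD module over $H$, there is exactly one right $B$-module structure on $V$ with $$v\cdot(\varphi\otimes h)=\varphi(v_{-1})\,v_0\cdot h .$$ (2) Conversely, let $V$ be a right $B$-module. Suppose that $H$ and $V$ are both Fréchet, or both strong duals of Fréchet spaces, or else that $(v,h)\mapsto v\cdot(\varepsilon\otimes h)$ is jointly continuous. Then $V$ is a right-left AYD module over $H$ with the action and coaction $$v\cdot h:=v\cdot(\varepsilon\otimes h),\qquad \nabla(v):=\sum_i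 x_i\otimes v\cdot(f^i\otimes 1).$$ (3) The constructions (1) and (2) are inverse to each other: for an AYD module structure and a right $B$-module structure on the same space $V$, the formula of (1) holds if and only if both formulas of (2) hold. -/

import Mathlib

open TensorProduct Topology UniformSpace

set_option linter.unusedSectionVars false

namespace TopHopf

section ProjectiveTensor

/-- The algebraic tensor product, to be equipped with the projective topology. -/
def ProjTensor (𝕜 : Type*) [RCLike 𝕜] (E F : Type*) [AddCommGroup E] [Module 𝕜 E]
    [AddCommGroup F] [Module 𝕜 F] : Type _ := E ⊗[𝕜] F

variable {𝕜 : Type*} [RCLike 𝕜]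
variable {E : Type*} [AddCommGroup E] [Module 𝕜 E]
variable {F : Type*} [AddCommGroup F] [Module 𝕜 F]

noncomputable instance : AddCommGroup (ProjTensor 𝕜 E F) :=
  inferInstanceAs (AddCommGroup (E ⊗[𝕜] F))

noncomputable instance : Module 𝕜 (ProjTensor 𝕜 E F) :=
  inferInstanceAs (Module 𝕜 (E ⊗[𝕜] F))

variable (𝕜) in
/-- The elementary tensor `x ⊗ y` in the algebraic tensor product. -/
def ptmul (x : E) (y : F) : ProjTensor 𝕜 E F := x ⊗ₜ[𝕜] y

variable [TopologicalSpace E] [TopologicalSpace F]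

/-- The projective topology: the finest locally convex topology on `E ⊗ F` for which the canonical
bilinear map `E × F → E ⊗ F` is (jointly) continuous. -/
instance : TopologicalSpace (ProjTensor 𝕜 E F) :=
  sInf {t : TopologicalSpace (ProjTensor 𝕜 E F) |
    PolynormableSpace 𝕜 (ProjTensor 𝕜 E F) (topology := t) ∧
      Continuous[inferInstance, t] (fun p : E × F => ptmul 𝕜 p.1 p.2)}

instance : PolynormableSpace 𝕜 (ProjTensor 𝕜 E F) :=
  PolynormableSpace.sInf fun _ ht => ht.1

instance : IsTopologicalAddGroup (ProjTensor 𝕜 E F) :=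
  (PolynormableSpace.withSeminorms 𝕜 _).topologicalAddGroup

instance : ContinuousSMul 𝕜 (ProjTensor 𝕜 E F) :=
  (PolynormableSpace.withSeminorms 𝕜 _).continuousSMul

noncomputable instance : UniformSpace (ProjTensor 𝕜 E F) :=
  IsTopologicalAddGroup.rightUniformSpace _

instance : IsUniformAddGroup (ProjTensor 𝕜 E F) := isUniformAddGroup_of_addCommGroup

instance : UniformContinuousConstSMul 𝕜 (ProjTensor 𝕜 E F) :=
  uniformContinuousConstSMul_of_continuousConstSMul _ _

theorem continuous_ptmul : Continuous (fun p : E × F => ptmul 𝕜 p.1 p.2) :=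
  continuous_sInf_rng.2 fun _ ht => ht.2

variable (𝕜 E F) in
/-- The completed projective tensor product `E ⊗̂_π F`. -/
def CTensor : Type _ := Completion (ProjTensor 𝕜 E F)

noncomputable instance : AddCommGroup (CTensor 𝕜 E F) :=
  inferInstanceAs (AddCommGroup (Completion (ProjTensor 𝕜 E F)))

noncomputable instance : Module 𝕜 (CTensor 𝕜 E F) :=
  inferInstanceAs (Module 𝕜 (Completion (ProjTensor 𝕜 E F)))

noncomputable instance : UniformSpace (CTensor 𝕜 E F) :=
  inferInstanceAs (UniformSpace (Completion (ProjTensor 𝕜 E F)))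

instance : IsUniformAddGroup (CTensor 𝕜 E F) :=
  inferInstanceAs (IsUniformAddGroup (Completion (ProjTensor 𝕜 E F)))

instance : CompleteSpace (CTensor 𝕜 E F) :=
  inferInstanceAs (CompleteSpace (Completion (ProjTensor 𝕜 E F)))

instance : T2Space (CTensor 𝕜 E F) :=
  inferInstanceAs (T2Space (Completion (ProjTensor 𝕜 E F)))

end ProjectiveTensor

/-- The completion of a locally convex space is locally convex. -/
theorem polynormableSpace_completion {𝕜 : Type*} [RCLike 𝕜] {E : Type*} [AddCommGroup E]
    [Module 𝕜 E] [UniformSpace E] [IsUniformAddGroup E] [UniformContinuousConstSMul 𝕜 E]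
    [PolynormableSpace 𝕜 E] : PolynormableSpace 𝕜 (Completion E) := by
  classical
  have hw := PolynormableSpace.withSeminorms 𝕜 E
  have huc : ∀ p : {p : Seminorm 𝕜 E // Continuous p}, UniformContinuous p.1 := fun p =>
    Seminorm.uniformContinuous_of_continuousAt_zero p.2.continuousAt
  let ext : {p : Seminorm 𝕜 E // Continuous p} → Completion E → ℝ :=
    fun p => Completion.extension p.1
  have hcont : ∀ p, Continuous (ext p) := fun p => Completion.continuous_extension
  have hcoe : ∀ p (x : E), ext p x = p.1 x := fun p x => Completion.extension_coe (huc p) x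
  let P : {p : Seminorm 𝕜 E // Continuous p} → Seminorm 𝕜 (Completion E) := fun p =>
    Seminorm.of (ext p)
      (fun x y => Completion.induction_on₂ x y
        (isClosed_le ((hcont p).comp (continuous_fst.add continuous_snd))
          (((hcont p).comp continuous_fst).add ((hcont p).comp continuous_snd)))
        (fun a b => by
          rw [← Completion.coe_add, hcoe, hcoe, hcoe]; exact map_add_le_add p.1 a b))
      (fun c x => Completion.induction_on x
        (isClosed_eq ((hcont p).comp (continuous_const_smul c))
          (continuous_const.mul (hcont p)))
        (fun a => by rw [← Completion.coe_smul, hcoe, hcoe]; exact map_smul_eq_mul p.1 c a))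
  have hP : WithSeminorms P := by
    refine (SeminormFamily.withSeminorms_iff_nhds_eq_iInf P).2 (le_antisymm ?_ ?_)
    · refine le_iInf fun p => ?_
      have := (hcont p).tendsto 0
      rw [show ext p 0 = 0 from map_zero (P p)] at this
      exact this.le_comap
    · intro U hU
      obtain ⟨W, hW, hWc, hWU⟩ := exists_mem_nhds_isClosed_subset hU
      have hV : ((↑) : E → Completion E) ⁻¹' W ∈ 𝓝 (0 : E) :=
        (Completion.continuous_coe E).continuousAt.preimage_mem_nhds (by rw [Completion.coe_zero]; exact hW)
      rw [(SeminormFamily.withSeminorms_iff_nhds_eq_iInf _).1 hw] at hV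
      have hV' : ((↑) : E → Completion E) ⁻¹' W ∈ 𝓝 (0 : E) := by
        rw [(SeminormFamily.withSeminorms_iff_nhds_eq_iInf _).1 hw]; exact hV
      obtain ⟨V, ⟨s, r, hr, rfl⟩, hVW⟩ : ∃ V, (∃ (p : {p : Seminorm 𝕜 E // Continuous p}) (r : ℝ), 0 < r ∧ V = p.1.ball 0 r) ∧
          V ⊆ ((↑) : E → Completion E) ⁻¹' W := by
        obtain ⟨V, hV1, hV2⟩ := hw.hasBasis.mem_iff.1 hV'
        obtain ⟨s, r, hr, rfl⟩ := (SeminormFamily.basisSets_iff _).1 hV1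
        refine ⟨_, ⟨⟨s.sup (fun p => p.1), ?_⟩, r, hr, rfl⟩, hV2⟩
        exact Seminorm.continuous_finsetSup fun i _ => i.2
      refine Filter.mem_of_superset (Filter.mem_iInf_of_mem s
        (Filter.preimage_mem_comap (Metric.ball_mem_nhds (0 : ℝ) hr))) (fun x hx => hWU ?_)
      have hx' : ext s x < r := by
        have h0 : |ext s x| < r := by
          have hx2 : P s x ∈ Metric.ball (0 : ℝ) r := hx
          rw [Metric.mem_ball, Real.dist_eq, sub_zero] at hx2
          exact hx2
        exact lt_of_le_of_lt (le_abs_self _) h0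
      have hmem : x ∈ closure (((↑) : E → Completion E) '' s.1.ball 0 r) := by
        rw [mem_closure_iff]
        intro O hO hxO
        obtain ⟨a, ha⟩ := (Completion.denseRange_coe (α := E)).exists_mem_open
          (hO.inter ((isOpen_lt (hcont s) continuous_const))) ⟨x, hxO, hx'⟩
        refine ⟨a, ha.1, a, ?_, rfl⟩
        have : ext s (a : Completion E) < r := ha.2
        rw [hcoe] at this
        simpa [Seminorm.mem_ball] using this
      exact closure_minimal (by rintro _ ⟨a, ha, rfl⟩; exact hVW ha) hWc hmem
  exact hP.toPolynormableSpace


section CTensorInstances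

variable {𝕜 : Type*} [RCLike 𝕜]
variable {E : Type*} [AddCommGroup E] [Module 𝕜 E] [TopologicalSpace E]
variable {F : Type*} [AddCommGroup F] [Module 𝕜 F] [TopologicalSpace F]

instance : PolynormableSpace 𝕜 (CTensor 𝕜 E F) :=
  polynormableSpace_completion (E := ProjTensor 𝕜 E F)

instance : ContinuousSMul 𝕜 (CTensor 𝕜 E F) :=
  (PolynormableSpace.withSeminorms 𝕜 _).continuousSMul

variable (𝕜 E F) in
/-- The canonical map of `E ⊗_π F` to its completion. -/
noncomputable def toCTensor : ProjTensor 𝕜 E F →L[𝕜] CTensor 𝕜 E F where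
  toFun t := (t : Completion (ProjTensor 𝕜 E F))
  map_add' := Completion.coe_add
  map_smul' := Completion.coe_smul
  cont := Completion.continuous_coe _

variable (𝕜 E F) in
/-- The canonical bilinear map `E × F → E ⊗̂_π F`. -/
noncomputable def ctmulₗ : E →ₗ[𝕜] F →ₗ[𝕜] CTensor 𝕜 E F :=
  LinearMap.mk₂ 𝕜 (fun x y => toCTensor 𝕜 E F (ptmul 𝕜 x y))
    (fun a b c => (congrArg (toCTensor 𝕜 E F) (TensorProduct.add_tmul a b c)).trans
      (map_add (toCTensor 𝕜 E F) (ptmul 𝕜 a c) (ptmul 𝕜 b c)))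
    (fun r a b => (congrArg (toCTensor 𝕜 E F) (TensorProduct.smul_tmul' r a b).symm).trans
      (map_smul (toCTensor 𝕜 E F) r (ptmul 𝕜 a b)))
    (fun a b c => (congrArg (toCTensor 𝕜 E F) (TensorProduct.tmul_add a b c)).trans
      (map_add (toCTensor 𝕜 E F) (ptmul 𝕜 a b) (ptmul 𝕜 a c)))
    (fun r a b => (congrArg (toCTensor 𝕜 E F) (TensorProduct.tmul_smul r a b)).trans
      (map_smul (toCTensor 𝕜 E F) r (ptmul 𝕜 a b)))

variable (𝕜) in
/-- The elementary tensor `x ⊗ y` in `E ⊗̂_π F`. -/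
noncomputable def ctmul (x : E) (y : F) : CTensor 𝕜 E F := ctmulₗ 𝕜 E F x y

theorem continuous_ctmul : Continuous (fun p : E × F => ctmul 𝕜 p.1 p.2) :=
  (toCTensor 𝕜 E F).continuous.comp continuous_ptmul

theorem denseRange_toCTensor : DenseRange (toCTensor 𝕜 E F) :=
  Completion.denseRange_coe (α := ProjTensor 𝕜 E F)

theorem ptmul_ext {X : Type*} [AddCommGroup X] [Module 𝕜 X] {f g : ProjTensor 𝕜 E F →ₗ[𝕜] X}
    (h : ∀ x y, f (ptmul 𝕜 x y) = g (ptmul 𝕜 x y)) : f = g :=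
  TensorProduct.ext' (g := f) (h := g) h

/-- Continuous linear maps on `E ⊗̂_π F` are determined by their values on elementary tensors. -/
theorem CTensor.ext {X : Type*} [AddCommGroup X] [Module 𝕜 X] [TopologicalSpace X] [T2Space X]
    {f g : CTensor 𝕜 E F →L[𝕜] X} (h : ∀ x y, f (ctmul 𝕜 x y) = g (ctmul 𝕜 x y)) : f = g := by
  have h1 : f.toLinearMap ∘ₗ (toCTensor 𝕜 E F).toLinearMap =
      g.toLinearMap ∘ₗ (toCTensor 𝕜 E F).toLinearMap := ptmul_ext h
  exact DFunLike.coe_injective (denseRange_toCTensor.equalizer f.continuous g.continuous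
    (funext fun t => LinearMap.congr_fun h1 t))

end CTensorInstances

section Multilinear

variable {𝕜 : Type*} [RCLike 𝕜]
variable {E : Type*} [AddCommGroup E] [Module 𝕜 E] [TopologicalSpace E] [ContinuousSMul 𝕜 E]
variable {F : Type*} [AddCommGroup F] [Module 𝕜 F] [TopologicalSpace F] [ContinuousSMul 𝕜 F]
variable {G : Type*} [AddCommGroup G] [Module 𝕜 G] [TopologicalSpace G] [ContinuousSMul 𝕜 G]
variable {X : Type*} [AddCommGroup X] [Module 𝕜 X]

theorem exists_smul_mem {U : Set E} (hU : U ∈ 𝓝 (0 : E)) (x : E) :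
    ∃ c : ℝ, 0 < c ∧ (c : 𝕜) • x ∈ U := by
  have h : Filter.Tendsto (fun c : ℝ => (c : 𝕜) • x) (𝓝[>] 0) (𝓝 0) := by
    have : Continuous fun c : ℝ => (c : 𝕜) • x :=
      (RCLike.continuous_ofReal).smul continuous_const
    have h0 := this.tendsto 0
    simp only [RCLike.ofReal_zero, zero_smul] at h0
    exact h0.mono_left nhdsWithin_le_nhds
  obtain ⟨c, hc, hc'⟩ := ((h.eventually hU).and self_mem_nhdsWithin).exists
  exact ⟨c, hc', hc⟩

theorem smul_preimage_mem {U : Set E} (hU : U ∈ 𝓝 (0 : E)) (c : 𝕜) :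
    {x : E | c • x ∈ U} ∈ 𝓝 (0 : E) := by
  have : Filter.Tendsto (fun x : E => c • x) (𝓝 0) (𝓝 0) := by
    simpa using (continuous_const_smul c).tendsto (0 : E)
  exact this hU

/-- The local form of joint continuity of a bilinear map: it is bounded near the origin, with
respect to every continuous seminorm of the target. -/
def BddNearZero₂ [TopologicalSpace X] (f : E →ₗ[𝕜] F →ₗ[𝕜] X) : Prop :=
  ∀ r : Seminorm 𝕜 X, Continuous r → ∃ U ∈ 𝓝 (0 : E), ∃ V ∈ 𝓝 (0 : F),
    ∀ x ∈ U, ∀ y ∈ V, r (f x y) ≤ 1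

/-- The local form of joint continuity of a trilinear map. -/
def BddNearZero₃ [TopologicalSpace X] (f : E →ₗ[𝕜] F →ₗ[𝕜] G →ₗ[𝕜] X) : Prop :=
  ∀ r : Seminorm 𝕜 X, Continuous r → ∃ U ∈ 𝓝 (0 : E), ∃ V ∈ 𝓝 (0 : F), ∃ W ∈ 𝓝 (0 : G),
    ∀ x ∈ U, ∀ y ∈ V, ∀ z ∈ W, r (f x y z) ≤ 1

theorem seminorm_le_of_smul_le (r : Seminorm 𝕜 X) {c : ℝ} (hc : 0 < c) {x : X}
    (h : r ((c : 𝕜) • x) ≤ 1) : r x ≤ c⁻¹ := by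
  rw [map_smul_eq_mul, RCLike.norm_ofReal, abs_of_pos hc] at h
  rw [inv_eq_one_div, le_div_iff₀ hc]; linarith

theorem continuous_bilin [IsTopologicalAddGroup E] [IsTopologicalAddGroup F]
    [TopologicalSpace X] {ι : Type*} {q : SeminormFamily 𝕜 X ι} (hq : WithSeminorms q)
    (f : E →ₗ[𝕜] F →ₗ[𝕜] X)
    (h : ∀ j, ∃ U ∈ 𝓝 (0 : E), ∃ V ∈ 𝓝 (0 : F), ∀ x ∈ U, ∀ y ∈ V, q j (f x y) ≤ 1) :
    Continuous (fun p : E × F => f p.1 p.2) := by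
  have := hq.topologicalAddGroup
  let f' : E →+ F →+ X := AddMonoidHom.mk' (fun x => (f x).toAddMonoidHom) fun a b => by
    ext y; simp
  have key : ∀ j, ∀ ε > 0, ∃ U ∈ 𝓝 (0 : E), ∃ V ∈ 𝓝 (0 : F), ∀ x ∈ U, ∀ y ∈ V,
      q j (f x y) < ε := by
    intro j ε hε
    obtain ⟨U, hU, V, hV, hUV⟩ := h j
    refine ⟨_, smul_preimage_mem (𝕜 := 𝕜) hU (((2 / ε : ℝ) : 𝕜)), V, hV, fun x hx y hy => ?_⟩
    have h1 := hUV _ hx y hy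
    rw [f.map_smul, LinearMap.smul_apply] at h1
    have h2 := seminorm_le_of_smul_le (q j) (by positivity) h1
    refine lt_of_le_of_lt h2 ?_
    rw [inv_div]; linarith
  refine continuous_of_continuousAt_zero₂ f' ?_ ?_ ?_
  · change Filter.Tendsto _ _ (𝓝 (f 0 0))
    rw [map_zero, hq.tendsto_nhds]
    intro j ε hε
    obtain ⟨U, hU, V, hV, hUV⟩ := key j ε hε
    rw [nhds_prod_eq]
    filter_upwards [Filter.prod_mem_prod hU hV] with p hp
    rw [sub_zero]
    exact hUV _ hp.1 _ hp.2
  · intro x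
    change Filter.Tendsto (fun y => f x y) _ (𝓝 (f x 0))
    rw [map_zero, hq.tendsto_nhds]
    intro j ε hε
    obtain ⟨U, hU, V, hV, hUV⟩ := key j ε hε
    obtain ⟨c, hc, hcx⟩ := exists_smul_mem (𝕜 := 𝕜) hU x
    filter_upwards [smul_preimage_mem (𝕜 := 𝕜) hV ((c⁻¹ : ℝ) : 𝕜)] with y hy
    have := hUV _ hcx _ hy
    rw [(f _).map_smul, f.map_smul, LinearMap.smul_apply, smul_smul, ← RCLike.ofReal_mul,
      inv_mul_cancel₀ hc.ne', RCLike.ofReal_one, one_smul] at this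
    rwa [sub_zero]
  · intro y
    change Filter.Tendsto (fun x => f x y) _ (𝓝 (f 0 y))
    rw [map_zero, LinearMap.zero_apply, hq.tendsto_nhds]
    intro j ε hε
    obtain ⟨U, hU, V, hV, hUV⟩ := key j ε hε
    obtain ⟨c, hc, hcy⟩ := exists_smul_mem (𝕜 := 𝕜) hV y
    filter_upwards [smul_preimage_mem (𝕜 := 𝕜) hU ((c⁻¹ : ℝ) : 𝕜)] with x hx
    have := hUV _ hx _ hcy
    rw [(f _).map_smul, f.map_smul, LinearMap.smul_apply, smul_smul, ← RCLike.ofReal_mul,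
      mul_inv_cancel₀ hc.ne', RCLike.ofReal_one, one_smul] at this
    rwa [sub_zero]

theorem BddNearZero₂.continuous [IsTopologicalAddGroup E] [IsTopologicalAddGroup F]
    [TopologicalSpace X] [PolynormableSpace 𝕜 X] {f : E →ₗ[𝕜] F →ₗ[𝕜] X} (hf : BddNearZero₂ f) :
    Continuous (fun p : E × F => f p.1 p.2) :=
  continuous_bilin (PolynormableSpace.withSeminorms 𝕜 X) f fun j => hf j.1 j.2

theorem bddNearZero₂_of_continuous [TopologicalSpace X] {f : E →ₗ[𝕜] F →ₗ[𝕜] X}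
    (hf : Continuous (fun p : E × F => f p.1 p.2)) : BddNearZero₂ f := by
  intro r hr
  have h : {p : E × F | r (f p.1 p.2) < 1} ∈ 𝓝 ((0, 0) : E × F) :=
    (isOpen_lt (hr.comp hf) continuous_const).mem_nhds (by simp)
  obtain ⟨U, hU, V, hV, hUV⟩ := mem_nhds_prod_iff.1 h
  exact ⟨U, hU, V, hV, fun x hx y hy => le_of_lt (hUV (Set.mk_mem_prod hx hy))⟩

end Multilinear


section Lift

variable {𝕜 : Type*} [RCLike 𝕜]
variable {E : Type*} [AddCommGroup E] [Module 𝕜 E] [TopologicalSpace E]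
variable {F : Type*} [AddCommGroup F] [Module 𝕜 F] [TopologicalSpace F]
variable {G : Type*} [AddCommGroup G] [Module 𝕜 G] [TopologicalSpace G]
variable {X : Type*} [AddCommGroup X] [Module 𝕜 X] [UniformSpace X] [IsUniformAddGroup X]
  [ContinuousSMul 𝕜 X] [PolynormableSpace 𝕜 X] [CompleteSpace X] [T2Space X]

/-- The linear map on `E ⊗ F` induced by a bilinear map. -/
def plift {X : Type*} [AddCommGroup X] [Module 𝕜 X] (f : E →ₗ[𝕜] F →ₗ[𝕜] X) :
    ProjTensor 𝕜 E F →ₗ[𝕜] X :=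
  TensorProduct.lift f

theorem plift_ptmul {X : Type*} [AddCommGroup X] [Module 𝕜 X] (f : E →ₗ[𝕜] F →ₗ[𝕜] X)
    (x : E) (y : F) : plift f (ptmul 𝕜 x y) = f x y :=
  TensorProduct.lift.tmul x y

theorem continuous_plift {X : Type*} [AddCommGroup X] [Module 𝕜 X] {t : TopologicalSpace X}
    [PolynormableSpace 𝕜 X] {f : E →ₗ[𝕜] F →ₗ[𝕜] X}
    (hf : Continuous (fun p : E × F => f p.1 p.2)) : Continuous (plift f) := by
  rw [continuous_iff_le_induced]
  refine sInf_le ⟨PolynormableSpace.induced (plift f), continuous_induced_rng.2 ?_⟩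
  exact hf.congr fun p => (plift_ptmul f p.1 p.2).symm

/-- The continuous linear map `E ⊗̂_π F → X`, `x ⊗ y ↦ f x y`, induced by a jointly continuous
bilinear map `f` into a complete Hausdorff locally convex space. -/
noncomputable def lift₂ (f : E →ₗ[𝕜] F →ₗ[𝕜] X)
    (hf : Continuous (fun p : E × F => f p.1 p.2)) : CTensor 𝕜 E F →L[𝕜] X :=
  haveI : UniformContinuousConstSMul 𝕜 X := uniformContinuousConstSMul_of_continuousConstSMul 𝕜 X
  ContinuousLinearMap.fromCompletion ⟨plift f, continuous_plift hf⟩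

theorem lift₂_toCTensor (f : E →ₗ[𝕜] F →ₗ[𝕜] X)
    (hf : Continuous (fun p : E × F => f p.1 p.2)) (t : ProjTensor 𝕜 E F) :
    lift₂ f hf (toCTensor 𝕜 E F t) = plift f t :=
  haveI : UniformContinuousConstSMul 𝕜 X := uniformContinuousConstSMul_of_continuousConstSMul 𝕜 X
  ContinuousLinearMap.fromCompletion_apply_coe
    (⟨plift f, continuous_plift hf⟩ : ProjTensor 𝕜 E F →L[𝕜] X) t

@[simp] theorem lift₂_ctmul (f : E →ₗ[𝕜] F →ₗ[𝕜] X)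
    (hf : Continuous (fun p : E × F => f p.1 p.2)) (x : E) (y : F) :
    lift₂ f hf (ctmul 𝕜 x y) = f x y :=
  (lift₂_toCTensor f hf _).trans (plift_ptmul f x y)

/-- If a family of bilinear maps is equibounded near the origin, so is the family of the induced
maps on the completed tensor product. -/
theorem lift₂_equibounded [ContinuousSMul 𝕜 E] [ContinuousSMul 𝕜 F] [IsTopologicalAddGroup E]
    [IsTopologicalAddGroup F] {ι : Type*} (f : ι → E →ₗ[𝕜] F →ₗ[𝕜] X)
    (hf : ∀ i, Continuous (fun p : E × F => f i p.1 p.2)) (r : Seminorm 𝕜 X) (hr : Continuous r)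
    {U : Set E} (hU : U ∈ 𝓝 (0 : E)) {V : Set F} (hV : V ∈ 𝓝 (0 : F))
    (h : ∀ i, ∀ x ∈ U, ∀ y ∈ V, r (f i x y) ≤ 1) :
    ∃ N ∈ 𝓝 (0 : CTensor 𝕜 E F), ∀ i, ∀ t ∈ N, r (lift₂ (f i) (hf i) t) ≤ 1 := by
  let p : ι → Seminorm 𝕜 (ProjTensor 𝕜 E F) := fun i => r.comp (plift (f i))
  have hbd : BddAbove (Set.range p) := by
    rw [Seminorm.bddAbove_range_iff]
    intro t
    refine TensorProduct.induction_on (motive := fun t : E ⊗[𝕜] F =>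
      BddAbove (Set.range fun i => p i (t : ProjTensor 𝕜 E F))) t ?_ ?_ ?_
    · refine ⟨0, ?_⟩
      rintro _ ⟨i, rfl⟩
      exact le_of_eq (map_zero (p i))
    · intro x y
      obtain ⟨c, hc, hcx⟩ := exists_smul_mem (𝕜 := 𝕜) hU x
      obtain ⟨d, hd, hdy⟩ := exists_smul_mem (𝕜 := 𝕜) hV y
      refine ⟨(c * d)⁻¹, ?_⟩
      rintro _ ⟨i, rfl⟩
      have h1 : r (f i x y) ≤ (c * d)⁻¹ := by
        refine seminorm_le_of_smul_le r (mul_pos hc hd) ?_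
        have := h i _ hcx _ hdy
        rwa [(f i _).map_smul, (f i).map_smul, LinearMap.smul_apply, smul_smul,
          ← RCLike.ofReal_mul, mul_comm d c] at this
      exact (congrArg r (plift_ptmul (f i) x y)).trans_le h1
    · rintro a b ⟨A, hA⟩ ⟨B, hB⟩
      refine ⟨A + B, ?_⟩
      rintro _ ⟨i, rfl⟩
      exact (map_add_le_add (p i) (a : ProjTensor 𝕜 E F) (b : ProjTensor 𝕜 E F)).trans
        (add_le_add (hA ⟨i, rfl⟩) (hB ⟨i, rfl⟩))
  let s : Seminorm 𝕜 (ProjTensor 𝕜 E F) := ⨆ i, p i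
  have hs : ∀ i, p i ≤ s := fun i => le_ciSup hbd i
  have hs1 : ∀ x ∈ U, ∀ y ∈ V, s (ptmul 𝕜 x y) ≤ 1 := by
    intro x hx y hy
    change (⨆ i, p i) _ ≤ 1
    rw [Seminorm.iSup_apply hbd]
    refine Real.iSup_le (fun i => ?_) zero_le_one
    exact (congrArg r (plift_ptmul (f i) x y)).trans_le (h i x hx y hy)
  have hsc : Continuous s := by
    let q : SeminormFamily 𝕜 (ProjTensor 𝕜 E F) Unit := fun _ => s
    let τ : TopologicalSpace (ProjTensor 𝕜 E F) := q.moduleFilterBasis.topology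
    have hq : WithSeminorms (topology := τ) q := @WithSeminorms.mk _ _ _ _ _ _ _ τ rfl
    have hle : instTopologicalSpaceProjTensor (𝕜 := 𝕜) (E := E) (F := F) ≤ τ := by
      refine sInf_le (show PolynormableSpace 𝕜 _ (topology := τ) ∧ Continuous[inferInstance, τ]
        (fun p : E × F => ptmul 𝕜 p.1 p.2) from
          ⟨@WithSeminorms.toPolynormableSpace _ _ _ _ _ _ τ _ hq, ?_⟩)
      exact @continuous_bilin 𝕜 _ E _ _ _ _ F _ _ _ _ (ProjTensor 𝕜 E F) _ _ _ _ τ Unit q hq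
        (TensorProduct.mk 𝕜 E F) (fun _ => ⟨U, hU, V, hV, hs1⟩)
    have h1 : Continuous[τ, inferInstance] s :=
      @WithSeminorms.continuous_seminorm _ _ _ _ _ _ τ q hq ()
    exact continuous_le_dom hle h1
  refine ⟨closure (toCTensor 𝕜 E F '' {t | s t < 1}), ?_, ?_⟩
  · have hopen : {t | s t < 1} ∈ 𝓝 (0 : ProjTensor 𝕜 E F) :=
      (isOpen_lt hsc continuous_const).mem_nhds (by simp)
    have hd : IsDenseInducing (toCTensor 𝕜 E F) :=
      Completion.isDenseInducing_coe (α := ProjTensor 𝕜 E F)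
    have := hd.closure_image_mem_nhds hopen
    rwa [map_zero] at this
  · intro i t ht
    have hcl : IsClosed {t : CTensor 𝕜 E F | r (lift₂ (f i) (hf i) t) ≤ 1} :=
      isClosed_le (hr.comp (lift₂ (f i) (hf i)).continuous) continuous_const
    refine closure_minimal ?_ hcl ht
    rintro _ ⟨a, ha, rfl⟩
    change r (lift₂ (f i) (hf i) (toCTensor 𝕜 E F a)) ≤ 1
    rw [lift₂_toCTensor]
    exact (hs i a).trans (le_of_lt ha)

variable {E' : Type*} [AddCommGroup E'] [Module 𝕜 E'] [TopologicalSpace E']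
variable {F' : Type*} [AddCommGroup F'] [Module 𝕜 F'] [TopologicalSpace F']

/-- The continuous linear map `f ⊗̂ g`. -/
noncomputable def cmap (f : E →L[𝕜] E') (g : F →L[𝕜] F') : CTensor 𝕜 E F →L[𝕜] CTensor 𝕜 E' F' :=
  lift₂ ((ctmulₗ 𝕜 E' F').compl₁₂ f.toLinearMap g.toLinearMap)
    (continuous_ctmul.comp (f.continuous.prodMap g.continuous))

@[simp] theorem cmap_ctmul (f : E →L[𝕜] E') (g : F →L[𝕜] F') (x : E) (y : F) :
    cmap f g (ctmul 𝕜 x y) = ctmul 𝕜 (f x) (g y) :=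
  lift₂_ctmul _ _ x y

section Trilinear

variable [ContinuousSMul 𝕜 E] [ContinuousSMul 𝕜 F] [ContinuousSMul 𝕜 G]
  [IsTopologicalAddGroup E] [IsTopologicalAddGroup F] [IsTopologicalAddGroup G]

theorem BddNearZero₃.bdd₂ {f : E →ₗ[𝕜] F →ₗ[𝕜] G →ₗ[𝕜] X} (hf : BddNearZero₃ f) (x : E) :
    BddNearZero₂ (f x) := by
  intro r hr
  obtain ⟨U, hU, V, hV, W, hW, h⟩ := hf r hr
  obtain ⟨c, hc, hcx⟩ := exists_smul_mem (𝕜 := 𝕜) hU x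
  refine ⟨_, smul_preimage_mem (𝕜 := 𝕜) hV ((c⁻¹ : ℝ) : 𝕜), W, hW, fun y hy z hz => ?_⟩
  have := h _ hcx _ hy _ hz
  rwa [(f _).map_smul, f.map_smul, LinearMap.smul_apply, LinearMap.smul_apply,
    LinearMap.smul_apply, smul_smul, ← RCLike.ofReal_mul, inv_mul_cancel₀ hc.ne',
    RCLike.ofReal_one, one_smul] at this

/-- The bilinear map `E × (F ⊗̂ G) → X` induced by a jointly continuous trilinear map. -/
noncomputable def lift₃Aux (f : E →ₗ[𝕜] F →ₗ[𝕜] G →ₗ[𝕜] X) (hf : BddNearZero₃ f) :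
    E →ₗ[𝕜] CTensor 𝕜 F G →ₗ[𝕜] X :=
  LinearMap.mk₂ 𝕜 (fun x t => lift₂ (f x) (hf.bdd₂ x).continuous t)
    (fun x x' t => by
      have : lift₂ (f (x + x')) (hf.bdd₂ (x + x')).continuous =
          lift₂ (f x) (hf.bdd₂ x).continuous + lift₂ (f x') (hf.bdd₂ x').continuous :=
        CTensor.ext fun y z => by simp
      exact congrArg (fun g : CTensor 𝕜 F G →L[𝕜] X => g t) this)
    (fun c x t => by
      have : lift₂ (f (c • x)) (hf.bdd₂ (c • x)).continuous =
          c • lift₂ (f x) (hf.bdd₂ x).continuous :=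
        CTensor.ext fun y z => by simp
      exact congrArg (fun g : CTensor 𝕜 F G →L[𝕜] X => g t) this)
    (fun x t t' => map_add _ t t')
    (fun c x t => map_smul _ c t)

theorem lift₃Aux_bdd (f : E →ₗ[𝕜] F →ₗ[𝕜] G →ₗ[𝕜] X) (hf : BddNearZero₃ f) :
    BddNearZero₂ (lift₃Aux f hf) := by
  intro r hr
  obtain ⟨U, hU, V, hV, W, hW, h⟩ := hf r hr
  obtain ⟨N, hN, h'⟩ := lift₂_equibounded (fun x : U => f x)
    (fun x => (hf.bdd₂ (x : E)).continuous) r hr hV hW (fun x y hy z hz => h x x.2 y hy z hz)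
  exact ⟨U, hU, N, hN, fun x hx t ht => h' ⟨x, hx⟩ t ht⟩

/-- The continuous linear map `E ⊗̂ (F ⊗̂ G) → X`, `x ⊗ (y ⊗ z) ↦ f x y z`, induced by a jointly
continuous trilinear map `f` into a complete Hausdorff locally convex space. -/
noncomputable def lift₃ (f : E →ₗ[𝕜] F →ₗ[𝕜] G →ₗ[𝕜] X) (hf : BddNearZero₃ f) :
    CTensor 𝕜 E (CTensor 𝕜 F G) →L[𝕜] X :=
  lift₂ (lift₃Aux f hf) (lift₃Aux_bdd f hf).continuous

@[simp] theorem lift₃_ctmul (f : E →ₗ[𝕜] F →ₗ[𝕜] G →ₗ[𝕜] X) (hf : BddNearZero₃ f)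
    (x : E) (y : F) (z : G) : lift₃ f hf (ctmul 𝕜 x (ctmul 𝕜 y z)) = f x y z :=
  (lift₂_ctmul _ _ x _).trans (lift₂_ctmul (f x) (hf.bdd₂ x).continuous y z)

end Trilinear

end Lift


/-! ### Well-behaved spaces -/

section WellBehaved

universe u v

/-- A continuous linear map `T` from a locally convex space to a normed space is nuclear if
`T x = ∑ cₙ φₙ(x) yₙ` with `(cₙ)` absolutely summable, `(φₙ)` equicontinuous and `(yₙ)` bounded. -/
def IsNuclearMap {𝕜 : Type u} [RCLike 𝕜] {E : Type v} [AddCommGroup E] [Module 𝕜 E]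
    [TopologicalSpace E] {F : Type v} [NormedAddCommGroup F] [NormedSpace 𝕜 F]
    (T : E →L[𝕜] F) : Prop :=
  ∃ (c : ℕ → 𝕜) (φ : ℕ → StrongDual 𝕜 E) (y : ℕ → F) (q : Seminorm 𝕜 E) (C : ℝ),
    Summable (fun n => ‖c n‖) ∧ Continuous q ∧ (∀ n x, ‖φ n x‖ ≤ q x) ∧ (∀ n, ‖y n‖ ≤ C) ∧
    ∀ x, HasSum (fun n => (c n * φ n x) • y n) (T x)

/-- A locally convex space is nuclear if every continuous linear map from it into a Banach space
is nuclear. -/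
def IsNuclearSpace (𝕜 : Type u) [RCLike 𝕜] (E : Type v) [AddCommGroup E] [Module 𝕜 E]
    [TopologicalSpace E] : Prop :=
  ∀ (F : Type v) [NormedAddCommGroup F] [NormedSpace 𝕜 F] [CompleteSpace F] (T : E →L[𝕜] F),
    IsNuclearMap T

/-- Fréchet spaces: complete metrizable locally convex spaces. -/
structure IsFrechetSpace (𝕜 : Type u) [RCLike 𝕜] (E : Type v) [AddCommGroup E] [Module 𝕜 E]
    [UniformSpace E] [IsUniformAddGroup E] : Prop where
  locallyConvex : PolynormableSpace 𝕜 E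
  hausdorff : T2Space E
  complete : CompleteSpace E
  firstCountable : FirstCountableTopology E

/-- Spaces that are isomorphic to the strong dual of a Fréchet space. -/
def IsDualOfFrechet (𝕜 : Type u) [RCLike 𝕜] (E : Type v) [AddCommGroup E] [Module 𝕜 E]
    [TopologicalSpace E] : Prop :=
  ∃ (F : Type v) (_ : AddCommGroup F) (_ : Module 𝕜 F) (_ : UniformSpace F)
    (_ : IsUniformAddGroup F), IsFrechetSpace 𝕜 F ∧ Nonempty (E ≃L[𝕜] StrongDual 𝕜 F)

/-- Well-behaved spaces: nuclear, and either Fréchet or the strong dual of a Fréchet space. -/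
def IsWellBehaved (𝕜 : Type u) [RCLike 𝕜] (E : Type v) [AddCommGroup E] [Module 𝕜 E]
    [UniformSpace E] [IsUniformAddGroup E] : Prop :=
  IsNuclearSpace 𝕜 E ∧ (IsFrechetSpace 𝕜 E ∨ IsDualOfFrechet 𝕜 E)

end WellBehaved

/-! ### Auxiliary maps between tensor products -/

section Aux

variable {𝕜 : Type*} [RCLike 𝕜]
variable {E : Type*} [AddCommGroup E] [Module 𝕜 E] [TopologicalSpace E]
  [ContinuousSMul 𝕜 E] [IsTopologicalAddGroup E]
variable {F : Type*} [AddCommGroup F] [Module 𝕜 F] [TopologicalSpace F]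
  [ContinuousSMul 𝕜 F] [IsTopologicalAddGroup F]
variable {G : Type*} [AddCommGroup G] [Module 𝕜 G] [TopologicalSpace G]
  [ContinuousSMul 𝕜 G] [IsTopologicalAddGroup G]
variable {E' : Type*} [AddCommGroup E'] [Module 𝕜 E'] [TopologicalSpace E']
  [ContinuousSMul 𝕜 E'] [IsTopologicalAddGroup E']
variable {F' : Type*} [AddCommGroup F'] [Module 𝕜 F'] [TopologicalSpace F']
  [ContinuousSMul 𝕜 F'] [IsTopologicalAddGroup F']

theorem ctmul_bdd (r : Seminorm 𝕜 (CTensor 𝕜 E F)) (hr : Continuous r) :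
    ∃ U ∈ 𝓝 (0 : E), ∃ V ∈ 𝓝 (0 : F), ∀ x ∈ U, ∀ y ∈ V, r (ctmul 𝕜 x y) ≤ 1 :=
  bddNearZero₂_of_continuous (f := ctmulₗ 𝕜 E F) continuous_ctmul r hr

theorem ctmul_add_left (x x' : E) (y : F) : ctmul 𝕜 (x + x') y = ctmul 𝕜 x y + ctmul 𝕜 x' y :=
  LinearMap.map_add₂ _ x x' y

theorem ctmul_smul_left (c : 𝕜) (x : E) (y : F) : ctmul 𝕜 (c • x) y = c • ctmul 𝕜 x y :=
  LinearMap.map_smul₂ _ c x y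

theorem ctmul_add_right (x : E) (y y' : F) : ctmul 𝕜 x (y + y') = ctmul 𝕜 x y + ctmul 𝕜 x y' :=
  map_add (ctmulₗ 𝕜 E F x) y y'

theorem ctmul_smul_right (c : 𝕜) (x : E) (y : F) : ctmul 𝕜 x (c • y) = c • ctmul 𝕜 x y :=
  map_smul (ctmulₗ 𝕜 E F x) c y

theorem cmap_add_left (f f' : E →L[𝕜] E') (g : F →L[𝕜] F') :
    cmap (f + f') g = cmap f g + cmap f' g :=
  CTensor.ext fun x y => by simp [ctmul_add_left]

theorem cmap_add_right (f : E →L[𝕜] E') (g g' : F →L[𝕜] F') :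
    cmap f (g + g') = cmap f g + cmap f g' :=
  CTensor.ext fun x y => by simp [ctmul_add_right]

theorem cmap_smul_left (c : 𝕜) (f : E →L[𝕜] E') (g : F →L[𝕜] F') :
    cmap (c • f) g = c • cmap f g :=
  CTensor.ext fun x y => by simp [ctmul_smul_left]

theorem cmap_smul_right (c : 𝕜) (f : E →L[𝕜] E') (g : F →L[𝕜] F') :
    cmap f (c • g) = c • cmap f g :=
  CTensor.ext fun x y => by simp [ctmul_smul_right]

theorem cmap_equibounded {ι : Type*} (f : ι → E →L[𝕜] E') (g : ι → F →L[𝕜] F')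
    (r : Seminorm 𝕜 (CTensor 𝕜 E' F')) (hr : Continuous r) {U' : Set E'} {V' : Set F'}
    (hUV : ∀ x ∈ U', ∀ y ∈ V', r (ctmul 𝕜 x y) ≤ 1) {U : Set E} (hU : U ∈ 𝓝 (0 : E))
    {V : Set F} (hV : V ∈ 𝓝 (0 : F)) (hf : ∀ i, ∀ x ∈ U, f i x ∈ U')
    (hg : ∀ i, ∀ y ∈ V, g i y ∈ V') :
    ∃ N ∈ 𝓝 (0 : CTensor 𝕜 E F), ∀ i, ∀ t ∈ N, r (cmap (f i) (g i) t) ≤ 1 :=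
  lift₂_equibounded
    (fun i => (ctmulₗ 𝕜 E' F').compl₁₂ (f i).toLinearMap (g i).toLinearMap)
    (fun i => continuous_ctmul.comp ((f i).continuous.prodMap (g i).continuous)) r hr hU hV
    (fun i x hx y hy => hUV _ (hf i x hx) _ (hg i y hy))

/-- The trilinear map `(x, y, z) ↦ (x ⊗ y) ⊗ z`. -/
noncomputable def assocTri : E →ₗ[𝕜] F →ₗ[𝕜] G →ₗ[𝕜] CTensor 𝕜 (CTensor 𝕜 E F) G :=
  (ctmulₗ 𝕜 E F).compr₂ (ctmulₗ 𝕜 (CTensor 𝕜 E F) G)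

theorem assocTri_bdd : BddNearZero₃ (assocTri : E →ₗ[𝕜] F →ₗ[𝕜] G →ₗ[𝕜] _) := by
  intro r hr
  obtain ⟨N, hN, W, hW, h⟩ := ctmul_bdd r hr
  have h0 : (fun p : E × F => ctmul 𝕜 p.1 p.2) ⁻¹' N ∈ 𝓝 ((0, 0) : E × F) := by
    refine (continuous_ctmul.continuousAt).preimage_mem_nhds ?_
    simpa [ctmul] using hN
  obtain ⟨U, hU, V, hV, hUV⟩ := mem_nhds_prod_iff.1 h0
  exact ⟨U, hU, V, hV, W, hW, fun x hx y hy z hz => h _ (hUV (Set.mk_mem_prod hx hy)) z hz⟩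

variable (𝕜 E F G) in
/-- The associativity map `E ⊗̂ (F ⊗̂ G) → (E ⊗̂ F) ⊗̂ G`, `x ⊗ (y ⊗ z) ↦ (x ⊗ y) ⊗ z`. -/
noncomputable def cassoc :
    CTensor 𝕜 E (CTensor 𝕜 F G) →L[𝕜] CTensor 𝕜 (CTensor 𝕜 E F) G :=
  lift₃ assocTri assocTri_bdd

/-- For `φ ∈ E°`, the map `φ ⊗̂ id : E ⊗̂ X → X`, `x ⊗ v ↦ φ(x) v`. -/
noncomputable def sliceLeft {X : Type*} [AddCommGroup X] [Module 𝕜 X] [UniformSpace X]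
    [IsUniformAddGroup X] [ContinuousSMul 𝕜 X] [PolynormableSpace 𝕜 X] [CompleteSpace X]
    [T2Space X] (φ : StrongDual 𝕜 E) : CTensor 𝕜 E X →L[𝕜] X :=
  lift₂ (LinearMap.lsmul 𝕜 X ∘ₗ φ.toLinearMap)
    ((φ.continuous.comp continuous_fst).smul continuous_snd)

@[simp] theorem sliceLeft_ctmul {X : Type*} [AddCommGroup X] [Module 𝕜 X] [UniformSpace X]
    [IsUniformAddGroup X] [ContinuousSMul 𝕜 X] [PolynormableSpace 𝕜 X] [CompleteSpace X]
    [T2Space X] (φ : StrongDual 𝕜 E) (x : E) (v : X) : sliceLeft φ (ctmul 𝕜 x v) = φ x • v :=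
  lift₂_ctmul _ _ x v

/-- For `φ ∈ F°`, the map `id ⊗̂ φ : X ⊗̂ F → X`, `v ⊗ y ↦ φ(y) v`. -/
noncomputable def sliceRight {X : Type*} [AddCommGroup X] [Module 𝕜 X] [UniformSpace X]
    [IsUniformAddGroup X] [ContinuousSMul 𝕜 X] [PolynormableSpace 𝕜 X] [CompleteSpace X]
    [T2Space X] (φ : StrongDual 𝕜 F) : CTensor 𝕜 X F →L[𝕜] X :=
  lift₂ (LinearMap.lsmul 𝕜 X ∘ₗ φ.toLinearMap).flip
    ((φ.continuous.comp continuous_snd).smul continuous_fst)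

end Aux

/-! ### Topological Hopf algebras -/

section Hopf

variable {𝕜 : Type*} [RCLike 𝕜]
variable {H : Type*} [Ring H] [Algebra 𝕜 H] [UniformSpace H] [IsUniformAddGroup H]
  [IsTopologicalRing H] [ContinuousSMul 𝕜 H] [PolynormableSpace 𝕜 H] [CompleteSpace H] [T2Space H]

variable (𝕜) in
/-- Right multiplication by `a`. -/
def rmul (a : H) : H →L[𝕜] H := ⟨LinearMap.mulRight 𝕜 a, continuous_mul_const a⟩

/-- For `s ∈ H ⊗̂ H`, the bilinear map `(c, d) ↦ s (c ⊗ d)`. -/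
noncomputable def tensorMulAux (s : CTensor 𝕜 H H) : H →ₗ[𝕜] H →ₗ[𝕜] CTensor 𝕜 H H :=
  LinearMap.mk₂ 𝕜 (fun c d => cmap (rmul 𝕜 c) (rmul 𝕜 d) s)
    (fun c c' d => by
      rw [show rmul 𝕜 (c + c') = rmul 𝕜 c + rmul 𝕜 c' from
        ContinuousLinearMap.ext fun x => mul_add x c c', cmap_add_left]; rfl)
    (fun k c d => by
      rw [show rmul 𝕜 (k • c) = k • rmul 𝕜 c from
        ContinuousLinearMap.ext fun x => mul_smul_comm k x c, cmap_smul_left]; rfl)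
    (fun c d d' => by
      rw [show rmul 𝕜 (d + d') = rmul 𝕜 d + rmul 𝕜 d' from
        ContinuousLinearMap.ext fun x => mul_add x d d', cmap_add_right]; rfl)
    (fun k c d => by
      rw [show rmul 𝕜 (k • d) = k • rmul 𝕜 d from
        ContinuousLinearMap.ext fun x => mul_smul_comm k x d, cmap_smul_right]; rfl)

theorem tensorMulAux_bdd (s : CTensor 𝕜 H H) : BddNearZero₂ (tensorMulAux s) := by
  intro r hr
  obtain ⟨U, hU, V, hV, hUV⟩ := ctmul_bdd r hr
  have hmul : ∀ W ∈ 𝓝 (0 : H), ∃ P ∈ 𝓝 (0 : H), ∃ Q ∈ 𝓝 (0 : H), ∀ x ∈ P, ∀ y ∈ Q,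
      x * y ∈ W := by
    intro W hW
    have h0 : (fun p : H × H => p.1 * p.2) ⁻¹' W ∈ 𝓝 ((0, 0) : H × H) :=
      continuous_mul.continuousAt.preimage_mem_nhds (by simpa using hW)
    obtain ⟨P, hP, Q, hQ, h⟩ := mem_nhds_prod_iff.1 h0
    exact ⟨P, hP, Q, hQ, fun x hx y hy => h (Set.mk_mem_prod hx hy)⟩
  obtain ⟨P₁, hP₁, Q₁, hQ₁, h₁⟩ := hmul U hU
  obtain ⟨P₂, hP₂, Q₂, hQ₂, h₂⟩ := hmul V hV
  obtain ⟨N, hN, h⟩ := cmap_equibounded (fun i : Q₁ × Q₂ => rmul 𝕜 (i.1 : H))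
    (fun i => rmul 𝕜 (i.2 : H)) r hr hUV hP₁ hP₂ (fun i x hx => h₁ x hx _ i.1.2)
    (fun i x hx => h₂ x hx _ i.2.2)
  obtain ⟨k, hk, hks⟩ := exists_smul_mem (𝕜 := 𝕜) hN s
  refine ⟨_, smul_preimage_mem (𝕜 := 𝕜) hQ₁ ((k⁻¹ : ℝ) : 𝕜), Q₂, hQ₂, fun c hc d hd => ?_⟩
  have h3 : r (cmap (rmul 𝕜 (((k⁻¹ : ℝ) : 𝕜) • c)) (rmul 𝕜 d) ((k : 𝕜) • s)) ≤ 1 :=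
    h (⟨_, hc⟩, ⟨d, hd⟩) _ hks
  rw [show rmul 𝕜 (((k⁻¹ : ℝ) : 𝕜) • c) = ((k⁻¹ : ℝ) : 𝕜) • rmul 𝕜 c from
    ContinuousLinearMap.ext fun x => mul_smul_comm _ x c, cmap_smul_left, map_smul,
    _root_.smul_apply, smul_smul, ← RCLike.ofReal_mul, mul_inv_cancel₀ hk.ne',
    RCLike.ofReal_one, one_smul] at h3
  exact h3

/-- The product of `H ⊗̂ H`: the continuous extension of `(a ⊗ b) (c ⊗ d) = a c ⊗ b d`. -/
noncomputable def tensorMul (s t : CTensor 𝕜 H H) : CTensor 𝕜 H H :=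
  lift₂ (tensorMulAux s) (tensorMulAux_bdd s).continuous t

@[simp] theorem tensorMul_ctmul (a b c d : H) :
    tensorMul (ctmul 𝕜 a b) (ctmul 𝕜 c d) = ctmul 𝕜 (a * c) (b * d) :=
  (lift₂_ctmul _ _ c d).trans (cmap_ctmul _ _ a b)

variable (𝕜 H) in
/-- A topological Hopf algebra: a complete Hausdorff locally convex algebra `H` with (jointly)
continuous multiplication, together with continuous linear maps `Δ : H → H ⊗̂ H`, `ε : H → 𝕜`,
`S : H → H` satisfying the axioms of a Hopf algebra. -/
structure TopHopfAlgebra where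
  /-- the comultiplication `Δ` -/
  comul : H →L[𝕜] CTensor 𝕜 H H
  /-- the counit `ε` -/
  counit : StrongDual 𝕜 H
  /-- the antipode `S` -/
  antipode : H →L[𝕜] H
  coassoc : ∀ h, cassoc 𝕜 H H H (cmap (.id 𝕜 H) comul (comul h)) =
    cmap comul (.id 𝕜 H) (comul h)
  counit_left : ∀ h, sliceLeft counit (comul h) = h
  counit_right : ∀ h, sliceRight counit (comul h) = h
  comul_one : comul 1 = ctmul 𝕜 1 1
  comul_mul : ∀ a b, comul (a * b) = tensorMul (comul a) (comul b)
  counit_one : counit 1 = 1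
  counit_mul : ∀ a b, counit (a * b) = counit a * counit b
  antipode_left : ∀ h,
    lift₂ ((LinearMap.mul 𝕜 H).compl₁₂ antipode.toLinearMap LinearMap.id)
      ((antipode.continuous.comp continuous_fst).mul continuous_snd) (comul h) = counit h • 1
  antipode_right : ∀ h,
    lift₂ ((LinearMap.mul 𝕜 H).compl₁₂ LinearMap.id antipode.toLinearMap)
      (continuous_fst.mul (antipode.continuous.comp continuous_snd)) (comul h) = counit h • 1

namespace TopHopfAlgebra

variable (A : TopHopfAlgebra 𝕜 H)

/-- The iterated comultiplication `h ↦ h₁ ⊗ (h₂ ⊗ h₃)`. -/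
noncomputable def comul₃ : H →L[𝕜] CTensor 𝕜 H (CTensor 𝕜 H H) :=
  cmap (.id 𝕜 H) A.comul ∘L A.comul

/-- The convolution product of `H°`: `(φ ψ)(x) = φ(x₁) ψ(x₂)`. -/
noncomputable def conv (φ ψ : StrongDual 𝕜 H) : StrongDual 𝕜 H :=
  lift₂ ((LinearMap.mul 𝕜 𝕜).compl₁₂ φ.toLinearMap ψ.toLinearMap)
    ((φ.continuous.comp continuous_fst).mul (ψ.continuous.comp continuous_snd)) ∘L A.comul

/-- The map `x ↦ S(c) x a`. -/
def conj (a c : H) : H →L[𝕜] H :=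
  ⟨LinearMap.mulRight 𝕜 a ∘ₗ LinearMap.mulLeft 𝕜 (A.antipode c),
    (continuous_const.mul continuous_id).mul continuous_const⟩

@[simp] theorem conj_apply (a c x : H) : A.conj a c x = A.antipode c * x * a := rfl

theorem conv_apply (φ ψ : StrongDual 𝕜 H) (x : H) :
    A.conv φ ψ x = ψ (sliceLeft φ (A.comul x)) := by
  have : lift₂ ((LinearMap.mul 𝕜 𝕜).compl₁₂ φ.toLinearMap ψ.toLinearMap)
      ((φ.continuous.comp continuous_fst).mul (ψ.continuous.comp continuous_snd)) =
      ψ ∘L sliceLeft φ := CTensor.ext fun a b => by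
    refine (lift₂_ctmul _ _ a b).trans ?_
    simp
  exact congrArg (fun f : CTensor 𝕜 H H →L[𝕜] 𝕜 => f (A.comul x)) this

theorem conv_add (φ ψ ψ' : StrongDual 𝕜 H) : A.conv φ (ψ + ψ') = A.conv φ ψ + A.conv φ ψ' := by
  ext x; simp [conv_apply]

theorem conv_smul (k : 𝕜) (φ ψ : StrongDual 𝕜 H) : A.conv φ (k • ψ) = k • A.conv φ ψ := by
  ext x; simp [conv_apply]

theorem comp_conj_add_left (ψ : StrongDual 𝕜 H) (a a' c : H) :
    ψ ∘L A.conj (a + a') c = ψ ∘L A.conj a c + ψ ∘L A.conj a' c := by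
  ext x; simp [mul_add]

theorem comp_conj_smul_left (ψ : StrongDual 𝕜 H) (k : 𝕜) (a c : H) :
    ψ ∘L A.conj (k • a) c = k • (ψ ∘L A.conj a c) := by
  ext x; simp

theorem comp_conj_add_right (ψ : StrongDual 𝕜 H) (a c c' : H) :
    ψ ∘L A.conj a (c + c') = ψ ∘L A.conj a c + ψ ∘L A.conj a c' := by
  ext x; simp [add_mul]

theorem comp_conj_smul_right (ψ : StrongDual 𝕜 H) (k : 𝕜) (a c : H) :
    ψ ∘L A.conj a (k • c) = k • (ψ ∘L A.conj a c) := by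
  ext x; simp

theorem conj_bdd (W : Set H) (hW : W ∈ 𝓝 (0 : H)) : ∃ P ∈ 𝓝 (0 : H), ∃ Q ∈ 𝓝 (0 : H),
    ∃ R ∈ 𝓝 (0 : H), ∀ a ∈ P, ∀ c ∈ Q, ∀ x ∈ R, A.conj a c x ∈ W := by
  have hc : Continuous fun p : H × H × H => A.antipode p.2.1 * p.2.2 * p.1 := by fun_prop
  have h0 : (fun p : H × H × H => A.antipode p.2.1 * p.2.2 * p.1) ⁻¹' W ∈
      𝓝 ((0, 0, 0) : H × H × H) :=
    hc.continuousAt.preimage_mem_nhds (by simpa using hW)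
  obtain ⟨P, hP, QR, hQR, h⟩ := mem_nhds_prod_iff.1 h0
  obtain ⟨Q, hQ, R, hR, h'⟩ := mem_nhds_prod_iff.1 hQR
  exact ⟨P, hP, Q, hQ, R, hR, fun a ha c hc x hx =>
    h (Set.mk_mem_prod ha (h' (Set.mk_mem_prod hc hx)))⟩

/-! ### Topological modules, comodules and anti-Yetter-Drinfeld modules -/

variable {V : Type*} [AddCommGroup V] [Module 𝕜 V] [UniformSpace V] [IsUniformAddGroup V]
  [ContinuousSMul 𝕜 V] [PolynormableSpace 𝕜 V] [CompleteSpace V] [T2Space V]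

variable (𝕜 H V) in
/-- A topological right `H`-module structure on `V`: a unital right module structure whose action
`V × H → V` is jointly continuous, i.e. is given by a continuous linear map `V ⊗̂ H → V`. -/
structure TopRightModule where
  /-- the action `(v, h) ↦ v · h` -/
  act : V →ₗ[𝕜] H →ₗ[𝕜] V
  continuous_act : Continuous (fun p : V × H => act p.1 p.2)
  act_one : ∀ v, act v 1 = v
  act_mul : ∀ v a b, act v (a * b) = act (act v a) b

/-- The operator `v ↦ v · h`. -/
def TopRightModule.op (M : TopRightModule 𝕜 H V) (h : H) : V →L[𝕜] V :=
  ⟨M.act.flip h, M.continuous_act.comp (continuous_id.prodMk continuous_const)⟩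

@[simp] theorem TopRightModule.op_apply (M : TopRightModule 𝕜 H V) (h : H) (v : V) :
    M.op h v = M.act v h := rfl

variable (V) in
/-- A topological left `H`-comodule structure on `V`: a continuous, coassociative and counital
coaction `V → H ⊗̂ V`. -/
structure TopLeftComodule where
  /-- the coaction `v ↦ v₋₁ ⊗ v₀` -/
  coact : V →L[𝕜] CTensor 𝕜 H V
  coassoc : ∀ v, cassoc 𝕜 H H V (cmap (.id 𝕜 H) coact (coact v)) =
    cmap A.comul (.id 𝕜 V) (coact v)
  counit : ∀ v, sliceLeft A.counit (coact v) = v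

/-- For `t = ∑ x ⊗ v ∈ H ⊗̂ V`, the trilinear map `(a, b, c) ↦ ∑ S(c) x a ⊗ v · b`. -/
noncomputable def aydTri (M : TopRightModule 𝕜 H V) (t : CTensor 𝕜 H V) :
    H →ₗ[𝕜] H →ₗ[𝕜] H →ₗ[𝕜] CTensor 𝕜 H V :=
  LinearMap.mk₂ 𝕜
    (fun a b =>
      { toFun := fun c => cmap (A.conj a c) (M.op b) t
        map_add' := fun c c' => by
          rw [show A.conj a (c + c') = A.conj a c + A.conj a c' from
            ContinuousLinearMap.ext fun x => by simp [add_mul], cmap_add_left]; rfl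
        map_smul' := fun k c => by
          rw [show A.conj a (k • c) = k • A.conj a c from
            ContinuousLinearMap.ext fun x => by simp, cmap_smul_left]; rfl })
    (fun a a' b => LinearMap.ext fun c => by
      change cmap (A.conj (a + a') c) (M.op b) t = _
      rw [show A.conj (a + a') c = A.conj a c + A.conj a' c from
        ContinuousLinearMap.ext fun x => by simp [mul_add], cmap_add_left]; rfl)
    (fun k a b => LinearMap.ext fun c => by
      change cmap (A.conj (k • a) c) (M.op b) t = _
      rw [show A.conj (k • a) c = k • A.conj a c from
        ContinuousLinearMap.ext fun x => by simp, cmap_smul_left]; rfl)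
    (fun a b b' => LinearMap.ext fun c => by
      change cmap (A.conj a c) (M.op (b + b')) t = _
      rw [show M.op (b + b') = M.op b + M.op b' from
        ContinuousLinearMap.ext fun v => by simp, cmap_add_right]; rfl)
    (fun k a b => LinearMap.ext fun c => by
      change cmap (A.conj a c) (M.op (k • b)) t = _
      rw [show M.op (k • b) = k • M.op b from
        ContinuousLinearMap.ext fun v => by simp, cmap_smul_right]; rfl)

theorem aydTri_apply (M : TopRightModule 𝕜 H V) (t : CTensor 𝕜 H V) (a b c : H) :
    A.aydTri M t a b c = cmap (A.conj a c) (M.op b) t := rfl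

theorem aydTri_bdd (M : TopRightModule 𝕜 H V) (t : CTensor 𝕜 H V) :
    BddNearZero₃ (A.aydTri M t) := by
  intro r hr
  obtain ⟨U, hU, W, hW, hUW⟩ := ctmul_bdd r hr
  obtain ⟨P, hP, Q, hQ, R, hR, h⟩ := A.conj_bdd U hU
  have h0 : (fun p : V × H => M.act p.1 p.2) ⁻¹' W ∈ 𝓝 ((0, 0) : V × H) :=
    M.continuous_act.continuousAt.preimage_mem_nhds (by simpa using hW)
  obtain ⟨R', hR', B, hB, h'⟩ := mem_nhds_prod_iff.1 h0
  obtain ⟨N, hN, h''⟩ := cmap_equibounded (fun i : (P × Q) × B => A.conj (i.1.1 : H) (i.1.2 : H))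
    (fun i => M.op (i.2 : H)) r hr hUW hR hR'
    (fun i x hx => h _ i.1.1.2 _ i.1.2.2 x hx)
    (fun i v hv => h' (Set.mk_mem_prod hv i.2.2))
  obtain ⟨k, hk, hkt⟩ := exists_smul_mem (𝕜 := 𝕜) hN t
  refine ⟨_, smul_preimage_mem (𝕜 := 𝕜) hP ((k⁻¹ : ℝ) : 𝕜), B, hB, Q, hQ,
    fun a ha b hb c hc => ?_⟩
  have h3 : r (A.aydTri M ((k : 𝕜) • t) (((k⁻¹ : ℝ) : 𝕜) • a) b c) ≤ 1 :=
    h'' ((⟨_, ha⟩, ⟨c, hc⟩), ⟨b, hb⟩) _ hkt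
  rw [LinearMap.map_smul, LinearMap.smul_apply, LinearMap.smul_apply, aydTri_apply,
    ContinuousLinearMap.map_smul, smul_smul,
    ← RCLike.ofReal_mul, inv_mul_cancel₀ hk.ne', RCLike.ofReal_one, one_smul] at h3
  exact h3

variable {A} in
/-- The right-left anti-Yetter-Drinfeld condition
`∇(v · h) = S(h₃) v₋₁ h₁ ⊗ v₀ · h₂` for a topological right module / left comodule `V`. -/
def IsAYD (M : TopRightModule 𝕜 H V) (N : A.TopLeftComodule V) : Prop :=
  ∀ v h, N.coact (M.act v h) = lift₃ (A.aydTri M (N.coact v)) (A.aydTri_bdd M (N.coact v))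
    (A.comul₃ h)

/-! ### The topological anti-Drinfeld double -/

variable (𝕜 H) in
/-- The space `H° ⊗̂_π H` underlying the anti-Drinfeld double, `H°` being the strong dual. -/
abbrev AYDDouble : Type _ := CTensor 𝕜 (StrongDual 𝕜 H) H

/-- The trilinear map `(a, b, c) ↦ φ * φ'(S(c) - a) ⊗ b h'` into `H° ⊗̂ H`. -/
noncomputable def doubleTri (φ φ' : StrongDual 𝕜 H) (h' : H) :
    H →ₗ[𝕜] H →ₗ[𝕜] H →ₗ[𝕜] AYDDouble 𝕜 H :=
  LinearMap.mk₂ 𝕜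
    (fun a b =>
      { toFun := fun c => ctmul 𝕜 (A.conv φ (φ' ∘L A.conj a c)) (b * h')
        map_add' := fun c c' => by
          rw [comp_conj_add_right, conv_add, ctmul_add_left]
        map_smul' := fun k c => by
          rw [comp_conj_smul_right, conv_smul, ctmul_smul_left]; rfl })
    (fun a a' b => LinearMap.ext fun c => by
      change ctmul 𝕜 (A.conv φ (φ' ∘L A.conj (a + a') c)) (b * h') = _
      rw [comp_conj_add_left, conv_add, ctmul_add_left]; rfl)
    (fun k a b => LinearMap.ext fun c => by
      change ctmul 𝕜 (A.conv φ (φ' ∘L A.conj (k • a) c)) (b * h') = _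
      rw [comp_conj_smul_left, conv_smul, ctmul_smul_left]; rfl)
    (fun a b b' => LinearMap.ext fun c => by
      change ctmul 𝕜 (A.conv φ (φ' ∘L A.conj a c)) ((b + b') * h') = _
      rw [add_mul, ctmul_add_right]; rfl)
    (fun k a b => LinearMap.ext fun c => by
      change ctmul 𝕜 (A.conv φ (φ' ∘L A.conj a c)) ((k • b) * h') = _
      rw [smul_mul_assoc, ctmul_smul_right]; rfl)

theorem doubleTri_bdd (φ φ' : StrongDual 𝕜 H) (h' : H) :
    BddNearZero₃ (A.doubleTri φ φ' h') := by
  intro r hr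
  obtain ⟨N, hN, W, hW, hNW⟩ := ctmul_bdd r hr
  obtain ⟨⟨K, D⟩, ⟨hK, hD⟩, hKD⟩ :=
    (ContinuousLinearMap.hasBasis_nhds_zero (σ := RingHom.id 𝕜) (E := H) (F := 𝕜)).mem_iff.1 hN
  let g : H →L[𝕜] H := sliceLeft φ ∘L A.comul
  have hgK : Bornology.IsVonNBounded 𝕜 (g '' K) := Bornology.IsVonNBounded.image hK g
  have hφ' : φ' ⁻¹' D ∈ 𝓝 (0 : H) :=
    φ'.continuous.continuousAt.preimage_mem_nhds (by simpa using hD)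
  obtain ⟨P, hP, Q, hQ, R, hR, h⟩ := A.conj_bdd _ hφ'
  obtain ⟨k, hk⟩ := (hgK hR).eventually.exists
  refine ⟨_, smul_preimage_mem (𝕜 := 𝕜) hP k, (fun b => b * h') ⁻¹' W, ?_, Q, hQ,
    fun a ha b hb c hc => hNW _ (hKD fun x hx => ?_) _ hb⟩
  · exact (continuous_mul_const h').continuousAt.preimage_mem_nhds (by simpa using hW)
  · obtain ⟨u, hu, hux⟩ := hk ⟨x, hx, rfl⟩
    rw [conv_apply]
    have h2 : φ' (A.conj (k • a) c u) ∈ D := h _ ha _ hc _ hu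
    have h3 : A.conj (k • a) c u = A.conj a c (sliceLeft φ (A.comul x)) := by
      have : sliceLeft φ (A.comul x) = k • u := hux.symm
      rw [this]; simp
    rwa [h3] at h2

/-- The product of elementary tensors in the anti-Drinfeld double:
`(φ ⊗ h)(φ' ⊗ h') = φ'₁(S(h₃)) φ'₃(h₁) φ φ'₂ ⊗ h₂ h'`,
where `φ'₁(S(c)) φ'₃(a) φ'₂` is the functional `x ↦ φ'(S(c) x a)`. -/
noncomputable def doubleProd (φ : StrongDual 𝕜 H) (h : H) (φ' : StrongDual 𝕜 H) (h' : H) :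
    AYDDouble 𝕜 H :=
  lift₃ (A.doubleTri φ φ' h') (A.doubleTri_bdd φ φ' h') (A.comul₃ h)

/-- The map `μ` is the multiplication of the anti-Drinfeld double: the separately continuous
bilinear extension to `H° ⊗̂ H` of the product of elementary tensors. -/
structure IsDoubleMul (μ : AYDDouble 𝕜 H →ₗ[𝕜] AYDDouble 𝕜 H →L[𝕜] AYDDouble 𝕜 H) : Prop where
  continuous_left : ∀ b, Continuous (fun a => μ a b)
  mul_ctmul : ∀ φ h φ' h', μ (ctmul 𝕜 φ h) (ctmul 𝕜 φ' h') = A.doubleProd φ h φ' h'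

/-- The unit `ε ⊗ 1` of the anti-Drinfeld double. -/
noncomputable def doubleOne : AYDDouble 𝕜 H := ctmul 𝕜 A.counit 1

/-- A right module structure `β` on `V` over the anti-Drinfeld double with multiplication `μ`:
unital, associative, and separately continuous (as the multiplication of the double is). -/
structure IsDoubleModule (μ : AYDDouble 𝕜 H →ₗ[𝕜] AYDDouble 𝕜 H →L[𝕜] AYDDouble 𝕜 H)
    (β : V →ₗ[𝕜] AYDDouble 𝕜 H →L[𝕜] V) : Prop where
  continuous_left : ∀ b, Continuous (fun v => β v b)
  act_one : ∀ v, β v A.doubleOne = v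
  act_mul : ∀ v a b, β v (μ a b) = β (β v a) b

/-- The map `λ : H° ⊗̂ H → End(H)`, `λ(φ ⊗ h)(x) = φ(x) h`. -/
noncomputable def toEnd (T : AYDDouble 𝕜 H) (x : H) : H :=
  lift₂ (LinearMap.mk₂ 𝕜 (fun (φ : StrongDual 𝕜 H) (h : H) => φ x • h)
      (fun φ φ' h => by simp [add_smul]) (fun k φ h => by simp [mul_smul])
      (fun φ h h' => smul_add _ h h') (fun k φ h => smul_comm _ k h))
    (((continuous_eval_const x).comp continuous_fst).smul continuous_snd) T

/-- For a continuous linear map `g : H° → V`, the map `H° ⊗̂ H → H ⊗̂ V`, `f ⊗ x ↦ x ⊗ g(f)`. -/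
noncomputable def swapMap (g : StrongDual 𝕜 H →L[𝕜] V) : AYDDouble 𝕜 H →L[𝕜] CTensor 𝕜 H V :=
  lift₂ ((ctmulₗ 𝕜 H V).compl₁₂ LinearMap.id g.toLinearMap).flip
    (continuous_ctmul.comp (continuous_snd.prodMk (g.continuous.comp continuous_fst)))

/-- The map `H° → H° ⊗̂ H`, `φ ↦ φ ⊗ 1`. -/
noncomputable def dualIncl : StrongDual 𝕜 H →L[𝕜] AYDDouble 𝕜 H :=
  ⟨(ctmulₗ 𝕜 (StrongDual 𝕜 H) H).flip 1, continuous_ctmul.comp (continuous_id.prodMk continuous_const)⟩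

end TopHopfAlgebra

end Hopf

end TopHopf

open TopHopf TopHopf.TopHopfAlgebra

/-! The whole statement is transported to operators. For nuclear `H` the map `λ` is a topological
isomorphism of `H° ⊗̂ H` with `L(H, H)`, the topology being that of uniform convergence on bounded
sets (`doubleEquivEnd`). Existence and uniqueness of `ρ` amount to its bijectivity, and the product
of the double becomes `(T * T')(x) = h₂ T'(S(h₃) x₂ h₁)` with `h = T(x₁)` (`star`).

Analysis. Nuclearity gives finite-rank approximations of the identity with a bound on their nuclear
sums that does not depend on the accuracy (`IsNuclearSpace.approx`). Hence continuous seminorms on a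
tensor product with a nuclear factor are controlled by slices (`IsNuclearSpace.seminorm_le_slices`):
elements are determined by their slices, `λ` is an embedding with dense complete image, and `T ↦ T
⊗̂ id` is continuous. Besides nuclearity, the construction of the double needs only that `H` is
barrelled with complete strong dual. For Fréchet spaces this is classical. For a nuclear strong
dual, the approximations show that the Fréchet predual is reflexive (`dualEval_surjective`), and
both properties follow.

Algebra. Everything is expressed by the twist `h ⊗ y ↦ h₂ ⊗ S(h₃) y h₁`, a composite of `h ⊗ y ↦ h₂
⊗ y h₁` and `h ⊗ y ↦ h₁ ⊗ S(h₂) y`. The second map inverts `h ⊗ y ↦ h₁ ⊗ h₂ y`. So its compatibility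
with products, coproducts and the counit follows by inverting the evident identities for
multiplication; neither bijectivity nor anti-multiplicativity of `S` is needed. The results
`twist_mul`, `twist_comul` and `counit_twist` make `star` associative and unital.

Modules. An AYD module is acted on by `v · b = v₀ · λ(b)(v₋₁)`; the AYD condition says that `∇` of
`v · h` is the twist applied to `h ⊗ ∇(v)`, followed by the action (`coact_act`), which is exactly
what associativity requires. Conversely, `λ(ρ) = id` says that the slice of `∑ xᵢ ⊗ g(fⁱ)` by `φ` is
`g(φ)` (`sliceLeft_swapMap`). After slicing, the comodule axioms and the AYD condition become
instances of associativity of the action, and the factorization `φ ⊗ h = (φ ⊗ 1)(ε ⊗ h)` makes the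
two constructions inverse. Joint continuity of the restricted action comes, in the two unmixed
cases, from the theorem that separate continuity implies joint continuity
(`continuous_of_separately_continuous`). -/

namespace TopHopf

/-! ### Seminorms and Hahn–Banach -/

section Seminorms

variable {𝕜 : Type*} [RCLike 𝕜] {E : Type*} [AddCommGroup E] [Module 𝕜 E]

theorem seminorm_le_of_le_one {r p : Seminorm 𝕜 E} (h : ∀ x, p x ≤ 1 → r x ≤ 1) (x : E) :
    r x ≤ p x := by
  -- The `δ` allows normalization when `p x = 0`.
  refine le_of_forall_pos_le_add fun δ hδ => ?_
  have hc : 0 < p x + δ := add_pos_of_nonneg_of_pos (apply_nonneg p x) hδ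
  have h1 : r ((((p x + δ)⁻¹ : ℝ) : 𝕜) • x) ≤ 1 := by
    refine h _ ?_
    rw [map_smul_eq_mul, RCLike.norm_ofReal, abs_of_pos (inv_pos.2 hc), inv_mul_le_iff₀ hc]
    linarith
  simpa using seminorm_le_of_smul_le r (inv_pos.2 hc) h1

/-- The seminorm `x ↦ ‖f x‖` of a linear functional. -/
def dualSeminorm (f : E →ₗ[𝕜] 𝕜) : Seminorm 𝕜 E := (normSeminorm 𝕜 𝕜).comp f

theorem norm_le_of_le_one {f : E →ₗ[𝕜] 𝕜} {p : Seminorm 𝕜 E} (h : ∀ x, p x ≤ 1 → ‖f x‖ ≤ 1)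
    (x : E) : ‖f x‖ ≤ p x :=
  seminorm_le_of_le_one (r := dualSeminorm f) h x

variable [TopologicalSpace E]

theorem seminorm_ball_mem_nhds {p : Seminorm 𝕜 E} (hp : Continuous p) {ε : ℝ} (hε : 0 < ε) :
    {x | p x ≤ ε} ∈ 𝓝 (0 : E) :=
  Filter.mem_of_superset ((isOpen_lt hp continuous_const).mem_nhds (by simpa using hε))
    fun x hx => le_of_lt (show p x < ε from hx)

theorem exists_seminorm_of_mem_nhds [PolynormableSpace 𝕜 E] {U : Set E} (hU : U ∈ 𝓝 (0 : E)) :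
    ∃ p : Seminorm 𝕜 E, Continuous p ∧ ∀ x, p x ≤ 1 → x ∈ U := by
  obtain ⟨V, hV1, hV2⟩ := (PolynormableSpace.withSeminorms 𝕜 E).hasBasis.mem_iff.1 hU
  obtain ⟨s, r, hr, rfl⟩ := (SeminormFamily.basisSets_iff _).1 hV1
  have := (PolynormableSpace.withSeminorms 𝕜 E).topologicalAddGroup
  let P := s.sup (fun p : {p : Seminorm 𝕜 E // Continuous p} => p.1)
  have hc : Continuous P := Seminorm.continuous_finsetSup fun i _ => i.2
  -- The factor 2 puts the closed unit ball of `d • P` inside the open `P`-ball of radius `r`.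
  let d : NNReal := ⟨2 / r, by positivity⟩
  have hd : ∀ x, (d • P) x = 2 / r * P x := fun x => rfl
  refine ⟨d • P, ?_, fun x hx => hV2 ?_⟩
  · have : Continuous fun x => 2 / r * P x := continuous_const.mul hc
    exact this
  · rw [hd, div_mul_eq_mul_div, div_le_one hr] at hx
    have := apply_nonneg P x
    change x ∈ Seminorm.ball P 0 r
    rw [Seminorm.mem_ball, sub_zero]
    linarith

theorem continuous_seminorm_of_mem_nhds [IsTopologicalAddGroup E] [ContinuousConstSMul 𝕜 E]
    {p : Seminorm 𝕜 E} (h : {x | p x ≤ 1} ∈ 𝓝 (0 : E)) : Continuous p :=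
  Seminorm.continuous' (r := 1) (by simpa [Seminorm.closedBall_zero_eq] using h)

/-- A locally convex space has, for every continuous seminorm, enough dominated functionals. -/
theorem exists_dual_eq_seminorm [PolynormableSpace 𝕜 E] {p : Seminorm 𝕜 E} (hp : Continuous p)
    (x : E) : ∃ f : StrongDual 𝕜 E, (∀ y, ‖f y‖ ≤ p y) ∧ f x = (p x : 𝕜) := by
  by_cases hx : x = 0
  · subst hx
    exact ⟨0, fun y => by simp, by simp⟩
  -- The functional `c • x ↦ c p(x)` on the line through `x` is extended by Hahn–Banach.
  let f : Module.Dual 𝕜 (𝕜 ∙ x) :=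
    (p x : 𝕜) • (LinearEquiv.toSpanNonzeroSingleton 𝕜 E x hx).symm.toLinearMap
  have hf : ∀ c : 𝕜, ∀ h, f ⟨c • x, h⟩ = (p x : 𝕜) * c := by
    intro c h
    have : (LinearEquiv.toSpanNonzeroSingleton 𝕜 E x hx).symm ⟨c • x, h⟩ = c := by
      rw [LinearEquiv.symm_apply_eq]; rfl
    simp [f, this, RCLike.real_smul_eq_coe_mul]
  obtain ⟨g, hg, hgp⟩ := Module.Dual.exists_continuous_extension_of_le_seminorm (𝕜 ∙ x) f hp
    (fun y => by
      obtain ⟨y, hy⟩ := y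
      obtain ⟨c, rfl⟩ := Submodule.mem_span_singleton.1 hy
      rw [hf]
      simp [abs_of_nonneg, map_smul_eq_mul, mul_comm])
  refine ⟨g, hgp, ?_⟩
  have := hg ⟨(1 : 𝕜) • x, Submodule.smul_mem _ _ (Submodule.mem_span_singleton_self x)⟩
  rw [hf] at this
  simpa using this

/-- By Hahn–Banach, `p x` is attained at a functional dominated by `p`. This reduces seminorm
estimates to scalar ones. -/
theorem seminorm_le_of_dual [PolynormableSpace 𝕜 E] {p : Seminorm 𝕜 E} (hp : Continuous p)
    {x : E} {M : ℝ} (h : ∀ f : StrongDual 𝕜 E, (∀ y, ‖f y‖ ≤ p y) → ‖f x‖ ≤ M) : p x ≤ M := by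
  obtain ⟨f, hf, hfx⟩ := exists_dual_eq_seminorm hp x
  have := h f hf
  rwa [hfx, RCLike.norm_ofReal, abs_of_nonneg (apply_nonneg p x)] at this

theorem eq_zero_of_forall_seminorm [PolynormableSpace 𝕜 E] [T2Space E] {x : E}
    (h : ∀ p : Seminorm 𝕜 E, Continuous p → p x = 0) : x = 0 := by
  by_contra hx
  obtain ⟨i, hi⟩ := (PolynormableSpace.withSeminorms 𝕜 E).separating_of_T1 x hx
  exact hi (h i.1 i.2)

open scoped ComplexOrder in
instance [IsTopologicalAddGroup E] [ContinuousSMul 𝕜 E] :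
    PolynormableSpace 𝕜 (StrongDual 𝕜 E) := by
  -- In the order of `𝕜` the nonnegative scalars are the nonnegative reals, so convexity over `𝕜` is
  -- real convexity.
  have : LocallyConvexSpace 𝕜 𝕜 :=
    LocallyConvexSpace.ofBasisZero 𝕜 𝕜 (fun r : ℝ => Metric.ball (0 : 𝕜) r) (fun r => 0 < r)
      Metric.nhds_basis_ball fun r _ => convex_of_nonneg_surjective_algebraMap _
        (fun _ => RCLike.nonneg_iff_exists_ofReal.mp) (convex_ball (0 : 𝕜) r)
  have : ContinuousSMul ℝ (StrongDual 𝕜 E) := IsScalarTower.continuousSMul 𝕜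
  exact LocallyConvexSpace.toPolynormableSpace

/-- A copy of `E`, equipped with the seminorm `q`. -/
def SeminormedCopy (_q : Seminorm 𝕜 E) : Type _ := E

variable (q : Seminorm 𝕜 E)

noncomputable instance : SeminormedAddCommGroup (SeminormedCopy q) :=
  q.toAddGroupSeminorm.toSeminormedAddCommGroup

noncomputable instance : Module 𝕜 (SeminormedCopy q) := inferInstanceAs (Module 𝕜 E)

noncomputable instance : NormedSpace 𝕜 (SeminormedCopy q) where
  norm_smul_le c x := (map_smul_eq_mul q c x).le

/-- The identity `E → (E, q)`. -/
def toSeminormedCopy : E →ₗ[𝕜] SeminormedCopy q := LinearMap.id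

variable {q}
theorem continuous_toSeminormedCopy [IsTopologicalAddGroup E] [ContinuousSMul 𝕜 E] (hq : Continuous q) :
    Continuous (toSeminormedCopy q) := by
  refine continuous_of_continuousAt_zero (toSeminormedCopy q) ?_
  rw [ContinuousAt, map_zero, tendsto_zero_iff_norm_tendsto_zero]
  have := hq.tendsto 0
  rwa [map_zero] at this

end Seminorms

/-! ### Finite-rank approximation on nuclear spaces -/

section Nuclear
universe u v
variable {𝕜 : Type u} [RCLike 𝕜] {E : Type v} [AddCommGroup E] [Module 𝕜 E] [TopologicalSpace E]
  [IsTopologicalAddGroup E] [ContinuousSMul 𝕜 E]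

/-- On a nuclear space, the identity is approximated, with respect to each continuous seminorm, by
operators of finite rank that are uniformly bounded in the nuclear sense. -/
theorem IsNuclearSpace.approx (h : IsNuclearSpace 𝕜 E) {q : Seminorm 𝕜 E} (hq : Continuous q) :
    ∃ (q' : Seminorm 𝕜 E) (K : ℝ), Continuous q' ∧ 0 ≤ K ∧ ∀ ε > 0,
      ∃ (N : ℕ) (c : ℕ → 𝕜) (φ : ℕ → StrongDual 𝕜 E) (y : ℕ → E),
        ∑ n ∈ Finset.range N, ‖c n‖ ≤ K ∧ (∀ n x, ‖φ n x‖ ≤ q' x) ∧ (∀ n, q (y n) ≤ 1) ∧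
        ∀ x, q (x - ∑ n ∈ Finset.range N, (c n * φ n x) • y n) ≤ ε * q' x := by
  -- Nuclearity is applied to the canonical map into the completion of `(E, q)`, a Banach space.
  let j : E →L[𝕜] Completion (SeminormedCopy q) :=
    ⟨(Completion.toComplₗᵢ (𝕜 := 𝕜) (E := SeminormedCopy q)).toLinearMap ∘ₗ toSeminormedCopy q,
      (Completion.toComplₗᵢ (𝕜 := 𝕜) (E := SeminormedCopy q)).continuous.comp (continuous_toSeminormedCopy hq)⟩
  have hj : ∀ x, ‖j x‖ = q x := fun x => Completion.norm_coe (toSeminormedCopy q x)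
  obtain ⟨c, φ, z, q', C, hc, hq', hφ, hz, hsum⟩ := h _ j
  have hC : 0 ≤ C := (norm_nonneg _).trans (hz 0)
  have hC1 : 0 < C + 1 := by linarith
  set S := ∑' n, ‖c n‖ with hS
  have hS0 : 0 ≤ S := tsum_nonneg fun n => norm_nonneg _
  refine ⟨q', S * (C + 1), hq', by positivity, fun ε hε => ?_⟩
  -- The vectors `z n` of the completion are replaced by vectors of `E` at distance less than `η`.
  -- The bound 1 keeps their seminorm below `C + 1`; the other bound keeps the total replacement
  -- error below half of the allowed error.
  have hη : 0 < min 1 (ε / (2 * (S + 1))) := lt_min one_pos (by positivity)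
  set η := min 1 (ε / (2 * (S + 1))) with hηdef
  have hy : ∀ n, ∃ y : E, ‖z n - j y‖ < η := by
    intro n
    obtain ⟨y, hy⟩ := (Completion.denseRange_coe (α := SeminormedCopy q)).exists_dist_lt (z n) hη
    exact ⟨y, by rwa [dist_eq_norm] at hy⟩
  choose y hy using hy
  have htail : ∃ N, ∑' n, ‖c (n + N)‖ < ε / (2 * (C + 1)) := by
    have := (tendsto_sum_nat_add fun n => ‖c n‖).eventually (gt_mem_nhds
      (show 0 < ε / (2 * (C + 1)) from div_pos hε (by linarith)))
    exact this.exists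
  obtain ⟨N, hN⟩ := htail
  -- The factor `C + 1` is moved from the vectors to the coefficients. The coefficient sum stays
  -- below `S * (C + 1)` for every `ε`.
  refine ⟨N, fun n => c n * ((C + 1 : ℝ) : 𝕜), φ, fun n => (((C + 1)⁻¹ : ℝ) : 𝕜) • y n, ?_, hφ, ?_, ?_⟩
  · simp only [norm_mul, RCLike.norm_ofReal, abs_of_pos hC1]
    rw [← Finset.sum_mul]
    exact mul_le_mul_of_nonneg_right (hc.sum_le_tsum _ fun n _ => norm_nonneg _) hC1.le
  · intro n
    rw [map_smul_eq_mul, RCLike.norm_ofReal, abs_of_pos (inv_pos.2 hC1), inv_mul_le_iff₀ hC1,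
      ← hj]
    have h1 : ‖j (y n)‖ ≤ ‖z n‖ + ‖z n - j (y n)‖ := norm_le_norm_add_norm_sub (z n) _
    have h2 : η ≤ 1 := min_le_left _ _
    linarith [hz n, hy n]
  · intro x
    have hq'x := apply_nonneg q' x
    have hs : ∀ n, (c n * ((C + 1 : ℝ) : 𝕜) * φ n x) • ((((C + 1)⁻¹ : ℝ) : 𝕜) • y n) =
        (c n * φ n x) • y n := by
      intro n
      rw [smul_smul]
      congr 1
      have h1 : ((C + 1 : ℝ) : 𝕜) * (((C + 1)⁻¹ : ℝ) : 𝕜) = 1 := by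
        rw [← RCLike.ofReal_mul, mul_inv_cancel₀ hC1.ne', RCLike.ofReal_one]
      linear_combination (c n * φ n x) * h1
    simp only [hs]
    rw [← hj, map_sub, map_sum]
    simp only [map_smul]
    -- The error is the tail of the nuclear series plus the replacement error in the head.
    have e1 : j x - ∑ n ∈ Finset.range N, (c n * φ n x) • j (y n) =
        (∑' n, (c (n + N) * φ (n + N) x) • z (n + N)) +
          ∑ n ∈ Finset.range N, (c n * φ n x) • (z n - j (y n)) := by
      simp only [smul_sub, Finset.sum_sub_distrib]
      rw [← (hsum x).tsum_eq, ← (hsum x).summable.sum_add_tsum_nat_add N]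
      abel
    have hsn : Summable fun n => ‖(c (n + N) * φ (n + N) x) • z (n + N)‖ := by
      refine Summable.of_nonneg_of_le (fun n => norm_nonneg _) (fun n => ?_)
        (((summable_nat_add_iff N).2 hc).mul_right (q' x * C))
      rw [norm_smul, norm_mul, mul_assoc]
      gcongr
      exacts [hφ _ _, hz _]
    have e2 : ‖∑' n, (c (n + N) * φ (n + N) x) • z (n + N)‖ ≤ ε / 2 * q' x := by
      refine (norm_tsum_le_tsum_norm hsn).trans ?_
      have : ∑' n, ‖(c (n + N) * φ (n + N) x) • z (n + N)‖ ≤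
          ∑' n, ‖c (n + N)‖ * (q' x * C) := by
        refine hsn.tsum_le_tsum (fun n => ?_) (((summable_nat_add_iff N).2 hc).mul_right (q' x * C))
        rw [norm_smul, norm_mul, mul_assoc]
        gcongr
        exacts [hφ _ _, hz _]
      refine this.trans ?_
      rw [tsum_mul_right]
      calc _ ≤ ε / (2 * (C + 1)) * (q' x * (C + 1)) := by
            gcongr; linarith
        _ = _ := by field_simp
    have e3 : ‖∑ n ∈ Finset.range N, (c n * φ n x) • (z n - j (y n))‖ ≤ ε / 2 * q' x := by
      refine (norm_sum_le _ _).trans ?_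
      calc _ ≤ ∑ n ∈ Finset.range N, ‖c n‖ * (q' x * η) := by
            refine Finset.sum_le_sum fun n _ => ?_
            rw [norm_smul, norm_mul, mul_assoc]
            gcongr
            exacts [hφ _ _, (hy n).le]
        _ = (∑ n ∈ Finset.range N, ‖c n‖) * (q' x * η) := by rw [Finset.sum_mul]
        _ ≤ (S + 1) * (q' x * (ε / (2 * (S + 1)))) := by
            gcongr
            · exact (hc.sum_le_tsum _ fun n _ => norm_nonneg _).trans (by linarith)
            · exact min_le_right _ _
        _ = _ := by field_simp
    rw [e1]
    refine (norm_add_le _ _).trans ?_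
    linarith

end Nuclear

/-! ### Cross-seminorm bounds and slices -/

section Bounds

variable {𝕜 : Type*} [RCLike 𝕜] {E : Type*} [AddCommGroup E] [Module 𝕜 E]
variable {F : Type*} [AddCommGroup F] [Module 𝕜 F]

theorem seminorm_le_mul_of_le_one {r p : Seminorm 𝕜 E} {M : ℝ} (h : ∀ x, p x ≤ 1 → r x ≤ M)
    (x : E) : r x ≤ M * p x := by
  have hM : 0 ≤ M := by simpa using h 0 (by simp)
  have key : ∀ δ > 0, r x ≤ M * (p x + δ) := by
    intro δ hδ
    have hc : 0 < p x + δ := add_pos_of_nonneg_of_pos (apply_nonneg p x) hδ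
    have h1 : r ((((p x + δ)⁻¹ : ℝ) : 𝕜) • x) ≤ M := by
      refine h _ ?_
      rw [map_smul_eq_mul, RCLike.norm_ofReal, abs_of_pos (inv_pos.2 hc), inv_mul_le_iff₀ hc]
      linarith
    rwa [map_smul_eq_mul, RCLike.norm_ofReal, abs_of_pos (inv_pos.2 hc), inv_mul_le_iff₀ hc,
      mul_comm] at h1
  refine le_of_forall_pos_le_add fun ε hε => (key (ε / (M + 1)) (by positivity)).trans ?_
  rw [mul_add]
  gcongr
  rw [mul_div_assoc', div_le_iff₀ (by positivity)]
  nlinarith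

variable [TopologicalSpace E] [TopologicalSpace F] [ContinuousSMul 𝕜 E] [ContinuousSMul 𝕜 F]
  [IsTopologicalAddGroup E] [IsTopologicalAddGroup F]

/-- The local bound on elementary tensors becomes a product bound by homogeneity in each variable
separately. -/
theorem exists_seminorm_ctmul_le [PolynormableSpace 𝕜 E] [PolynormableSpace 𝕜 F]
    {r : Seminorm 𝕜 (CTensor 𝕜 E F)} (hr : Continuous r) :
    ∃ (p : Seminorm 𝕜 E) (q : Seminorm 𝕜 F), Continuous p ∧ Continuous q ∧
      ∀ x y, r (ctmul 𝕜 x y) ≤ p x * q y := by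
  obtain ⟨U, hU, V, hV, h⟩ := ctmul_bdd r hr
  obtain ⟨p, hp, hpU⟩ := exists_seminorm_of_mem_nhds (𝕜 := 𝕜) hU
  obtain ⟨q, hq, hqV⟩ := exists_seminorm_of_mem_nhds (𝕜 := 𝕜) hV
  refine ⟨p, q, hp, hq, fun x y => ?_⟩
  refine seminorm_le_mul_of_le_one (r := r.comp (ctmulₗ 𝕜 E F x)) (p := q) (fun y hy => ?_) y
  rw [← one_mul (p x)]
  exact seminorm_le_mul_of_le_one (r := r.comp ((ctmulₗ 𝕜 E F).flip y)) (p := p)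
    (fun x hx => h _ (hpU x hx) _ (hqV y hy)) x

end Bounds

section Slices

variable {𝕜 : Type*} [RCLike 𝕜]
variable {E : Type*} [AddCommGroup E] [Module 𝕜 E] [TopologicalSpace E]
  [ContinuousSMul 𝕜 E] [IsTopologicalAddGroup E]
variable {F : Type*} [AddCommGroup F] [Module 𝕜 F] [TopologicalSpace F]
  [ContinuousSMul 𝕜 F] [IsTopologicalAddGroup F]
variable {X : Type*} [AddCommGroup X] [Module 𝕜 X] [UniformSpace X]
    [IsUniformAddGroup X] [ContinuousSMul 𝕜 X] [PolynormableSpace 𝕜 X] [CompleteSpace X]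
    [T2Space X]

@[simp] theorem sliceRight_ctmul (φ : StrongDual 𝕜 F) (v : X) (y : F) :
    sliceRight φ (ctmul 𝕜 v y) = φ y • v :=
  lift₂_ctmul _ _ v y

/-- The slices by equicontinuous functionals are equicontinuous. -/
theorem sliceRight_equibounded {p : Seminorm 𝕜 X} (hp : Continuous p) {q : Seminorm 𝕜 F}
    (hq : Continuous q) : ∃ N ∈ 𝓝 (0 : CTensor 𝕜 X F), ∀ ψ : StrongDual 𝕜 F,
      (∀ y, ‖ψ y‖ ≤ q y) → ∀ t ∈ N, p (sliceRight ψ t) ≤ 1 := by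
  obtain ⟨N, hN, h⟩ := lift₂_equibounded
    (fun ψ : {ψ : StrongDual 𝕜 F // ∀ y, ‖ψ y‖ ≤ q y} =>
      (LinearMap.lsmul 𝕜 X ∘ₗ ψ.1.toLinearMap).flip)
    (fun ψ => (ψ.1.continuous.comp continuous_snd).smul continuous_fst) p hp
    (seminorm_ball_mem_nhds hp one_pos) (seminorm_ball_mem_nhds hq one_pos)
    (fun ψ x hx y hy => by
      change p (ψ.1 y • x) ≤ 1
      rw [map_smul_eq_mul]
      exact mul_le_one₀ ((ψ.2 y).trans hy) (apply_nonneg p x) hx)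
  exact ⟨N, hN, fun ψ hψ t ht => h ⟨ψ, hψ⟩ t ht⟩

theorem denseRange_toCTensor_near (t : CTensor 𝕜 E F) {N : Set (CTensor 𝕜 E F)}
    (hN : N ∈ 𝓝 (0 : CTensor 𝕜 E F)) : ∃ s, t - toCTensor 𝕜 E F s ∈ N := by
  have : {u | t - u ∈ N} ∈ 𝓝 t :=
    (continuous_const.sub continuous_id).continuousAt.preimage_mem_nhds (by simpa using hN)
  obtain ⟨u, hu, s, rfl⟩ := mem_closure_iff_nhds.1 (denseRange_toCTensor t) _ this
  exact ⟨s, hu⟩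

end Slices

/-! ### Projective and injective topologies agree for a nuclear factor -/

section Nuclear
universe u v w
variable {𝕜 : Type u} [RCLike 𝕜] {E : Type v} [AddCommGroup E] [Module 𝕜 E] [UniformSpace E]
    [IsUniformAddGroup E] [ContinuousSMul 𝕜 E] [PolynormableSpace 𝕜 E] [CompleteSpace E]
    [T2Space E]
  {F : Type w} [AddCommGroup F] [Module 𝕜 F] [TopologicalSpace F]
  [IsTopologicalAddGroup F] [ContinuousSMul 𝕜 F] [PolynormableSpace 𝕜 F]

/-- The finite rank operator `x ↦ ∑ cₙ φₙ(x) yₙ`. -/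
noncomputable def finiteRank (N : ℕ) (c : ℕ → 𝕜) (φ : ℕ → StrongDual 𝕜 F) (y : ℕ → F) : F →L[𝕜] F :=
  ∑ n ∈ Finset.range N, (c n • φ n).smulRight (y n)

theorem finiteRank_apply (N : ℕ) (c : ℕ → 𝕜) (φ : ℕ → StrongDual 𝕜 F) (y : ℕ → F) (x : F) :
    finiteRank N c φ y x = ∑ n ∈ Finset.range N, (c n * φ n x) • y n := by
  simp [finiteRank]

/-- `E ⊗̂ F → E ⊗̂ F`, `x ⊗ y ↦ x ⊗ y₀`, as a map of the first factor. -/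
noncomputable def tmulRight (E : Type*) [AddCommGroup E] [Module 𝕜 E] [TopologicalSpace E]
    {F : Type*} [AddCommGroup F] [Module 𝕜 F] [TopologicalSpace F] (y : F) :
    E →L[𝕜] CTensor 𝕜 E F :=
  ⟨(ctmulₗ 𝕜 E F).flip y, continuous_ctmul.comp (continuous_id.prodMk continuous_const)⟩

@[simp] theorem tmulRight_apply {E : Type*} [AddCommGroup E] [Module 𝕜 E] [TopologicalSpace E]
    {F : Type*} [AddCommGroup F] [Module 𝕜 F] [TopologicalSpace F] (x : E) (y : F) :
    tmulRight E y x = ctmul 𝕜 x y := rfl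

theorem cmap_finiteRank (N : ℕ) (c : ℕ → 𝕜) (φ : ℕ → StrongDual 𝕜 F) (y : ℕ → F)
    (t : CTensor 𝕜 E F) : cmap (.id 𝕜 E) (finiteRank N c φ y) t =
      ∑ n ∈ Finset.range N, c n • ctmul 𝕜 (sliceRight (φ n) t) (y n) := by
  have : cmap (.id 𝕜 E) (finiteRank N c φ y) =
      ∑ n ∈ Finset.range N, c n • (tmulRight E (y n) ∘L sliceRight (φ n)) := by
    refine CTensor.ext fun x z => ?_
    rw [cmap_ctmul, finiteRank_apply]
    simp only [_root_.sum_apply, _root_.smul_apply, ContinuousLinearMap.comp_apply,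
      sliceRight_ctmul, map_smul, tmulRight_apply, smul_smul]
    change ctmulₗ 𝕜 E F x _ = _
    rw [map_sum]
    simp only [map_smul]
    rfl
  rw [this]
  simp

/-- On `E ⊗̂ F` with `F` nuclear, the projective topology is the injective one. -/
theorem IsNuclearSpace.seminorm_le_slices (hF : IsNuclearSpace 𝕜 F)
    {r : Seminorm 𝕜 (CTensor 𝕜 E F)} (hr : Continuous r) :
    ∃ (p : Seminorm 𝕜 E) (q : Seminorm 𝕜 F) (K : ℝ), Continuous p ∧ Continuous q ∧ 0 ≤ K ∧
      ∀ t M, (∀ ψ : StrongDual 𝕜 F, (∀ y, ‖ψ y‖ ≤ q y) → p (sliceRight ψ t) ≤ M) →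
        r t ≤ K * M := by
  obtain ⟨p, q₀, hp, hq₀, hpq⟩ := exists_seminorm_ctmul_le hr
  obtain ⟨q, K, hq, hK, happ⟩ := hF.approx hq₀
  refine ⟨p, q, K, hp, hq, hK, ?_⟩
  -- For a fixed algebraic tensor the error of `id ⊗ G` is at most `ε` times a constant. That the
  -- constant depends on the tensor is harmless, because `ε` tends to zero while `K` stays fixed.
  have hrem : ∀ s : ProjTensor 𝕜 E F, ∃ C, 0 ≤ C ∧ ∀ ε ≥ 0, ∀ G : F →L[𝕜] F,
      (∀ y, q₀ (y - G y) ≤ ε * q y) →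
      r (toCTensor 𝕜 E F s - cmap (.id 𝕜 E) G (toCTensor 𝕜 E F s)) ≤ ε * C := by
    intro s
    refine TensorProduct.induction_on (motive := fun s : E ⊗[𝕜] F => ∃ C, 0 ≤ C ∧ ∀ ε ≥ 0,
      ∀ G : F →L[𝕜] F, (∀ y, q₀ (y - G y) ≤ ε * q y) →
      r (toCTensor 𝕜 E F (s : ProjTensor 𝕜 E F) -
        cmap (.id 𝕜 E) G (toCTensor 𝕜 E F (s : ProjTensor 𝕜 E F))) ≤ ε * C) s ?_ ?_ ?_
    · refine ⟨0, le_rfl, fun ε hε G hG => ?_⟩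
      have : toCTensor 𝕜 E F (0 : ProjTensor 𝕜 E F) = 0 := map_zero _
      change r (toCTensor 𝕜 E F (0 : ProjTensor 𝕜 E F) -
        cmap (.id 𝕜 E) G (toCTensor 𝕜 E F (0 : ProjTensor 𝕜 E F))) ≤ _
      rw [this]
      simp
    · intro x y
      refine ⟨p x * q y, by positivity, fun ε hε G hG => ?_⟩
      change r (ctmul 𝕜 x y - cmap (.id 𝕜 E) G (ctmul 𝕜 x y)) ≤ _
      rw [cmap_ctmul, show ctmul 𝕜 x y - ctmul 𝕜 ((.id 𝕜 E : E →L[𝕜] E) x) (G y) =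
        ctmul 𝕜 x (y - G y) from (map_sub (ctmulₗ 𝕜 E F x) y (G y)).symm]
      refine (hpq _ _).trans ?_
      calc _ ≤ p x * (ε * q y) := by gcongr; exact hG y
        _ = _ := by ring
    · rintro a b ⟨A, hA, hA'⟩ ⟨B, hB, hB'⟩
      refine ⟨A + B, by positivity, fun ε hε G hG => ?_⟩
      have : toCTensor 𝕜 E F (a + b : ProjTensor 𝕜 E F) = toCTensor 𝕜 E F (a : ProjTensor 𝕜 E F) +
        toCTensor 𝕜 E F (b : ProjTensor 𝕜 E F) := map_add _ _ _
      change r (toCTensor 𝕜 E F (a + b : ProjTensor 𝕜 E F) -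
        cmap (.id 𝕜 E) G (toCTensor 𝕜 E F (a + b : ProjTensor 𝕜 E F))) ≤ _
      rw [this, map_add, add_sub_add_comm, mul_add]
      exact (map_add_le_add r _ _).trans (add_le_add (hA' ε hε G hG) (hB' ε hε G hG))
  have halg : ∀ (s : ProjTensor 𝕜 E F) (M : ℝ), (∀ ψ : StrongDual 𝕜 F, (∀ y, ‖ψ y‖ ≤ q y) →
      p (sliceRight ψ (toCTensor 𝕜 E F s)) ≤ M) → r (toCTensor 𝕜 E F s) ≤ K * M := by
    intro s M hM
    have hM0 : 0 ≤ M := by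
      have := hM 0 (fun y => by simp)
      exact (apply_nonneg p _).trans this
    obtain ⟨C, hC, hC'⟩ := hrem s
    refine le_of_forall_pos_le_add fun ε hε => ?_
    obtain ⟨N, c, φ, y, hc, hφ, hy, happ'⟩ := happ (ε / (C + 1)) (by positivity)
    have h1 := hC' (ε / (C + 1)) (by positivity) (finiteRank N c φ y)
      (fun x => by rw [finiteRank_apply]; exact happ' x)
    -- Applying `id ⊗ G` produces only slices by the `φ n`, each dominated by `q`; the coefficient
    -- sum is bounded by `K`.
    have h2 : r (cmap (.id 𝕜 E) (finiteRank N c φ y) (toCTensor 𝕜 E F s)) ≤ K * M := by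
      rw [cmap_finiteRank]
      refine (Finset.le_sum_of_subadditive r (map_zero r).le (map_add_le_add r) _ _).trans ?_
      calc _ ≤ ∑ n ∈ Finset.range N, ‖c n‖ * M := by
            refine Finset.sum_le_sum fun n _ => ?_
            rw [map_smul_eq_mul]
            gcongr
            refine (hpq _ _).trans ?_
            calc _ ≤ M * 1 := mul_le_mul (hM _ (hφ n)) (hy n) (apply_nonneg _ _) hM0
              _ = M := mul_one M
        _ = (∑ n ∈ Finset.range N, ‖c n‖) * M := by rw [Finset.sum_mul]
        _ ≤ _ := by gcongr
    have h3 : ε / (C + 1) * C ≤ ε := by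
      rw [div_mul_eq_mul_div, div_le_iff₀ (by positivity)]
      nlinarith
    have h4 := map_add_le_add r (cmap (.id 𝕜 E) (finiteRank N c φ y) (toCTensor 𝕜 E F s))
      (toCTensor 𝕜 E F s - cmap (.id 𝕜 E) (finiteRank N c φ y) (toCTensor 𝕜 E F s))
    rw [add_sub_cancel] at h4
    linarith
  intro t M hM
  -- Equicontinuity lets one algebraic tensor approximate `t` in `r` and, simultaneously, in all the
  -- slices by functionals dominated by `q`.
  obtain ⟨N, hN, hN'⟩ := sliceRight_equibounded (X := E) hp hq
  have key : ∀ η > 0, r t ≤ K * (M + η) + η := by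
    intro η hη
    obtain ⟨s, hs1, hs2⟩ := denseRange_toCTensor_near t
      (Filter.inter_mem (smul_preimage_mem (𝕜 := 𝕜) hN ((η⁻¹ : ℝ) : 𝕜)) (seminorm_ball_mem_nhds hr hη))
    have h1 := halg s (M + η) fun ψ hψ => by
      have h2 := hN' ψ hψ _ hs1
      rw [map_smul] at h2
      have h3 := seminorm_le_of_smul_le p (inv_pos.2 hη) h2
      rw [inv_inv, map_sub] at h3
      have h4 := hM ψ hψ
      have h5 := map_sub_le_add p (sliceRight ψ t)
        (sliceRight ψ t - sliceRight ψ (toCTensor 𝕜 E F s))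
      rw [sub_sub_cancel] at h5
      linarith
    have h2 := map_add_le_add r (toCTensor 𝕜 E F s) (t - toCTensor 𝕜 E F s)
    rw [add_sub_cancel] at h2
    have h3 : r (t - toCTensor 𝕜 E F s) ≤ η := hs2
    linarith
  refine le_of_forall_pos_le_add fun ε hε => (key (ε / (K + 1)) (by positivity)).trans (le_of_eq ?_)
  field_simp
  ring

/-- The flip `E ⊗̂ F → F ⊗̂ E`. -/
noncomputable def cswap (𝕜 : Type*) [RCLike 𝕜] (E F : Type*) [AddCommGroup E] [Module 𝕜 E]
    [TopologicalSpace E] [AddCommGroup F] [Module 𝕜 F] [TopologicalSpace F] :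
    CTensor 𝕜 E F →L[𝕜] CTensor 𝕜 F E :=
  lift₂ (ctmulₗ 𝕜 F E).flip (continuous_ctmul.comp (continuous_snd.prodMk continuous_fst))

@[simp] theorem cswap_ctmul {E F : Type*} [AddCommGroup E] [Module 𝕜 E]
    [TopologicalSpace E] [AddCommGroup F] [Module 𝕜 F] [TopologicalSpace F] (x : E) (y : F) :
    cswap 𝕜 E F (ctmul 𝕜 x y) = ctmul 𝕜 y x := lift₂_ctmul _ _ x y

theorem cswap_cswap {E F : Type*} [AddCommGroup E] [Module 𝕜 E]
    [TopologicalSpace E] [AddCommGroup F] [Module 𝕜 F] [TopologicalSpace F] (t : CTensor 𝕜 E F) :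
    cswap 𝕜 F E (cswap 𝕜 E F t) = t := by
  have : cswap 𝕜 F E ∘L cswap 𝕜 E F = .id 𝕜 _ := CTensor.ext fun x y => by simp
  exact congrArg (fun f : CTensor 𝕜 E F →L[𝕜] CTensor 𝕜 E F => f t) this

theorem sliceRight_cswap (φ : StrongDual 𝕜 F) (t : CTensor 𝕜 F E) :
    sliceRight φ (cswap 𝕜 F E t) = sliceLeft φ t := by
  have : sliceRight φ ∘L cswap 𝕜 F E = sliceLeft φ := CTensor.ext fun x y => by simp
  exact congrArg (fun f : CTensor 𝕜 F E →L[𝕜] E => f t) this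

theorem IsNuclearSpace.seminorm_le_slices_left (hF : IsNuclearSpace 𝕜 F)
    {r : Seminorm 𝕜 (CTensor 𝕜 F E)} (hr : Continuous r) :
    ∃ (p : Seminorm 𝕜 E) (q : Seminorm 𝕜 F) (K : ℝ), Continuous p ∧ Continuous q ∧ 0 ≤ K ∧
      ∀ t M, (∀ ψ : StrongDual 𝕜 F, (∀ y, ‖ψ y‖ ≤ q y) → p (sliceLeft ψ t) ≤ M) →
        r t ≤ K * M := by
  obtain ⟨p, q, K, hp, hq, hK, h⟩ := hF.seminorm_le_slices
    (r := r.comp (cswap 𝕜 E F).toLinearMap) (hr.comp (cswap 𝕜 E F).continuous)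
  refine ⟨p, q, K, hp, hq, hK, fun t M hM => ?_⟩
  have := h (cswap 𝕜 F E t) M fun ψ hψ => by rw [sliceRight_cswap]; exact hM ψ hψ
  change r (cswap 𝕜 E F (cswap 𝕜 F E t)) ≤ _ at this
  rwa [cswap_cswap] at this

theorem IsNuclearSpace.eq_zero_of_slices_left (hF : IsNuclearSpace 𝕜 F) {t : CTensor 𝕜 F E}
    (h : ∀ ψ : StrongDual 𝕜 F, sliceLeft ψ t = 0) : t = 0 := by
  refine eq_zero_of_forall_seminorm (𝕜 := 𝕜) fun r hr => ?_
  obtain ⟨p, q, K, hp, hq, hK, h'⟩ := hF.seminorm_le_slices_left hr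
  have := h' t 0 fun ψ _ => by rw [h, map_zero]
  rw [mul_zero] at this
  exact le_antisymm this (apply_nonneg r t)

/-- The elements of `F ⊗̂ E`, for a nuclear space `F`, are determined by their slices. -/
theorem IsNuclearSpace.ext_slices_left (hF : IsNuclearSpace 𝕜 F) {s t : CTensor 𝕜 F E}
    (h : ∀ ψ : StrongDual 𝕜 F, sliceLeft ψ s = sliceLeft ψ t) : s = t :=
  sub_eq_zero.1 (hF.eq_zero_of_slices_left fun ψ => by rw [map_sub, h, sub_self])

end Nuclear

/-! ### Uniform boundedness and polars -/

section Bounded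

variable {𝕜 : Type*} [RCLike 𝕜] {E : Type*} [AddCommGroup E] [Module 𝕜 E] [TopologicalSpace E]

/-- The uniform boundedness principle in terms of seminorms. -/
theorem exists_seminorm_of_pointwise_bdd [BarrelledSpace 𝕜 E] {F : Type*} [AddCommGroup F]
    [Module 𝕜 F] [TopologicalSpace F] {ι : Type*} (f : ι → E →L[𝕜] F) {r : Seminorm 𝕜 F}
    (hr : Continuous r) (h : ∀ x, ∃ C, ∀ i, r (f i x) ≤ C) :
    ∃ p : Seminorm 𝕜 E, Continuous p ∧ ∀ i x, r (f i x) ≤ p x := by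
  have hb : BddAbove (Set.range fun i => r.comp (f i).toLinearMap) := by
    rw [Seminorm.bddAbove_range_iff]
    intro x
    obtain ⟨C, hC⟩ := h x
    exact ⟨C, by rintro _ ⟨i, rfl⟩; exact hC i⟩
  refine ⟨⨆ i, r.comp (f i).toLinearMap, ?_, fun i => le_ciSup hb i⟩
  rw [Seminorm.coe_iSup_eq hb]
  -- Barrelledness is used here: a finite supremum of continuous seminorms is continuous.
  exact Seminorm.continuous_iSup (fun i => r.comp (f i).toLinearMap)
    (fun i => hr.comp (f i).continuous) hb

theorem Bornology.IsVonNBounded.exists_seminorm_le {s : Set E} (hs : Bornology.IsVonNBounded 𝕜 s)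
    {p : Seminorm 𝕜 E} (hp : Continuous p) : ∃ C, 0 < C ∧ ∀ x ∈ s, p x ≤ C := by
  obtain ⟨k, hk⟩ := (hs (seminorm_ball_mem_nhds hp one_pos)).exists_pos
  obtain ⟨hk0, hk⟩ := hk
  refine ⟨k, hk0, fun x hx => ?_⟩
  obtain ⟨y, hy, rfl⟩ := hk (k : 𝕜) (by simp [abs_of_pos hk0]) hx
  change p ((k : 𝕜) • y) ≤ k
  rw [map_smul_eq_mul, RCLike.norm_ofReal, abs_of_pos hk0]
  exact mul_le_of_le_one_right hk0.le hy

theorem isVonNBounded_of_seminorm_le [PolynormableSpace 𝕜 E] {s : Set E}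
    (h : ∀ p : Seminorm 𝕜 E, Continuous p → ∃ C, ∀ x ∈ s, p x ≤ C) :
    Bornology.IsVonNBounded 𝕜 s := by
  rw [(PolynormableSpace.withSeminorms 𝕜 E).isVonNBounded_iff_seminorm_bounded]
  rintro ⟨p, hp⟩
  obtain ⟨C, hC⟩ := h p hp
  exact ⟨max C 0 + 1, by positivity, fun x hx => lt_of_le_of_lt ((hC x hx).trans (le_max_left _ _))
    (lt_add_one _)⟩

variable [IsTopologicalAddGroup E] [ContinuousSMul 𝕜 E]

/-- Weakly bounded sets are bounded. -/
theorem isVonNBounded_of_weakly_bounded [PolynormableSpace 𝕜 E] {D : Set E}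
    (h : ∀ f : StrongDual 𝕜 E, ∃ C, ∀ d ∈ D, ‖f d‖ ≤ C) : Bornology.IsVonNBounded 𝕜 D := by
  refine isVonNBounded_of_seminorm_le (𝕜 := 𝕜) fun s hs => ?_
  let j : E →L[𝕜] SeminormedCopy s := ⟨toSeminormedCopy s, continuous_toSeminormedCopy hs⟩
  -- The points of `D` act on the dual of `(E, s)`, a Banach space, and are pointwise bounded there.
  obtain ⟨C, hC⟩ := banach_steinhaus
    (g := fun d : D => NormedSpace.inclusionInDoubleDual 𝕜 (SeminormedCopy s) (j d)) fun f => by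
      obtain ⟨C, hC⟩ := h (f ∘L j)
      exact ⟨C, fun d => hC d d.2⟩
  refine ⟨C, fun d hd => seminorm_le_of_dual hs fun f hf => ?_⟩
  let g : StrongDual 𝕜 (SeminormedCopy s) :=
    LinearMap.mkContinuous (f.toLinearMap : SeminormedCopy s →ₗ[𝕜] 𝕜) 1
      (fun x => by rw [one_mul]; exact hf x)
  have hg : ‖g‖ ≤ 1 := LinearMap.mkContinuous_norm_le _ zero_le_one _
  have h1 := (NormedSpace.inclusionInDoubleDual 𝕜 (SeminormedCopy s) (j d)).le_of_opNorm_le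
    (hC ⟨d, hd⟩) g
  have hC0 : 0 ≤ C := (norm_nonneg _).trans (hC ⟨d, hd⟩)
  exact h1.trans (mul_le_of_le_one_right hC0 hg)

theorem dual_polar_mem_nhds {A : Set E} (hA : Bornology.IsVonNBounded 𝕜 A) :
    {f : StrongDual 𝕜 E | ∀ a ∈ A, ‖f a‖ ≤ 1} ∈ 𝓝 (0 : StrongDual 𝕜 E) := by
  refine Filter.mem_of_superset (ContinuousLinearMap.eventually_nhds_zero_mapsTo hA
    (Metric.closedBall_mem_nhds (0 : 𝕜) one_pos)) fun f hf a ha => ?_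
  simpa using hf ha

/-- Polars of bounded sets form a basis at zero of the strong dual. Dilating the bounded set by `2 /
δ` absorbs the size of the target ball. -/
theorem exists_polar_subset {W : Set (StrongDual 𝕜 E)} (hW : W ∈ 𝓝 (0 : StrongDual 𝕜 E)) :
    ∃ A : Set E, Bornology.IsVonNBounded 𝕜 A ∧ ∀ f : StrongDual 𝕜 E, (∀ a ∈ A, ‖f a‖ ≤ 1) →
      f ∈ W := by
  obtain ⟨⟨A, U⟩, ⟨hA, hU⟩, h⟩ :=
    (ContinuousLinearMap.hasBasis_nhds_zero (σ := RingHom.id 𝕜) (E := E) (F := 𝕜)).mem_iff.1 hW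
  obtain ⟨δ, hδ, hU⟩ := Metric.mem_nhds_iff.1 hU
  refine ⟨(((2 / δ : ℝ) : 𝕜) • ContinuousLinearMap.id 𝕜 E) '' A, hA.image _, fun f hf => h fun x hx => hU ?_⟩
  have := hf _ ⟨x, hx, rfl⟩
  rw [_root_.smul_apply, map_smul, norm_smul, RCLike.norm_ofReal, abs_of_pos (by positivity),
    div_mul_eq_mul_div, div_le_one hδ] at this
  rw [mem_ball_zero_iff]
  have h0 : 0 ≤ ‖f x‖ := norm_nonneg _
  change 2 * ‖f x‖ ≤ δ at this
  linarith

end Bounded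

/-! ### Fréchet spaces -/

section Frechet
universe u v
variable {𝕜 : Type u} [RCLike 𝕜] {E : Type v} [AddCommGroup E] [Module 𝕜 E] [UniformSpace E]
  [IsUniformAddGroup E]

theorem IsFrechetSpace.continuousSMul (h : IsFrechetSpace 𝕜 E) : ContinuousSMul 𝕜 E :=
  have := h.locallyConvex
  (PolynormableSpace.withSeminorms 𝕜 E).continuousSMul

theorem IsFrechetSpace.barrelled (h : IsFrechetSpace 𝕜 E) : BarrelledSpace 𝕜 E := by
  have := h.continuousSMul
  have := h.complete
  have := h.firstCountable
  have : (uniformity E).IsCountablyGenerated := IsUniformAddGroup.uniformity_countably_generated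
  infer_instance

theorem IsFrechetSpace.completeSpace_dual (h : IsFrechetSpace 𝕜 E) :
    CompleteSpace (StrongDual 𝕜 E) := by
  have := h.continuousSMul
  have := h.firstCountable
  infer_instance

end Frechet

/-! ### Nuclear strong duals: reflexivity of the predual, barrelledness, complete dual -/

section DualOfFrechet
universe u v
variable {𝕜 : Type u} [RCLike 𝕜]
  {E : Type v} [AddCommGroup E] [Module 𝕜 E] [UniformSpace E] [IsUniformAddGroup E]
  [ContinuousSMul 𝕜 E] [PolynormableSpace 𝕜 E]
  {F : Type v} [AddCommGroup F] [Module 𝕜 F] [UniformSpace F] [IsUniformAddGroup F]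
  [ContinuousSMul 𝕜 F] [PolynormableSpace 𝕜 F]

/-- The functional `y ↦ e y x` on a space `E` identified by `e` with the dual of `F`. -/
def dualEval (e : E ≃L[𝕜] StrongDual 𝕜 F) (x : F) : StrongDual 𝕜 E :=
  ⟨{ toFun := fun y => e y x
     map_add' := fun y z => by simp
     map_smul' := fun c y => by simp }, (continuous_eval_const x).comp e.continuous⟩

@[simp] theorem dualEval_apply (e : E ≃L[𝕜] StrongDual 𝕜 F) (x : F) (y : E) :
    dualEval e x y = e y x := rfl

/-- The polar of a neighbourhood of zero is bounded in the strong dual. -/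
theorem isVonNBounded_dual_polar (e : E ≃L[𝕜] StrongDual 𝕜 F) {s : Seminorm 𝕜 F}
    (hs : Continuous s) : Bornology.IsVonNBounded 𝕜 {y : E | ∀ x, ‖e y x‖ ≤ s x} := by
  refine isVonNBounded_of_seminorm_le (𝕜 := 𝕜) fun q hq => ?_
  have h0 : {f : StrongDual 𝕜 F | q (e.symm f) ≤ 1} ∈ 𝓝 (0 : StrongDual 𝕜 F) :=
    e.symm.continuous.continuousAt.preimage_mem_nhds
      (by rw [map_zero]; exact seminorm_ball_mem_nhds hq one_pos)
  obtain ⟨A, hA, hA'⟩ := exists_polar_subset h0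
  obtain ⟨c, hc, hcA⟩ := Bornology.IsVonNBounded.exists_seminorm_le hA hs
  refine ⟨c, fun y hy => ?_⟩
  have h1 : q (e.symm (((c⁻¹ : ℝ) : 𝕜) • e y)) ≤ 1 := hA' _ fun a ha => by
    rw [_root_.smul_apply, norm_smul, RCLike.norm_ofReal, abs_of_pos (inv_pos.2 hc),
      inv_mul_le_iff₀ hc, mul_one]
    exact (hy a).trans (hcA a ha)
  rw [map_smul, e.symm_apply_apply] at h1
  simpa using seminorm_le_of_smul_le q (inv_pos.2 hc) h1

/-- A functional on the strong dual that is bounded by the polar of `A` is approximated, at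
finitely many points, by elements of the absolutely convex set `A`. -/
theorem exists_near_at_finitely_many (e : E ≃L[𝕜] StrongDual 𝕜 F) (ξ : StrongDual 𝕜 E)
    {p : Seminorm 𝕜 E} (hp : ∀ y, (∀ x, (∀ z, ‖e z x‖ ≤ p z) → ‖e y x‖ ≤ 1) → ‖ξ y‖ ≤ 1)
    (N : ℕ) (y : ℕ → E) {δ : ℝ} (hδ : 0 < δ) :
    ∃ a : F, (∀ z, ‖e z a‖ ≤ p z) ∧ ∀ n < N, ‖e (y n) a - ξ (y n)‖ ≤ δ := by
  -- Goldstine's argument: if the vector of values of `ξ` were not in the closure of the convex set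
  -- of values of `A`, the two could be separated in a finite-dimensional space. The separating
  -- functional is a combination `y'` of the `y n`, and it contradicts `hp`.
  let L : F → Fin N → 𝕜 := fun a n => e (y n) a
  let A : Set F := {x | ∀ z, ‖e z x‖ ≤ p z}
  have hconv : Convex ℝ (L '' A) := by
    rintro _ ⟨a, ha, rfl⟩ _ ⟨b, hb, rfl⟩ s t hs ht hst
    refine ⟨(s : 𝕜) • a + (t : 𝕜) • b, fun z => ?_, ?_⟩
    · rw [map_add, map_smul, map_smul]
      refine (norm_add_le _ _).trans ?_
      rw [norm_smul, norm_smul, RCLike.norm_ofReal, RCLike.norm_ofReal, abs_of_nonneg hs,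
        abs_of_nonneg ht]
      calc _ ≤ s * p z + t * p z := by gcongr; exacts [ha z, hb z]
        _ = p z := by rw [← add_mul, hst, one_mul]
    · ext n
      simp [L, RCLike.real_smul_eq_coe_mul]
  by_cases hmem : (fun n : Fin N => ξ (y n)) ∈ closure (L '' A)
  · obtain ⟨_, ⟨a, ha, rfl⟩, had⟩ := Metric.mem_closure_iff.1 hmem δ hδ
    refine ⟨a, ha, fun n hn => ?_⟩
    have := (dist_le_pi_dist (fun n : Fin N => ξ (y n)) (L a) ⟨n, hn⟩).trans had.le
    rw [dist_comm, dist_eq_norm] at this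
    exact this
  · exfalso
    obtain ⟨f, u, hf1, hf2⟩ := RCLike.geometric_hahn_banach_closed_point (𝕜 := 𝕜) hconv.closure
      isClosed_closure hmem
    have hf : ∀ w : Fin N → 𝕜, f w = ∑ n, w n * f (Pi.single n 1) := by
      intro w
      conv_lhs => rw [← Finset.univ_sum_single w, map_sum]
      refine Finset.sum_congr rfl fun n _ => ?_
      rw [← smul_eq_mul, ← map_smul]
      congr 1
      rw [← Pi.single_smul, smul_eq_mul, mul_one]
    let y' : E := ∑ n : Fin N, f (Pi.single n 1) • y n
    have h1 : ∀ a, f (L a) = e y' a := by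
      intro a
      rw [hf]
      simp [y', L, mul_comm]
    have h2 : f (fun n => ξ (y n)) = ξ y' := by
      rw [hf]
      simp [y', mul_comm]
    have hu : 0 < u := by
      have := hf1 (L 0) (subset_closure ⟨0, fun z => by simp, rfl⟩)
      rw [h1, map_zero] at this
      simpa using this
    have h3 : ∀ a ∈ A, ‖e y' a‖ ≤ u := by
      intro a ha
      -- Since `A` is balanced, rotating `a` turns the bound on real parts into a bound on absolute
      -- values.
      obtain ⟨c, hc, hca⟩ := RCLike.exists_norm_eq_mul_self (e y' a)
      have := hf1 (L (c • a)) (subset_closure ⟨c • a, fun z => by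
        rw [map_smul, norm_smul, hc, one_mul]; exact ha z, rfl⟩)
      rw [h1, map_smul, smul_eq_mul, ← hca, RCLike.ofReal_re] at this
      exact this.le
    have h4 : ‖ξ (((u⁻¹ : ℝ) : 𝕜) • y')‖ ≤ 1 := hp _ fun x hx => by
      rw [map_smul, _root_.smul_apply, norm_smul, RCLike.norm_ofReal, abs_of_pos (inv_pos.2 hu),
        inv_mul_le_iff₀ hu, mul_one]
      exact h3 x hx
    rw [map_smul, norm_smul, RCLike.norm_ofReal, abs_of_pos (inv_pos.2 hu),
        inv_mul_le_iff₀ hu, mul_one] at h4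
    rw [h2] at hf2
    exact absurd (hf2.trans_le (RCLike.re_le_norm _)) (not_lt.2 h4)

/-- Continuity places `ξ` in the bipolar of a bounded set `A` of the predual, so both `ξ` and the
points of `A` are dominated by one seminorm `p`. The identity of `E` is approximated in `p` by a
finite-rank operator; matching `ξ` at its finitely many vectors by a point `a` dominated by `p`
controls the finite-rank part, and domination by `p` controls the rest. The seminorm `q` does not
depend on `ε`, which makes the approximation uniform on bounded sets. -/
theorem exists_dualEval_near (hE : IsNuclearSpace 𝕜 E) (e : E ≃L[𝕜] StrongDual 𝕜 F)
    (ξ : StrongDual 𝕜 E) : ∃ q : Seminorm 𝕜 E, Continuous q ∧ ∀ ε > 0, ∃ a : F, ∀ y,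
      ‖ξ y - e y a‖ ≤ ε * q y := by
  have h0 : {f : StrongDual 𝕜 F | ‖ξ (e.symm f)‖ ≤ 1} ∈ 𝓝 (0 : StrongDual 𝕜 F) :=
    seminorm_ball_mem_nhds (p := dualSeminorm (ξ ∘L e.symm.toContinuousLinearMap).toLinearMap)
      (ξ.continuous.comp e.symm.continuous).norm one_pos
  obtain ⟨A, hA, hA'⟩ := exists_polar_subset h0
  have h1 : {y : E | ∀ a ∈ A, ‖e y a‖ ≤ 1} ∈ 𝓝 (0 : E) :=
    e.continuous.continuousAt.preimage_mem_nhds (by rw [map_zero]; exact dual_polar_mem_nhds hA)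
  obtain ⟨p, hp, hpA⟩ := exists_seminorm_of_mem_nhds (𝕜 := 𝕜) h1
  have hξA : ∀ y, (∀ a ∈ A, ‖e y a‖ ≤ 1) → ‖ξ y‖ ≤ 1 := fun y hy => by
    simpa using hA' (e y) hy
  have hAp : ∀ a ∈ A, ∀ z, ‖e z a‖ ≤ p z := fun a ha =>
    norm_le_of_le_one (f := (dualEval e a).toLinearMap) fun z hz => hpA z hz a ha
  have hξp : ∀ y, ‖ξ y‖ ≤ p y :=
    norm_le_of_le_one (f := ξ.toLinearMap) fun z hz => hξA z (hpA z hz)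
  obtain ⟨q, K, hq, hK, happ⟩ := hE.approx hp
  refine ⟨q, hq, fun ε hε => ?_⟩
  obtain ⟨N, c, φ, y, hc, hφ, -, happ⟩ := happ (ε / 4) (by positivity)
  obtain ⟨a, ha, hay⟩ := exists_near_at_finitely_many e ξ
    (fun y hy => hξA y fun a ha => hy a (hAp a ha)) N y
    (δ := ε / (2 * (K + 1))) (by positivity)
  refine ⟨a, fun z => ?_⟩
  set w := ∑ n ∈ Finset.range N, (c n * φ n z) • y n with hw
  have e1 : ξ z - e z a = (ξ (z - w) - e (z - w) a) + (ξ w - e w a) := by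
    simp only [map_sub, _root_.sub_apply]; ring
  have e2 : ‖ξ (z - w) - e (z - w) a‖ ≤ ε / 2 * q z := by
    refine (norm_sub_le _ _).trans ?_
    have := hξp (z - w)
    have := ha (z - w)
    have := happ z
    linarith
  have e3 : ‖ξ w - e w a‖ ≤ ε / 2 * q z := by
    have : ξ w - e w a = ∑ n ∈ Finset.range N, (c n * φ n z) * (ξ (y n) - e (y n) a) := by
      simp [hw, mul_sub]
    rw [this]
    refine (norm_sum_le _ _).trans ?_
    calc _ ≤ ∑ n ∈ Finset.range N, ‖c n‖ * (q z * (ε / (2 * (K + 1)))) := by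
          refine Finset.sum_le_sum fun n hn => ?_
          rw [norm_mul, norm_mul, mul_assoc]
          gcongr
          · exact hφ n z
          · rw [norm_sub_rev]; exact hay n (Finset.mem_range.1 hn)
      _ = (∑ n ∈ Finset.range N, ‖c n‖) * (q z * (ε / (2 * (K + 1)))) := by rw [Finset.sum_mul]
      _ ≤ (K + 1) * (q z * (ε / (2 * (K + 1)))) := by gcongr; linarith
      _ = _ := by field_simp
  rw [e1]
  refine (norm_add_le _ _).trans ?_
  linarith

variable [T2Space F] [CompleteSpace F]

/-- The predual `F` of a nuclear space `E` is reflexive. -/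
theorem dualEval_surjective (hE : IsNuclearSpace 𝕜 E) (e : E ≃L[𝕜] StrongDual 𝕜 F) :
    Function.Surjective (dualEval e) := by
  intro ξ
  obtain ⟨q, hq, hqa⟩ := exists_dualEval_near hE e ξ
  choose a ha using fun n : ℕ => hqa (1 / ((n : ℝ) + 1)) (by positivity)
  have hlim : Filter.Tendsto (fun n : ℕ => 1 / ((n : ℝ) + 1)) Filter.atTop (𝓝 0) :=
    tendsto_one_div_add_atTop_nhds_zero_nat
  -- The polar of a continuous seminorm `s` is bounded in `E`, so `q` is bounded on it. The errors
  -- are therefore uniform there, which by Hahn–Banach controls `s (a j - a i)`.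
  have hc : CauchySeq a := by
    rw [cauchySeq_iff_tendsto, uniformity_eq_comap_nhds_zero, Filter.tendsto_comap_iff,
      (PolynormableSpace.withSeminorms 𝕜 F).tendsto_nhds]
    rintro ⟨s, hs⟩ ε hε
    obtain ⟨C, hC, hCs⟩ := Bornology.IsVonNBounded.exists_seminorm_le
      (isVonNBounded_dual_polar e hs) hq
    obtain ⟨n, hn⟩ := (hlim.eventually (gt_mem_nhds (show 0 < ε / (4 * C) by positivity))).exists_forall_of_atTop
    refine Filter.eventually_atTop.2 ⟨(n, n), ?_⟩
    rintro ⟨i, j⟩ ⟨hi, hj⟩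
    change s (a j - a i - 0) < ε
    rw [sub_zero]
    refine lt_of_le_of_lt (b := ε / 2) (seminorm_le_of_dual hs fun f hf => ?_) (by linarith)
    have hy : ∀ k ≥ n, ‖ξ (e.symm f) - f (a k)‖ ≤ ε / 4 := by
      intro k hk
      have h1 := ha k (e.symm f)
      rw [e.apply_symm_apply] at h1
      refine h1.trans ?_
      calc _ ≤ ε / (4 * C) * C :=
            mul_le_mul (hn k hk).le (hCs _ fun x => by simpa using hf x) (apply_nonneg _ _)
              (by positivity)
        _ = _ := by field_simp
    rw [map_sub, show f (a j) - f (a i) = (ξ (e.symm f) - f (a i)) - (ξ (e.symm f) - f (a j)) by ring]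
    refine (norm_sub_le _ _).trans ?_
    linarith [hy i hi, hy j hj]
  obtain ⟨x, hx⟩ := cauchySeq_tendsto_of_complete hc
  refine ⟨x, ContinuousLinearMap.ext fun y => ?_⟩
  have h1 : Filter.Tendsto (fun n => e y (a n)) Filter.atTop (𝓝 (e y x)) :=
    ((e y).continuous.tendsto x).comp hx
  have h2 : Filter.Tendsto (fun n => e y (a n)) Filter.atTop (𝓝 (ξ y)) := by
    rw [tendsto_iff_norm_sub_tendsto_zero]
    refine squeeze_zero (fun n => norm_nonneg _) (fun n => ?_)
      ((hlim.mul_const (q y)).trans (by rw [zero_mul]))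
    rw [norm_sub_rev]
    exact ha n y
  exact tendsto_nhds_unique h1 h2

theorem isVonNBounded_of_dual_bounded (e : E ≃L[𝕜] StrongDual 𝕜 F) {D : Set F}
    (h : ∀ y : E, ∃ C, ∀ d ∈ D, ‖e y d‖ ≤ C) : Bornology.IsVonNBounded 𝕜 D :=
  isVonNBounded_of_weakly_bounded fun f => by
    obtain ⟨C, hC⟩ := h (e.symm f)
    exact ⟨C, by simpa using hC⟩

/-- Let `p` be a lower semicontinuous seminorm. The set `D` of points of `F` dominated by `p` is
weakly bounded, hence bounded, so its polar is a neighbourhood of zero; by a bipolar argument, half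
of that polar lies in the unit ball of `p`. Reflexivity of `F` turns the separating functional into
a point of `D`. -/
theorem barrelledSpace_of_dual (hE : IsNuclearSpace 𝕜 E) (e : E ≃L[𝕜] StrongDual 𝕜 F) :
    BarrelledSpace 𝕜 E := by
  refine ⟨fun p hp => continuous_seminorm_of_mem_nhds ?_⟩
  let D : Set F := {x | ∀ y, ‖e y x‖ ≤ p y}
  have hD : Bornology.IsVonNBounded 𝕜 D :=
    isVonNBounded_of_dual_bounded e fun y => ⟨p y, fun d hd => hd y⟩
  have h0 : {y : E | ∀ a ∈ D, ‖e y a‖ ≤ 1} ∈ 𝓝 (0 : E) :=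
    e.continuous.continuousAt.preimage_mem_nhds (by rw [map_zero]; exact dual_polar_mem_nhds hD)
  have h0' : {y : E | ∀ a ∈ D, ‖e ((2 : 𝕜) • y) a‖ ≤ 1} ∈ 𝓝 (0 : E) := smul_preimage_mem h0 2
  refine Filter.mem_of_superset h0' fun y hy => ?_
  by_contra hpy
  have hpy : 1 < p y := not_le.1 hpy
  have hopen : {z | 1 < p (y - z)} ∈ 𝓝 (0 : E) := by
    have : IsOpen {z : E | 1 < p z} := lowerSemicontinuous_iff_isOpen_preimage.1 hp 1
    exact (this.preimage (continuous_const.sub continuous_id)).mem_nhds (by simpa using hpy)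
  -- Lower semicontinuity yields a continuous `s` with `p > 1` on the unit `s`-ball about `y`. Then
  -- the infimal convolution `p ⊓ s` is continuous, dominated by `p`, and at least 1 at `y`;
  -- Hahn–Banach applies to it although `p` is not yet known to be continuous.
  obtain ⟨s, hs, hsU⟩ := exists_seminorm_of_mem_nhds (𝕜 := 𝕜) hopen
  have hps : 1 ≤ (p ⊓ s) y := by
    rw [Seminorm.inf_apply]
    refine le_ciInf fun u => ?_
    by_contra hlt
    have hlt : p u + s (y - u) < 1 := not_le.1 hlt
    have h1 : 1 < p (y - (y - u)) := hsU _ (by have := apply_nonneg p u; linarith)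
    rw [sub_sub_cancel] at h1
    have := apply_nonneg s (y - u)
    linarith
  have hcont : Continuous (p ⊓ s : Seminorm 𝕜 E) :=
    Seminorm.continuous_of_le hs (inf_le_right)
  obtain ⟨f, hf, hfy⟩ := exists_dual_eq_seminorm hcont y
  obtain ⟨x, rfl⟩ := dualEval_surjective hE e f
  have h2 := hy x fun z => (hf z).trans (inf_le_left (a := p) (b := s) z)
  rw [map_smul, _root_.smul_apply, norm_smul, RCLike.norm_ofNat] at h2
  have h3 : ‖e y x‖ = (p ⊓ s) y := by
    rw [← dualEval_apply, hfy, RCLike.norm_ofReal, abs_of_nonneg (apply_nonneg _ _)]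
  rw [h3] at h2
  linarith

/-- By reflexivity, `F` and the strong dual of `E` are the same uniform space, so completeness
passes from `F`. -/
theorem completeSpace_dual_of_dual [BarrelledSpace 𝕜 F] (hE : IsNuclearSpace 𝕜 E)
    (e : E ≃L[𝕜] StrongDual 𝕜 F) : CompleteSpace (StrongDual 𝕜 E) := by
  let ev : F →+ StrongDual 𝕜 E := AddMonoidHom.mk' (dualEval e) fun x y => by
    ext z; simp
  have hev : IsUniformInducing ev := by
    refine IsUniformInducing.mk ?_
    rw [uniformity_eq_comap_nhds_zero, uniformity_eq_comap_nhds_zero, Filter.comap_comap]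
    have h1 : 𝓝 (0 : F) = Filter.comap ev (𝓝 0) := by
      refine le_antisymm ?_ ?_
      · rw [← Filter.map_le_iff_le_comap]
        intro W hW
        obtain ⟨A, hA, hA'⟩ := exists_polar_subset hW
        -- As `F` is barrelled, bounded sets of its dual are equicontinuous; this makes `ev`
        -- continuous. The reverse inclusion uses that polars of neighbourhoods are bounded.
        obtain ⟨s, hs, hs'⟩ := exists_seminorm_of_pointwise_bdd (fun y : A => e (y : E))
          (r := normSeminorm 𝕜 𝕜) continuous_norm fun x => by
            obtain ⟨C, -, hC⟩ := Bornology.IsVonNBounded.exists_seminorm_le hA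
              (p := dualSeminorm (dualEval e x).toLinearMap) (dualEval e x).continuous.norm
            exact ⟨C, fun i => hC i i.2⟩
        change ev ⁻¹' W ∈ 𝓝 (0 : F)
        exact Filter.mem_of_superset (seminorm_ball_mem_nhds hs one_pos)
          fun x hx => hA' _ fun y hy => (hs' ⟨y, hy⟩ x).trans hx
      · intro U hU
        obtain ⟨s, hs, hsU⟩ := exists_seminorm_of_mem_nhds (𝕜 := 𝕜) hU
        refine ⟨_, dual_polar_mem_nhds (isVonNBounded_dual_polar e hs), fun x hx => hsU x ?_⟩
        refine seminorm_le_of_dual hs fun f hf => ?_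
        simpa [ev] using hx (e.symm f) (by simpa using hf)
    rw [h1, Filter.comap_comap]
    congr 1
    ext p
    simp
  exact (hev.completeSpace_congr (dualEval_surjective hE e)).1 inferInstance

end DualOfFrechet

/-! ### The consequences of well-behavedness used below -/

section WellBehaved
universe u v
variable {𝕜 : Type u} [RCLike 𝕜]
  {E : Type v} [AddCommGroup E] [Module 𝕜 E] [UniformSpace E] [IsUniformAddGroup E]

theorem IsWellBehaved.barrelledSpace_and_completeSpace_dual [ContinuousSMul 𝕜 E]
    [PolynormableSpace 𝕜 E] (h : IsWellBehaved 𝕜 E) :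
    BarrelledSpace 𝕜 E ∧ CompleteSpace (StrongDual 𝕜 E) := by
  obtain ⟨hn, h | ⟨F, _, _, _, _, hF, ⟨e⟩⟩⟩ := h
  · exact ⟨h.barrelled, h.completeSpace_dual⟩
  · have := hF.locallyConvex
    have := hF.hausdorff
    have := hF.complete
    have := hF.continuousSMul
    have := hF.barrelled
    exact ⟨barrelledSpace_of_dual hn e, completeSpace_dual_of_dual hn e⟩

end WellBehaved

/-! ### Neighbourhoods in spaces of operators -/

section Operators

variable {𝕜 : Type*} [RCLike 𝕜] {E : Type*} [AddCommGroup E] [Module 𝕜 E] [TopologicalSpace E]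
  [IsTopologicalAddGroup E] [ContinuousSMul 𝕜 E]
variable {X : Type*} [AddCommGroup X] [Module 𝕜 X] [TopologicalSpace X]
  [IsTopologicalAddGroup X] [ContinuousSMul 𝕜 X]

theorem continuous_of_seminorm_le [PolynormableSpace 𝕜 X] (f : E →ₗ[𝕜] X)
    (h : ∀ r : Seminorm 𝕜 X, Continuous r →
      ∃ p : Seminorm 𝕜 E, Continuous p ∧ ∀ x, r (f x) ≤ p x) : Continuous f := by
  refine (PolynormableSpace.withSeminorms 𝕜 X).continuous_of_continuous_comp f fun r => ?_
  obtain ⟨p, hp, hrp⟩ := h r.1 r.2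
  exact Seminorm.continuous_of_le hp hrp

/-- The evaluation at `x` as a functional on the strong dual. -/
def evalDual (x : E) : StrongDual 𝕜 (StrongDual 𝕜 E) :=
  ⟨{ toFun := fun f => f x
     map_add' := fun _ _ => rfl
     map_smul' := fun _ _ => rfl }, continuous_eval_const x⟩

@[simp] theorem evalDual_apply (x : E) (f : StrongDual 𝕜 E) : evalDual x f = f x := rfl

/-- The basic neighbourhoods of zero in the space of operators. -/
theorem clm_mem_nhds {A : Set E} (hA : Bornology.IsVonNBounded 𝕜 A) {q : Seminorm 𝕜 X}
    (hq : Continuous q) {ε : ℝ} (hε : 0 < ε) :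
    {T : E →L[𝕜] X | ∀ a ∈ A, q (T a) ≤ ε} ∈ 𝓝 (0 : E →L[𝕜] X) :=
  Filter.mem_of_superset (ContinuousLinearMap.eventually_nhds_zero_mapsTo hA
    (seminorm_ball_mem_nhds hq hε)) fun _ hT _ ha => hT ha

theorem exists_clm_nhds [PolynormableSpace 𝕜 X] {W : Set (E →L[𝕜] X)}
    (hW : W ∈ 𝓝 (0 : E →L[𝕜] X)) : ∃ (A : Set E) (q : Seminorm 𝕜 X),
      Bornology.IsVonNBounded 𝕜 A ∧ Continuous q ∧ ∀ T : E →L[𝕜] X, (∀ a ∈ A, q (T a) ≤ 1) →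
        T ∈ W := by
  obtain ⟨⟨A, U⟩, ⟨hA, hU⟩, h⟩ :=
    (ContinuousLinearMap.hasBasis_nhds_zero (σ := RingHom.id 𝕜) (E := E) (F := X)).mem_iff.1 hW
  obtain ⟨q, hq, hqU⟩ := exists_seminorm_of_mem_nhds (𝕜 := 𝕜) hU
  exact ⟨A, q, hA, hq, fun T hT => h fun a ha => hqU _ (hT a ha)⟩

end Operators

/-! ### The isomorphism of `H° ⊗̂ H` with `L(H, H)` -/

namespace TopHopfAlgebra
section Double
universe u v
variable {𝕜 : Type u} [RCLike 𝕜]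
variable {H : Type v} [Ring H] [Algebra 𝕜 H] [UniformSpace H] [IsUniformAddGroup H]
  [IsTopologicalRing H] [ContinuousSMul 𝕜 H] [PolynormableSpace 𝕜 H] [CompleteSpace H] [T2Space H]

/-- The evaluation at `x` of the operators defined by the elements of `H° ⊗̂ H`. -/
noncomputable def toEndEval (x : H) : AYDDouble 𝕜 H →L[𝕜] H :=
  lift₂ (LinearMap.mk₂ 𝕜 (fun (φ : StrongDual 𝕜 H) (h : H) => φ x • h)
      (fun φ φ' h => by simp [add_smul]) (fun k φ h => by simp [mul_smul])
      (fun φ h h' => smul_add _ h h') (fun k φ h => smul_comm _ k h))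
    (((continuous_eval_const x).comp continuous_fst).smul continuous_snd)

theorem toEndEval_apply (x : H) (T : AYDDouble 𝕜 H) : toEndEval x T = toEnd T x := rfl

@[simp] theorem toEnd_ctmul (φ : StrongDual 𝕜 H) (h x : H) :
    toEnd (ctmul 𝕜 φ h) x = φ x • h := lift₂_ctmul _ _ φ h

/-- Slices are matrix coefficients of `λ(b)`; this converts slice estimates into operator estimates.
-/
theorem dual_toEnd [CompleteSpace (StrongDual 𝕜 H)] (ψ : StrongDual 𝕜 H) (b : AYDDouble 𝕜 H)
    (x : H) : ψ (toEnd b x) = sliceRight ψ b x := by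
  have : ψ ∘L toEndEval x = evalDual x ∘L sliceRight ψ :=
    CTensor.ext fun φ h => by
      simp [toEndEval_apply, mul_comm]
  exact congrArg (fun f : AYDDouble 𝕜 H →L[𝕜] 𝕜 => f b) this

/-- The linear operator on `H` defined by an element of `H° ⊗̂ H`. -/
noncomputable def toEndₗ (b : AYDDouble 𝕜 H) : H →ₗ[𝕜] H where
  toFun := toEnd b
  map_add' x y := by
    have : toEndEval (x + y) = (toEndEval x + toEndEval y : AYDDouble 𝕜 H →L[𝕜] H) :=
      CTensor.ext fun φ h => by simp [toEndEval_apply, add_smul]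
    exact congrArg (fun f : AYDDouble 𝕜 H →L[𝕜] H => f b) this
  map_smul' c x := by
    have : toEndEval (c • x) = (c • toEndEval x : AYDDouble 𝕜 H →L[𝕜] H) :=
      CTensor.ext fun φ h => by simp [toEndEval_apply, mul_smul]
    exact congrArg (fun f : AYDDouble 𝕜 H →L[𝕜] H => f b) this

variable [BarrelledSpace 𝕜 H] [CompleteSpace (StrongDual 𝕜 H)]

/-- The slices of `b` by functionals dominated by `r` are pointwise bounded, hence equicontinuous
because `H` is barrelled. -/
theorem continuous_toEnd (b : AYDDouble 𝕜 H) : Continuous (toEnd b) := by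
  refine continuous_of_seminorm_le (toEndₗ b) fun r hr => ?_
  obtain ⟨p, hp, hp'⟩ := exists_seminorm_of_pointwise_bdd (r := normSeminorm 𝕜 𝕜)
    (fun ψ : {ψ : StrongDual 𝕜 H // ∀ y, ‖ψ y‖ ≤ r y} => sliceRight ψ.1 b) continuous_norm
    fun x => ⟨r (toEnd b x), fun ψ => by
      change ‖sliceRight ψ.1 b x‖ ≤ _
      rw [← dual_toEnd]; exact ψ.2 _⟩
  refine ⟨p, hp, fun x => seminorm_le_of_dual hr fun ψ hψ => ?_⟩
  change ‖ψ (toEnd b x)‖ ≤ _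
  rw [dual_toEnd]
  exact hp' ⟨ψ, hψ⟩ x

/-- The map `λ : H° ⊗̂ H → L(H, H)`. -/
noncomputable def doubleToEndₗ : AYDDouble 𝕜 H →ₗ[𝕜] (H →L[𝕜] H) where
  toFun b := ⟨toEndₗ b, continuous_toEnd b⟩
  map_add' b b' := ContinuousLinearMap.ext fun x => map_add (toEndEval x) b b'
  map_smul' c b := ContinuousLinearMap.ext fun x => map_smul (toEndEval x) c b

@[simp] theorem doubleToEndₗ_apply (b : AYDDouble 𝕜 H) (x : H) :
    doubleToEndₗ b x = toEnd b x := rfl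

theorem continuous_doubleToEndₗ : Continuous (doubleToEndₗ : AYDDouble 𝕜 H →ₗ[𝕜] (H →L[𝕜] H)) := by
  refine continuous_of_continuousAt_zero (doubleToEndₗ : AYDDouble 𝕜 H →ₗ[𝕜] (H →L[𝕜] H)) ?_
  rw [ContinuousAt, map_zero]
  intro W hW
  obtain ⟨A, q, hA, hq, hW⟩ := exists_clm_nhds hW
  obtain ⟨N, hN, h⟩ := lift₂_equibounded
    (fun x : A => LinearMap.mk₂ 𝕜 (fun (φ : StrongDual 𝕜 H) (h : H) => φ (x : H) • h)
      (fun φ φ' h => by simp [add_smul]) (fun k φ h => by simp [mul_smul])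
      (fun φ h h' => smul_add _ h h') (fun k φ h => smul_comm _ k h))
    (fun x => ((continuous_eval_const (x : H)).comp continuous_fst).smul continuous_snd) q hq
    (dual_polar_mem_nhds hA) (seminorm_ball_mem_nhds hq one_pos) fun x φ hφ h hh => by
      change q (φ (x : H) • h) ≤ 1
      rw [map_smul_eq_mul]
      exact mul_le_one₀ (hφ x x.2) (apply_nonneg q h) hh
  change doubleToEndₗ ⁻¹' W ∈ 𝓝 (0 : AYDDouble 𝕜 H)
  exact Filter.mem_of_superset hN fun b hb => hW _ fun a ha => h ⟨a, ha⟩ b hb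

/-- A continuous seminorm on `H° ⊗̂ H` is controlled by the slices in the strong dual, that is, by
their values on a bounded set `A`. By `dual_toEnd` these are controlled by `λ(b)` on `A`, which
describes a neighbourhood in `L(H, H)`. -/
theorem isUniformInducing_doubleToEndₗ (hH : IsNuclearSpace 𝕜 H) :
    IsUniformInducing (doubleToEndₗ : AYDDouble 𝕜 H →ₗ[𝕜] (H →L[𝕜] H)) := by
  have h1 : 𝓝 (0 : AYDDouble 𝕜 H) = Filter.comap (doubleToEndₗ : AYDDouble 𝕜 H →ₗ[𝕜] (H →L[𝕜] H)) (𝓝 0) := by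
    refine le_antisymm ?_ ?_
    · rw [← Filter.map_le_iff_le_comap]
      have := (continuous_doubleToEndₗ (𝕜 := 𝕜) (H := H)).tendsto 0
      rwa [map_zero] at this
    · intro U hU
      obtain ⟨r, hr, hrU⟩ := exists_seminorm_of_mem_nhds (𝕜 := 𝕜) hU
      obtain ⟨p, q, K, hp, hq, hK, h⟩ := hH.seminorm_le_slices hr
      obtain ⟨A, hA, hA'⟩ := exists_polar_subset (seminorm_ball_mem_nhds hp one_pos)
      have hK1 : 0 < K + 1 := by linarith
      refine ⟨_, clm_mem_nhds hA hq (inv_pos.2 hK1), fun b hb => hrU b ?_⟩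
      refine (h b (K + 1)⁻¹ fun ψ hψ => ?_).trans ?_
      · refine seminorm_le_of_smul_le p hK1 (hA' _ fun a ha => ?_)
        rw [_root_.smul_apply, ← dual_toEnd, norm_smul, RCLike.norm_ofReal, abs_of_pos hK1]
        have h2 : q (toEnd b a) ≤ (K + 1)⁻¹ := hb a ha
        calc _ ≤ (K + 1) * (K + 1)⁻¹ := by gcongr; exact (hψ _).trans h2
          _ = 1 := mul_inv_cancel₀ hK1.ne'
      · rw [← div_eq_mul_inv, div_le_one hK1]; linarith
  refine IsUniformInducing.mk ?_
  rw [uniformity_eq_comap_nhds_zero, uniformity_eq_comap_nhds_zero, h1, Filter.comap_comap, Filter.comap_comap]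
  congr 1
  ext p
  simp

/-- The range is complete, hence closed, and it contains the operators `T ∘ G` of finite rank. By
nuclearity these approximate `T` uniformly on bounded sets. -/
theorem doubleToEndₗ_surjective (hH : IsNuclearSpace 𝕜 H) :
    Function.Surjective (doubleToEndₗ : AYDDouble 𝕜 H →ₗ[𝕜] (H →L[𝕜] H)) := by
  have hcl : IsClosed (Set.range (doubleToEndₗ : AYDDouble 𝕜 H →ₗ[𝕜] (H →L[𝕜] H))) :=
    (isUniformInducing_doubleToEndₗ hH).isComplete_range.isClosed
  intro T
  change T ∈ Set.range _
  rw [← hcl.closure_eq, mem_closure_iff_nhds]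
  intro W hW
  have hW0 : {S | T - S ∈ W} ∈ 𝓝 (0 : H →L[𝕜] H) :=
    (continuous_const.sub continuous_id).continuousAt.preimage_mem_nhds (by simpa using hW)
  obtain ⟨A, r, hA, hr, hW0⟩ := exists_clm_nhds hW0
  obtain ⟨q, K, hq, hK, happ⟩ := hH.approx
    (q := r.comp T.toLinearMap) (hr.comp T.continuous)
  obtain ⟨C, hC, hCA⟩ := Bornology.IsVonNBounded.exists_seminorm_le hA hq
  obtain ⟨N, c, φ, y, -, -, -, h⟩ := happ C⁻¹ (by positivity)
  -- The approximant is `T ∘ G`, written so that its difference from `T` is the small operator.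
  refine ⟨T - (T - T ∘L finiteRank N c φ y), hW0 _ fun a ha => ?_,
    ∑ n ∈ Finset.range N, ctmul 𝕜 (c n • φ n) (T (y n)), ?_⟩
  · have h2 := h a
    have h1 : (T - T ∘L finiteRank N c φ y) a =
        T (a - ∑ n ∈ Finset.range N, (c n * φ n a) • y n) := by
      rw [map_sub, ← finiteRank_apply]; rfl
    rw [h1]
    refine h2.trans ?_
    rw [inv_mul_le_iff₀ hC, mul_one]
    exact hCA a ha
  · ext x
    rw [sub_sub_cancel, map_sum]
    simp [finiteRank_apply]

/-- For a nuclear space `H`, the topological isomorphism `H° ⊗̂ H ≃ L(H, H)`. -/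
noncomputable def doubleEquivEnd (hH : IsNuclearSpace 𝕜 H) : AYDDouble 𝕜 H ≃L[𝕜] (H →L[𝕜] H) where
  toLinearEquiv := LinearEquiv.ofBijective doubleToEndₗ
    ⟨(isUniformInducing_doubleToEndₗ hH).injective, doubleToEndₗ_surjective hH⟩
  continuous_toFun := continuous_doubleToEndₗ
  continuous_invFun := (isUniformInducing_doubleToEndₗ hH).isInducing.continuous_iff.2 <| by
    refine continuous_id.congr fun T => ?_
    exact ((LinearEquiv.ofBijective doubleToEndₗ ⟨(isUniformInducing_doubleToEndₗ hH).injective,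
      doubleToEndₗ_surjective hH⟩).apply_symm_apply T).symm

@[simp] theorem doubleEquivEnd_apply (hH : IsNuclearSpace 𝕜 H) (b : AYDDouble 𝕜 H) (x : H) :
    doubleEquivEnd hH b x = toEnd b x := rfl

theorem toEnd_ext (hH : IsNuclearSpace 𝕜 H) {b b' : AYDDouble 𝕜 H} (h : ∀ x, toEnd b x = toEnd b' x) :
    b = b' :=
  (doubleEquivEnd hH).injective (ContinuousLinearMap.ext h)

end Double
end TopHopfAlgebra

/-! ### Continuity of `T ↦ T ⊗̂ id` -/

section Slice

universe u v w
variable {𝕜 : Type u} [RCLike 𝕜]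
  {E : Type v} [AddCommGroup E] [Module 𝕜 E] [UniformSpace E]
    [IsUniformAddGroup E] [ContinuousSMul 𝕜 E] [PolynormableSpace 𝕜 E] [CompleteSpace E]
    [T2Space E]
  {V : Type w} [AddCommGroup V] [Module 𝕜 V] [UniformSpace V]
    [IsUniformAddGroup V] [ContinuousSMul 𝕜 V] [PolynormableSpace 𝕜 V] [CompleteSpace V]
    [T2Space V]

theorem sliceRight_cmap_id {E' : Type*} [AddCommGroup E'] [Module 𝕜 E'] [UniformSpace E']
    [IsUniformAddGroup E'] [ContinuousSMul 𝕜 E'] [PolynormableSpace 𝕜 E'] [CompleteSpace E']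
    [T2Space E'] (ψ : StrongDual 𝕜 V) (T : E →L[𝕜] E') (t : CTensor 𝕜 E V) :
    sliceRight ψ (cmap T (.id 𝕜 V) t) = T (sliceRight ψ t) := by
  have : sliceRight ψ ∘L cmap T (.id 𝕜 V) = T ∘L sliceRight ψ := CTensor.ext fun x y => by simp
  exact congrArg (fun f : CTensor 𝕜 E V →L[𝕜] E' => f t) this

/-- `T ↦ T ⊗̂ id` as a linear map. -/
noncomputable def cmapIdₗ : (E →L[𝕜] E) →ₗ[𝕜] (CTensor 𝕜 E V →L[𝕜] CTensor 𝕜 E V) where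
  toFun T := cmap T (.id 𝕜 V)
  map_add' T T' := cmap_add_left T T' _
  map_smul' c T := cmap_smul_left c T _

/-- For a nuclear space `V`, the map `T ↦ T ⊗̂ id_V` is continuous. -/
theorem IsNuclearSpace.continuous_cmap_id (hV : IsNuclearSpace 𝕜 V) :
    Continuous (fun T : E →L[𝕜] E => cmap T (.id 𝕜 V)) := by
  refine continuous_of_continuousAt_zero (cmapIdₗ : (E →L[𝕜] E) →ₗ[𝕜] (CTensor 𝕜 E V →L[𝕜] CTensor 𝕜 E V)) ?_
  rw [ContinuousAt, map_zero]
  intro W hW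
  obtain ⟨B, r, hB, hr, hW⟩ := exists_clm_nhds hW
  obtain ⟨p, q, K, hp, hq, hK, h⟩ := hV.seminorm_le_slices hr
  have hK1 : 0 < K + 1 := by linarith
  -- All slices of elements of `B` by functionals dominated by `q` form a bounded set. Smallness of
  -- `T` on it makes `T ⊗̂ id` small on `B`, because slicing commutes with `T`.
  have hA : Bornology.IsVonNBounded 𝕜
      {x : E | ∃ t ∈ B, ∃ ψ : StrongDual 𝕜 V, (∀ y, ‖ψ y‖ ≤ q y) ∧ sliceRight ψ t = x} := by
    refine isVonNBounded_of_seminorm_le (𝕜 := 𝕜) fun s hs => ?_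
    obtain ⟨N, hN, hN'⟩ := sliceRight_equibounded (X := E) hs hq
    obtain ⟨ρ, hρ, hρN⟩ := exists_seminorm_of_mem_nhds (𝕜 := 𝕜) hN
    obtain ⟨C, hC, hCB⟩ := Bornology.IsVonNBounded.exists_seminorm_le hB hρ
    refine ⟨C, ?_⟩
    rintro _ ⟨t, ht, ψ, hψ, rfl⟩
    refine (seminorm_le_of_le_one (r := s.comp (sliceRight ψ).toLinearMap) (p := ρ)
      (fun t ht => hN' ψ hψ t (hρN t ht)) t).trans (hCB t ht)
  change cmapIdₗ ⁻¹' W ∈ 𝓝 (0 : E →L[𝕜] E)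
  refine Filter.mem_of_superset (clm_mem_nhds hA hp (inv_pos.2 hK1)) fun T hT => hW _ fun t ht => ?_
  change r (cmap T (.id 𝕜 V) t) ≤ 1
  refine (h _ (K + 1)⁻¹ fun ψ hψ => ?_).trans ?_
  · rw [sliceRight_cmap_id]
    exact hT _ ⟨t, ht, ψ, hψ, rfl⟩
  · rw [← div_eq_mul_inv, div_le_one hK1]; linarith

end Slice

/-! ### Rearranging tensor factors -/

section Maps

variable {𝕜 : Type*} [RCLike 𝕜]
variable {E : Type*} [AddCommGroup E] [Module 𝕜 E] [TopologicalSpace E]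
  [ContinuousSMul 𝕜 E] [IsTopologicalAddGroup E]
variable {F : Type*} [AddCommGroup F] [Module 𝕜 F] [TopologicalSpace F]
  [ContinuousSMul 𝕜 F] [IsTopologicalAddGroup F]
variable {G : Type*} [AddCommGroup G] [Module 𝕜 G] [TopologicalSpace G]
  [ContinuousSMul 𝕜 G] [IsTopologicalAddGroup G]
variable {E' : Type*} [AddCommGroup E'] [Module 𝕜 E'] [TopologicalSpace E']
  [ContinuousSMul 𝕜 E'] [IsTopologicalAddGroup E']
variable {F' : Type*} [AddCommGroup F'] [Module 𝕜 F'] [TopologicalSpace F']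
  [ContinuousSMul 𝕜 F'] [IsTopologicalAddGroup F']
variable {E'' : Type*} [AddCommGroup E''] [Module 𝕜 E''] [TopologicalSpace E'']
  [ContinuousSMul 𝕜 E''] [IsTopologicalAddGroup E'']
variable {F'' : Type*} [AddCommGroup F''] [Module 𝕜 F''] [TopologicalSpace F'']
  [ContinuousSMul 𝕜 F''] [IsTopologicalAddGroup F'']
variable {X : Type*} [AddCommGroup X] [Module 𝕜 X] [TopologicalSpace X]

/-- With both sides written as continuous linear maps of one variable tensor, an identity may be
checked on elementary tensors. All Sweedler computations below rest on this. -/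
theorem CTensor.congr [T2Space X] {f g : CTensor 𝕜 E F →L[𝕜] X}
    (h : ∀ x y, f (ctmul 𝕜 x y) = g (ctmul 𝕜 x y)) (t : CTensor 𝕜 E F) : f t = g t :=
  DFunLike.congr_fun (CTensor.ext h) t

/-- The map `y ↦ x ⊗ y`. -/
noncomputable def tmulLeft (F : Type*) [AddCommGroup F] [Module 𝕜 F] [TopologicalSpace F] (x : E) :
    F →L[𝕜] CTensor 𝕜 E F :=
  ⟨ctmulₗ 𝕜 E F x, continuous_ctmul.comp (continuous_const.prodMk continuous_id)⟩

@[simp] theorem tmulLeft_apply (x : E) (y : F) : tmulLeft F x y = ctmul 𝕜 x y := rfl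

theorem CTensor.congr₃ [T2Space X] {f g : CTensor 𝕜 E (CTensor 𝕜 F G) →L[𝕜] X}
    (h : ∀ x y z, f (ctmul 𝕜 x (ctmul 𝕜 y z)) = g (ctmul 𝕜 x (ctmul 𝕜 y z)))
    (t : CTensor 𝕜 E (CTensor 𝕜 F G)) : f t = g t :=
  CTensor.congr (fun x u => CTensor.congr (f := f ∘L tmulLeft _ x) (g := g ∘L tmulLeft _ x)
    (fun y z => h x y z) u) t

theorem cmap_cmap (f : E' →L[𝕜] E'') (g : F' →L[𝕜] F'') (f' : E →L[𝕜] E') (g' : F →L[𝕜] F')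
    (t : CTensor 𝕜 E F) : cmap f g (cmap f' g' t) = cmap (f ∘L f') (g ∘L g') t :=
  CTensor.congr (f := cmap f g ∘L cmap f' g') (fun x y => by simp) t

theorem cmap_id_id (t : CTensor 𝕜 E F) : cmap (.id 𝕜 E) (.id 𝕜 F) t = t :=
  CTensor.congr (g := .id 𝕜 _) (fun x y => by simp) t

theorem bddNearZero₃_of_continuous {f : E →ₗ[𝕜] F →ₗ[𝕜] G →ₗ[𝕜] X}
    (hf : Continuous (fun p : E × F × G => f p.1 p.2.1 p.2.2)) : BddNearZero₃ f := by
  intro r hr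
  have h : {p : E × F × G | r (f p.1 p.2.1 p.2.2) < 1} ∈ 𝓝 ((0, 0, 0) : E × F × G) :=
    (isOpen_lt (hr.comp hf) continuous_const).mem_nhds (by simp)
  obtain ⟨U, hU, VW, hVW, h1⟩ := mem_nhds_prod_iff.1 h
  obtain ⟨V, hV, W, hW, h2⟩ := mem_nhds_prod_iff.1 hVW
  exact ⟨U, hU, V, hV, W, hW, fun x hx y hy z hz =>
    le_of_lt (h1 (Set.mk_mem_prod hx (h2 (Set.mk_mem_prod hy hz))))⟩

theorem _root_.Continuous.ctmul {α : Type*} [TopologicalSpace α] {f : α → E} {g : α → F}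
    (hf : Continuous f) (hg : Continuous g) : Continuous fun a => ctmul 𝕜 (f a) (g a) :=
  continuous_ctmul.comp (hf.prodMk hg)

variable (𝕜 E F G)

/-- The trilinear map `(x, y, z) ↦ y ⊗ (x ⊗ z)`. -/
noncomputable def leftCommTri : E →ₗ[𝕜] F →ₗ[𝕜] G →ₗ[𝕜] CTensor 𝕜 F (CTensor 𝕜 E G) where
  toFun x := (ctmulₗ 𝕜 F (CTensor 𝕜 E G)).compl₂ (ctmulₗ 𝕜 E G x)
  map_add' x x' := by ext y z; simp
  map_smul' c x := by ext y z; simp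

/-- The map `x ⊗ (y ⊗ z) ↦ y ⊗ (x ⊗ z)`. -/
noncomputable def cleftComm :
    CTensor 𝕜 E (CTensor 𝕜 F G) →L[𝕜] CTensor 𝕜 F (CTensor 𝕜 E G) :=
  lift₃ (leftCommTri 𝕜 E F G) (bddNearZero₃_of_continuous
    (continuous_snd.fst.ctmul (continuous_fst.ctmul continuous_snd.snd)))

/-- The trilinear map `(z, x, y) ↦ x ⊗ (y ⊗ z)`. -/
noncomputable def rotateTri : G →ₗ[𝕜] E →ₗ[𝕜] F →ₗ[𝕜] CTensor 𝕜 E (CTensor 𝕜 F G) where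
  toFun z := (ctmulₗ 𝕜 E (CTensor 𝕜 F G)).compl₂ ((ctmulₗ 𝕜 F G).flip z)
  map_add' x x' := by ext y z; simp
  map_smul' c x := by ext y z; simp

/-- The map `(x ⊗ y) ⊗ z ↦ x ⊗ (y ⊗ z)`. -/
noncomputable def cassocInv :
    CTensor 𝕜 (CTensor 𝕜 E F) G →L[𝕜] CTensor 𝕜 E (CTensor 𝕜 F G) :=
  lift₃ (rotateTri 𝕜 E F G) (bddNearZero₃_of_continuous
    (continuous_snd.fst.ctmul (continuous_snd.snd.ctmul continuous_fst))) ∘L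
    cswap 𝕜 (CTensor 𝕜 E F) G

variable {𝕜 E F G}

@[simp] theorem cleftComm_ctmul (x : E) (y : F) (z : G) :
    cleftComm 𝕜 E F G (ctmul 𝕜 x (ctmul 𝕜 y z)) = ctmul 𝕜 y (ctmul 𝕜 x z) :=
  lift₃_ctmul _ _ x y z

@[simp] theorem cassoc_ctmul (x : E) (y : F) (z : G) :
    cassoc 𝕜 E F G (ctmul 𝕜 x (ctmul 𝕜 y z)) = ctmul 𝕜 (ctmul 𝕜 x y) z :=
  lift₃_ctmul _ _ x y z

@[simp] theorem cassocInv_ctmul (x : E) (y : F) (z : G) :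
    cassocInv 𝕜 E F G (ctmul 𝕜 (ctmul 𝕜 x y) z) = ctmul 𝕜 x (ctmul 𝕜 y z) := by
  rw [cassocInv, ContinuousLinearMap.comp_apply, cswap_ctmul]
  exact lift₃_ctmul _ _ z x y

/-- For `f : E ⊗̂ F → F'`, the map `(x ⊗ z) ⊗ y ↦ x ⊗ f (z ⊗ y)`. -/
noncomputable def actSnd (f : CTensor 𝕜 G F →L[𝕜] F') :
    CTensor 𝕜 (CTensor 𝕜 E G) F →L[𝕜] CTensor 𝕜 E F' :=
  cmap (.id 𝕜 E) f ∘L cassocInv 𝕜 E G F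

/-- For `f : E ⊗̂ F → F'`, the map `(x ⊗ z) ⊗ y ↦ z ⊗ f (x ⊗ y)`. -/
noncomputable def actFst (f : CTensor 𝕜 E F →L[𝕜] F') :
    CTensor 𝕜 (CTensor 𝕜 E G) F →L[𝕜] CTensor 𝕜 G F' :=
  cmap (.id 𝕜 G) f ∘L cleftComm 𝕜 E G F ∘L cassocInv 𝕜 E G F

@[simp] theorem actSnd_ctmul (f : CTensor 𝕜 G F →L[𝕜] F') (x : E) (z : G) (y : F) :
    actSnd f (ctmul 𝕜 (ctmul 𝕜 x z) y) = ctmul 𝕜 x (f (ctmul 𝕜 z y)) := by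
  simp [actSnd]

@[simp] theorem actFst_ctmul (f : CTensor 𝕜 E F →L[𝕜] F') (x : E) (z : G) (y : F) :
    actFst f (ctmul 𝕜 (ctmul 𝕜 x z) y) = ctmul 𝕜 z (f (ctmul 𝕜 x y)) := by
  simp [actFst]

/-- For `f : G ⊗̂ E → E'`, the map `z ⊗ (x ⊗ y) ↦ f (z ⊗ x) ⊗ y`. -/
noncomputable def leg₁ (F : Type*) [AddCommGroup F] [Module 𝕜 F] [TopologicalSpace F]
    [ContinuousSMul 𝕜 F] [IsTopologicalAddGroup F] (f : CTensor 𝕜 G E →L[𝕜] E') :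
    CTensor 𝕜 G (CTensor 𝕜 E F) →L[𝕜] CTensor 𝕜 E' F :=
  cmap f (.id 𝕜 F) ∘L cassoc 𝕜 G E F

/-- For `f : G ⊗̂ F → F'`, the map `z ⊗ (x ⊗ y) ↦ x ⊗ f (z ⊗ y)`. -/
noncomputable def leg₂ (E : Type*) [AddCommGroup E] [Module 𝕜 E] [TopologicalSpace E]
    [ContinuousSMul 𝕜 E] [IsTopologicalAddGroup E] (f : CTensor 𝕜 G F →L[𝕜] F') :
    CTensor 𝕜 G (CTensor 𝕜 E F) →L[𝕜] CTensor 𝕜 E F' :=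
  cmap (.id 𝕜 E) f ∘L cleftComm 𝕜 G E F

@[simp] theorem leg₁_ctmul (f : CTensor 𝕜 G E →L[𝕜] E') (z : G) (x : E) (y : F) :
    leg₁ F f (ctmul 𝕜 z (ctmul 𝕜 x y)) = ctmul 𝕜 (f (ctmul 𝕜 z x)) y := by
  simp [leg₁]

@[simp] theorem leg₂_ctmul (f : CTensor 𝕜 G F →L[𝕜] F') (z : G) (x : E) (y : F) :
    leg₂ E f (ctmul 𝕜 z (ctmul 𝕜 x y)) = ctmul 𝕜 x (f (ctmul 𝕜 z y)) := by
  simp [leg₂]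

end Maps

/-! ### Multiplication as maps on tensor products -/

section Mul

variable {𝕜 : Type*} [RCLike 𝕜]
variable {H : Type*} [Ring H] [Algebra 𝕜 H] [UniformSpace H] [IsUniformAddGroup H]
  [IsTopologicalRing H] [ContinuousSMul 𝕜 H] [PolynormableSpace 𝕜 H] [CompleteSpace H] [T2Space H]

variable (𝕜 H) in
/-- The multiplication as a map `H ⊗̂ H → H`. -/
noncomputable def mulC : CTensor 𝕜 H H →L[𝕜] H := lift₂ (LinearMap.mul 𝕜 H) continuous_mul

variable (𝕜 H) in
/-- The opposite multiplication as a map `H ⊗̂ H → H`. -/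
noncomputable def mulOpC : CTensor 𝕜 H H →L[𝕜] H := mulC 𝕜 H ∘L cswap 𝕜 H H

@[simp] theorem mulC_ctmul (a b : H) : mulC 𝕜 H (ctmul 𝕜 a b) = a * b := lift₂_ctmul _ _ a b

@[simp] theorem mulOpC_ctmul (a b : H) : mulOpC 𝕜 H (ctmul 𝕜 a b) = b * a := by simp [mulOpC]

variable (𝕜 H) in
/-- The product of `H ⊗̂ H` as a map on the tensor product. -/
noncomputable def tensorMulC : CTensor 𝕜 (CTensor 𝕜 H H) (CTensor 𝕜 H H) →L[𝕜] CTensor 𝕜 H H :=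
  leg₁ H (mulC 𝕜 H) ∘L actSnd (leg₂ H (mulC 𝕜 H))

@[simp] theorem tensorMulC_ctmul (a b c d : H) :
    tensorMulC 𝕜 H (ctmul 𝕜 (ctmul 𝕜 a b) (ctmul 𝕜 c d)) = ctmul 𝕜 (a * c) (b * d) := by
  simp [tensorMulC]

theorem tensorMul_eq (s t : CTensor 𝕜 H H) : tensorMul s t = tensorMulC 𝕜 H (ctmul 𝕜 s t) := by
  refine CTensor.congr (f := lift₂ (tensorMulAux s) (tensorMulAux_bdd s).continuous)
    (g := tensorMulC 𝕜 H ∘L tmulLeft _ s) (fun c d => ?_) t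
  rw [lift₂_ctmul]
  exact CTensor.congr (f := cmap (rmul 𝕜 c) (rmul 𝕜 d))
    (g := tensorMulC 𝕜 H ∘L tmulRight _ (ctmul 𝕜 c d)) (fun a b => by simp; rfl) s

end Mul

/-! ### Sweedler calculus -/

namespace TopHopfAlgebra
section Sweedler

variable {𝕜 : Type*} [RCLike 𝕜]
variable {H : Type*} [Ring H] [Algebra 𝕜 H] [UniformSpace H] [IsUniformAddGroup H]
  [IsTopologicalRing H] [ContinuousSMul 𝕜 H] [PolynormableSpace 𝕜 H] [CompleteSpace H] [T2Space H]
  (A : TopHopfAlgebra 𝕜 H)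
variable {Y : Type*} [AddCommGroup Y] [Module 𝕜 Y] [UniformSpace Y]
    [IsUniformAddGroup Y] [ContinuousSMul 𝕜 Y] [PolynormableSpace 𝕜 Y] [CompleteSpace Y]
    [T2Space Y]
variable {Z : Type*} [AddCommGroup Z] [Module 𝕜 Z] [UniformSpace Z]
    [IsUniformAddGroup Z] [ContinuousSMul 𝕜 Z] [PolynormableSpace 𝕜 Z] [CompleteSpace Z]
    [T2Space Z]
variable {W : Type*} [AddCommGroup W] [Module 𝕜 W] [UniformSpace W]
    [IsUniformAddGroup W] [ContinuousSMul 𝕜 W] [PolynormableSpace 𝕜 W] [CompleteSpace W]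
    [T2Space W]

/-- Coassociativity, in the form used for Sweedler calculations. -/
theorem coassoc_congr {X : Type*} [AddCommGroup X] [Module 𝕜 X] [TopologicalSpace X] [T2Space X]
    {f g : CTensor 𝕜 H H →L[𝕜] X}
    (f' : CTensor 𝕜 (CTensor 𝕜 H H) H →L[𝕜] X) (g' : CTensor 𝕜 H (CTensor 𝕜 H H) →L[𝕜] X)
    (hf : ∀ a b, f (ctmul 𝕜 a b) = f' (ctmul 𝕜 (A.comul a) b))
    (hg : ∀ a b, g (ctmul 𝕜 a b) = g' (ctmul 𝕜 a (A.comul b)))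
    (h : ∀ a b c, f' (ctmul 𝕜 (ctmul 𝕜 a b) c) = g' (ctmul 𝕜 a (ctmul 𝕜 b c))) (x : H) :
    f (A.comul x) = g (A.comul x) := by
  have h1 : f (A.comul x) = f' (cmap A.comul (.id 𝕜 H) (A.comul x)) :=
    CTensor.congr (g := f' ∘L cmap A.comul (.id 𝕜 H)) (fun a b => by simp [hf]) _
  have h2 : g (A.comul x) = g' (cmap (.id 𝕜 H) A.comul (A.comul x)) :=
    CTensor.congr (g := g' ∘L cmap (.id 𝕜 H) A.comul) (fun a b => by simp [hg]) _
  rw [h1, h2, ← A.coassoc]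
  exact CTensor.congr₃ (f := f' ∘L cassoc 𝕜 H H H) (fun a b c => by simp [h]) _

/-- The map `h ⊗ y ↦ h₁ ⊗ f (h₂ ⊗ y)`. -/
noncomputable def sg (f : CTensor 𝕜 H Y →L[𝕜] Z) : CTensor 𝕜 H Y →L[𝕜] CTensor 𝕜 H Z :=
  actSnd f ∘L cmap A.comul (.id 𝕜 Y)

/-- The map `h ⊗ y ↦ h₂ ⊗ f (h₁ ⊗ y)`. -/
noncomputable def rr (f : CTensor 𝕜 H Y →L[𝕜] Z) : CTensor 𝕜 H Y →L[𝕜] CTensor 𝕜 H Z :=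
  actFst f ∘L cmap A.comul (.id 𝕜 Y)

@[simp] theorem sg_ctmul (f : CTensor 𝕜 H Y →L[𝕜] Z) (h : H) (y : Y) :
    A.sg f (ctmul 𝕜 h y) = actSnd f (ctmul 𝕜 (A.comul h) y) := by simp [sg]

@[simp] theorem rr_ctmul (f : CTensor 𝕜 H Y →L[𝕜] Z) (h : H) (y : Y) :
    A.rr f (ctmul 𝕜 h y) = actFst f (ctmul 𝕜 (A.comul h) y) := by simp [rr]

/-- Both sides send `h ⊗ y` to `h₁ ⊗ f(h₂ ⊗ g(h₃ ⊗ y))`. -/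
theorem sg_sg (f : CTensor 𝕜 H Z →L[𝕜] W) (g : CTensor 𝕜 H Y →L[𝕜] Z) (t : CTensor 𝕜 H Y) :
    A.sg f (A.sg g t) = A.sg (f ∘L A.sg g) t := by
  refine CTensor.congr (f := A.sg f ∘L A.sg g) (fun h y => ?_) t
  simp only [ContinuousLinearMap.comp_apply, sg_ctmul]
  exact A.coassoc_congr (f := A.sg f ∘L actSnd g ∘L tmulRight _ y)
    (g := actSnd (f ∘L A.sg g) ∘L tmulRight _ y)
    (actSnd f ∘L cmap (.id 𝕜 _) (g ∘L tmulRight _ y))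
    (cmap (.id 𝕜 _) (f ∘L actSnd g ∘L tmulRight _ y)) (fun a b => by simp) (fun a b => by simp)
    (fun a b c => by simp) h

/-- Both sides send `h ⊗ y` to `h₃ ⊗ f(h₂ ⊗ g(h₁ ⊗ y))`. -/
theorem rr_rr (f : CTensor 𝕜 H Z →L[𝕜] W) (g : CTensor 𝕜 H Y →L[𝕜] Z) (t : CTensor 𝕜 H Y) :
    A.rr f (A.rr g t) = A.rr (f ∘L A.rr g) t := by
  refine CTensor.congr (f := A.rr f ∘L A.rr g) (fun h y => ?_) t
  simp only [ContinuousLinearMap.comp_apply, rr_ctmul]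
  exact (A.coassoc_congr (g := A.rr f ∘L actFst g ∘L tmulRight _ y)
    (f := actFst (f ∘L A.rr g) ∘L tmulRight _ y)
    (cmap (.id 𝕜 _) (f ∘L actFst g ∘L tmulRight _ y) ∘L cswap 𝕜 _ _)
    (actFst f ∘L cmap (.id 𝕜 _) (g ∘L tmulRight _ y) ∘L cswap 𝕜 _ _)
    (fun a b => by simp) (fun a b => by simp)
    (fun a b c => by simp) h).symm

/-- Operations that consume the first and the last Sweedler leg can be exchanged, provided that they
commute on the remaining factor. -/
theorem rr_sg {f : CTensor 𝕜 H Z →L[𝕜] W} {g : CTensor 𝕜 H Y →L[𝕜] Z}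
    {Z' : Type*} [AddCommGroup Z'] [Module 𝕜 Z'] [UniformSpace Z']
    [IsUniformAddGroup Z'] [ContinuousSMul 𝕜 Z'] [PolynormableSpace 𝕜 Z'] [CompleteSpace Z']
    [T2Space Z'] {f' : CTensor 𝕜 H Y →L[𝕜] Z'} {g' : CTensor 𝕜 H Z' →L[𝕜] W}
    (hfg : ∀ a b y, f (ctmul 𝕜 a (g (ctmul 𝕜 b y))) = g' (ctmul 𝕜 b (f' (ctmul 𝕜 a y))))
    (t : CTensor 𝕜 H Y) : A.rr f (A.sg g t) = A.sg g' (A.rr f' t) := by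
  refine CTensor.congr (f := A.rr f ∘L A.sg g) (g := A.sg g' ∘L A.rr f') (fun h y => ?_) t
  simp only [ContinuousLinearMap.comp_apply, rr_ctmul, sg_ctmul]
  exact A.coassoc_congr (f := A.rr f ∘L actSnd g ∘L tmulRight _ y)
    (g := A.sg g' ∘L actFst f' ∘L tmulRight _ y)
    (actFst f ∘L cmap (.id 𝕜 _) (g ∘L tmulRight _ y))
    (actSnd g' ∘L cmap (.id 𝕜 _) (f' ∘L tmulRight _ y) ∘L cswap 𝕜 _ _)
    (fun a b => by simp) (fun a b => by simp)
    (fun a b c => by simp [hfg]) h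

theorem actSnd_cmap (f : CTensor 𝕜 H Z →L[𝕜] W) (g : Y →L[𝕜] Z) (t : CTensor 𝕜 (CTensor 𝕜 H H) Y) :
    actSnd f (cmap (.id 𝕜 _) g t) = actSnd (E := H) (f ∘L cmap (.id 𝕜 _) g) t :=
  CTensor.congr (E := CTensor 𝕜 H H) (f := actSnd f ∘L cmap (.id 𝕜 _) g)
    (g := actSnd (f ∘L cmap (.id 𝕜 _) g)) (fun u y =>
    CTensor.congr (E := H) (F := H) (f := actSnd f ∘L cmap (.id 𝕜 _) g ∘L tmulRight _ y)
      (g := actSnd (f ∘L cmap (.id 𝕜 _) g) ∘L tmulRight _ y) (fun a b => by simp) u) t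

theorem actFst_cmap (f : CTensor 𝕜 H Z →L[𝕜] W) (g : Y →L[𝕜] Z) (t : CTensor 𝕜 (CTensor 𝕜 H H) Y) :
    actFst f (cmap (.id 𝕜 _) g t) = actFst (G := H) (f ∘L cmap (.id 𝕜 _) g) t :=
  CTensor.congr (E := CTensor 𝕜 H H) (f := actFst f ∘L cmap (.id 𝕜 _) g)
    (g := actFst (f ∘L cmap (.id 𝕜 _) g)) (fun u y =>
    CTensor.congr (E := H) (F := H) (f := actFst f ∘L cmap (.id 𝕜 _) g ∘L tmulRight _ y)
      (g := actFst (f ∘L cmap (.id 𝕜 _) g) ∘L tmulRight _ y) (fun a b => by simp) u) t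

theorem sg_cmap (f : CTensor 𝕜 H Z →L[𝕜] W) (g : Y →L[𝕜] Z) (t : CTensor 𝕜 H Y) :
    A.sg f (cmap (.id 𝕜 H) g t) = A.sg (f ∘L cmap (.id 𝕜 H) g) t :=
  CTensor.congr (f := A.sg f ∘L cmap (.id 𝕜 H) g) (fun h y => by
    simp [← actSnd_cmap]) t

theorem rr_cmap (f : CTensor 𝕜 H Z →L[𝕜] W) (g : Y →L[𝕜] Z) (t : CTensor 𝕜 H Y) :
    A.rr f (cmap (.id 𝕜 H) g t) = A.rr (f ∘L cmap (.id 𝕜 H) g) t :=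
  CTensor.congr (f := A.rr f ∘L cmap (.id 𝕜 H) g) (fun h y => by
    simp [← actFst_cmap]) t

theorem cmap_sg (g : Z →L[𝕜] W) (f : CTensor 𝕜 H Y →L[𝕜] Z) (t : CTensor 𝕜 H Y) :
    cmap (.id 𝕜 H) g (A.sg f t) = A.sg (g ∘L f) t := by
  simp only [sg, actSnd, ContinuousLinearMap.comp_apply, cmap_cmap]
  rfl

theorem cmap_rr (g : Z →L[𝕜] W) (f : CTensor 𝕜 H Y →L[𝕜] Z) (t : CTensor 𝕜 H Y) :
    cmap (.id 𝕜 H) g (A.rr f t) = A.rr (g ∘L f) t := by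
  simp only [rr, actFst, ContinuousLinearMap.comp_apply, cmap_cmap]
  rfl

theorem sg_congr_cmap {Y' : Type*} [AddCommGroup Y'] [Module 𝕜 Y'] [UniformSpace Y']
    [IsUniformAddGroup Y'] [ContinuousSMul 𝕜 Y'] [PolynormableSpace 𝕜 Y'] [CompleteSpace Y']
    [T2Space Y'] {f : CTensor 𝕜 H Z →L[𝕜] W} {g : Y →L[𝕜] Z} {g' : Y' →L[𝕜] W}
    {f' : CTensor 𝕜 H Y →L[𝕜] Y'}
    (h : ∀ a y, f (ctmul 𝕜 a (g y)) = g' (f' (ctmul 𝕜 a y))) (t : CTensor 𝕜 H Y) :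
    A.sg f (cmap (.id 𝕜 H) g t) = cmap (.id 𝕜 H) g' (A.sg f' t) := by
  rw [sg_cmap, cmap_sg]
  congr 2
  exact CTensor.ext fun a y => by simp [h]

theorem rr_congr_cmap {Y' : Type*} [AddCommGroup Y'] [Module 𝕜 Y'] [UniformSpace Y']
    [IsUniformAddGroup Y'] [ContinuousSMul 𝕜 Y'] [PolynormableSpace 𝕜 Y'] [CompleteSpace Y']
    [T2Space Y'] {f : CTensor 𝕜 H Z →L[𝕜] W} {g : Y →L[𝕜] Z} {g' : Y' →L[𝕜] W}
    {f' : CTensor 𝕜 H Y →L[𝕜] Y'}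
    (h : ∀ a y, f (ctmul 𝕜 a (g y)) = g' (f' (ctmul 𝕜 a y))) (t : CTensor 𝕜 H Y) :
    A.rr f (cmap (.id 𝕜 H) g t) = cmap (.id 𝕜 H) g' (A.rr f' t) := by
  rw [rr_cmap, cmap_rr]
  congr 2
  exact CTensor.ext fun a y => by simp [h]

end Sweedler
end TopHopfAlgebra

/-! ### The twist and its compatibilities -/

namespace TopHopfAlgebra
section Twist

variable {𝕜 : Type*} [RCLike 𝕜]
variable {H : Type*} [Ring H] [Algebra 𝕜 H] [UniformSpace H] [IsUniformAddGroup H]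
  [IsTopologicalRing H] [ContinuousSMul 𝕜 H] [PolynormableSpace 𝕜 H] [CompleteSpace H] [T2Space H]
  (A : TopHopfAlgebra 𝕜 H)
variable {Y : Type*} [AddCommGroup Y] [Module 𝕜 Y] [UniformSpace Y]
    [IsUniformAddGroup Y] [ContinuousSMul 𝕜 Y] [PolynormableSpace 𝕜 Y] [CompleteSpace Y]
    [T2Space Y]
variable {V : Type*} [AddCommGroup V] [Module 𝕜 V] [UniformSpace V]
    [IsUniformAddGroup V] [ContinuousSMul 𝕜 V] [PolynormableSpace 𝕜 V] [CompleteSpace V]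
    [T2Space V]

theorem sg_sliceLeft_counit (t : CTensor 𝕜 H Y) : A.sg (sliceLeft A.counit) t = t := by
  refine CTensor.congr (g := .id 𝕜 _) (fun h y => ?_) t
  have := CTensor.congr (f := actSnd (sliceLeft A.counit) ∘L tmulRight _ y)
    (g := tmulRight _ y ∘L sliceRight A.counit)
    (fun a b => by simp [ctmul_smul_right]) (A.comul h)
  simpa [A.counit_right] using this

theorem antipode_left' (h : H) :
    mulC 𝕜 H (cmap A.antipode (.id 𝕜 H) (A.comul h)) = A.counit h • 1 := by
  rw [← A.antipode_left]
  exact CTensor.congr (f := mulC 𝕜 H ∘L cmap A.antipode (.id 𝕜 H)) (fun a b => by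
    refine Eq.trans ?_ (lift₂_ctmul _ _ a b).symm
    simp) _

theorem antipode_right' (h : H) :
    mulC 𝕜 H (cmap (.id 𝕜 H) A.antipode (A.comul h)) = A.counit h • 1 := by
  rw [← A.antipode_right]
  exact CTensor.congr (f := mulC 𝕜 H ∘L cmap (.id 𝕜 H) A.antipode) (fun a b => by
    refine Eq.trans ?_ (lift₂_ctmul _ _ a b).symm
    simp) _

section Inverse

variable {ℓ : CTensor 𝕜 H Y →L[𝕜] Y} (h_one : ∀ y, ℓ (ctmul 𝕜 1 y) = y)
  (h_mul : ∀ a b y, ℓ (ctmul 𝕜 a (ℓ (ctmul 𝕜 b y))) = ℓ (ctmul 𝕜 (a * b) y))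

-- For a left action `ℓ` the composite is `h ⊗ y ↦ h₁ ⊗ S(h₂) h₃ y`, and the antipode axiom
-- collapses it. Together with the opposite composite this makes `h ⊗ y ↦ h₁ ⊗ h₂ y` invertible, so
-- identities involving `S` can be derived from identities without it.
include h_one h_mul in
theorem sg_antipode_sg (t : CTensor 𝕜 H Y) :
    A.sg (ℓ ∘L cmap A.antipode (.id 𝕜 Y)) (A.sg ℓ t) = t := by
  rw [sg_sg]
  refine Eq.trans (congrArg (fun f => A.sg f t) (CTensor.ext fun h y => ?_))
    (A.sg_sliceLeft_counit t)
  have := CTensor.congr (f := ℓ ∘L cmap A.antipode (.id 𝕜 Y) ∘L actSnd ℓ ∘L tmulRight _ y)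
    (g := ℓ ∘L tmulRight _ y ∘L
      mulC 𝕜 H ∘L cmap A.antipode (.id 𝕜 H))
    (fun a b => by simp [h_mul]) (A.comul h)
  simp only [ContinuousLinearMap.comp_apply, A.antipode_left'] at this
  simpa [ctmul_smul_left, h_one] using this

include h_one h_mul in
theorem sg_sg_antipode (t : CTensor 𝕜 H Y) :
    A.sg ℓ (A.sg (ℓ ∘L cmap A.antipode (.id 𝕜 Y)) t) = t := by
  rw [sg_sg]
  refine Eq.trans (congrArg (fun f => A.sg f t) (CTensor.ext fun h y => ?_))
    (A.sg_sliceLeft_counit t)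
  have := CTensor.congr
    (f := ℓ ∘L actSnd (ℓ ∘L cmap A.antipode (.id 𝕜 Y)) ∘L tmulRight _ y)
    (g := ℓ ∘L tmulRight _ y ∘L
      mulC 𝕜 H ∘L cmap (.id 𝕜 H) A.antipode)
    (fun a b => by simp [h_mul]) (A.comul h)
  simp only [ContinuousLinearMap.comp_apply, A.antipode_right'] at this
  simpa [ctmul_smul_left, h_one] using this

end Inverse

/-- The map `h ⊗ y ↦ S(h) y`. -/
noncomputable def antiMulC : CTensor 𝕜 H H →L[𝕜] H := mulC 𝕜 H ∘L cmap A.antipode (.id 𝕜 H)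

@[simp] theorem antiMulC_ctmul (h y : H) : A.antiMulC (ctmul 𝕜 h y) = A.antipode h * y := by
  simp [antiMulC]

theorem leg₁_antiMulC :
    leg₁ V A.antiMulC = leg₁ V (mulC 𝕜 H) ∘L cmap A.antipode (.id 𝕜 (CTensor 𝕜 H V)) :=
  ContinuousLinearMap.ext (CTensor.congr₃ fun a b c => by simp)

theorem leg₂_antiMulC :
    leg₂ V A.antiMulC = leg₂ V (mulC 𝕜 H) ∘L cmap A.antipode (.id 𝕜 (CTensor 𝕜 V H)) :=
  ContinuousLinearMap.ext (CTensor.congr₃ fun a b c => by simp)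

theorem leg₁_mulC_mulC (a b : H) (t : CTensor 𝕜 H V) :
    leg₁ V (mulC 𝕜 H) (ctmul 𝕜 a (leg₁ V (mulC 𝕜 H) (ctmul 𝕜 b t))) =
      leg₁ V (mulC 𝕜 H) (ctmul 𝕜 (a * b) t) :=
  CTensor.congr (f := leg₁ V (mulC 𝕜 H) ∘L tmulLeft _ a ∘L leg₁ V (mulC 𝕜 H) ∘L tmulLeft _ b)
    (g := leg₁ V (mulC 𝕜 H) ∘L tmulLeft _ (a * b)) (fun x y => by simp [mul_assoc]) t

theorem leg₂_mulC_mulC (a b : H) (t : CTensor 𝕜 V H) :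
    leg₂ V (mulC 𝕜 H) (ctmul 𝕜 a (leg₂ V (mulC 𝕜 H) (ctmul 𝕜 b t))) =
      leg₂ V (mulC 𝕜 H) (ctmul 𝕜 (a * b) t) :=
  CTensor.congr (f := leg₂ V (mulC 𝕜 H) ∘L tmulLeft _ a ∘L leg₂ V (mulC 𝕜 H) ∘L tmulLeft _ b)
    (g := leg₂ V (mulC 𝕜 H) ∘L tmulLeft _ (a * b)) (fun x y => by simp [mul_assoc]) t

theorem leg₁_mulC_one (t : CTensor 𝕜 H V) : leg₁ V (mulC 𝕜 H) (ctmul 𝕜 1 t) = t :=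
  CTensor.congr (f := leg₁ V (mulC 𝕜 H) ∘L tmulLeft _ 1) (g := .id 𝕜 _) (fun x y => by simp) t

theorem leg₂_mulC_one (t : CTensor 𝕜 V H) : leg₂ V (mulC 𝕜 H) (ctmul 𝕜 1 t) = t :=
  CTensor.congr (f := leg₂ V (mulC 𝕜 H) ∘L tmulLeft _ 1) (g := .id 𝕜 _) (fun x y => by simp) t

theorem sg_anti_sg (t : CTensor 𝕜 H H) : A.sg A.antiMulC (A.sg (mulC 𝕜 H) t) = t :=
  A.sg_antipode_sg (ℓ := mulC 𝕜 H) (by simp) (by simp [mul_assoc]) t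

theorem sg_sg_anti (t : CTensor 𝕜 H H) : A.sg (mulC 𝕜 H) (A.sg A.antiMulC t) = t :=
  A.sg_sg_antipode (ℓ := mulC 𝕜 H) (by simp) (by simp [mul_assoc]) t

theorem sg_anti_sg₁ (t : CTensor 𝕜 H (CTensor 𝕜 H V)) :
    A.sg (leg₁ V A.antiMulC) (A.sg (leg₁ V (mulC 𝕜 H)) t) = t := by
  rw [leg₁_antiMulC]
  exact A.sg_antipode_sg leg₁_mulC_one leg₁_mulC_mulC t

theorem sg_anti_sg₂ (t : CTensor 𝕜 H (CTensor 𝕜 V H)) :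
    A.sg (leg₂ V A.antiMulC) (A.sg (leg₂ V (mulC 𝕜 H)) t) = t := by
  rw [leg₂_antiMulC]
  exact A.sg_antipode_sg leg₂_mulC_one leg₂_mulC_mulC t

theorem sg_sg_anti₂ (t : CTensor 𝕜 H (CTensor 𝕜 V H)) :
    A.sg (leg₂ V (mulC 𝕜 H)) (A.sg (leg₂ V A.antiMulC) t) = t := by
  rw [leg₂_antiMulC]
  exact A.sg_sg_antipode leg₂_mulC_one leg₂_mulC_mulC t

/-- The map `h ⊗ y ↦ h₂ ⊗ S(h₃) y h₁`. -/
noncomputable def twist : CTensor 𝕜 H H →L[𝕜] CTensor 𝕜 H H :=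
  A.sg A.antiMulC ∘L A.rr (mulOpC 𝕜 H)

variable (V) in
/-- The map `h ⊗ (y ⊗ v) ↦ h₂ ⊗ (S(h₃) y h₁ ⊗ v)`. -/
noncomputable def twist₁ : CTensor 𝕜 H (CTensor 𝕜 H V) →L[𝕜] CTensor 𝕜 H (CTensor 𝕜 H V) :=
  A.sg (leg₁ V A.antiMulC) ∘L A.rr (leg₁ V (mulOpC 𝕜 H))

variable (V) in
/-- The map `h ⊗ (v ⊗ y) ↦ h₂ ⊗ (v ⊗ S(h₃) y h₁)`. -/
noncomputable def twist₂ : CTensor 𝕜 H (CTensor 𝕜 V H) →L[𝕜] CTensor 𝕜 H (CTensor 𝕜 V H) :=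
  A.sg (leg₂ V A.antiMulC) ∘L A.rr (leg₂ V (mulOpC 𝕜 H))

/-- Links the two-step definition of the twist with formulas written through the iterated
comultiplication `h₁ ⊗ (h₂ ⊗ h₃)`. -/
theorem twist_ctmul {X : Type*} [AddCommGroup X] [Module 𝕜 X] [TopologicalSpace X] [T2Space X]
    {F : CTensor 𝕜 H H →L[𝕜] X} {G : CTensor 𝕜 H (CTensor 𝕜 H H) →L[𝕜] X} {y : H}
    (hFG : ∀ a b c, G (ctmul 𝕜 a (ctmul 𝕜 b c)) = F (ctmul 𝕜 b (A.antipode c * y * a))) (h : H) :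
    F (A.twist (ctmul 𝕜 h y)) = G (A.comul₃ h) := by
  simp only [twist, ContinuousLinearMap.comp_apply, rr_ctmul, comul₃]
  exact CTensor.congr (f := F ∘L A.sg A.antiMulC ∘L actFst (mulOpC 𝕜 H) ∘L tmulRight _ y)
    (g := G ∘L cmap (.id 𝕜 H) A.comul) (fun p q => by
      simp only [ContinuousLinearMap.comp_apply, tmulRight_apply, actFst_ctmul, sg_ctmul,
        cmap_ctmul, mulOpC_ctmul, ContinuousLinearMap.id_apply]
      exact CTensor.congr (f := F ∘L actSnd A.antiMulC ∘L tmulRight _ (y * p))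
        (g := G ∘L tmulLeft _ p) (fun b c => by simp [hFG, mul_assoc]) (A.comul q)) (A.comul h)

theorem twist₁_ctmul {X : Type*} [AddCommGroup X] [Module 𝕜 X] [TopologicalSpace X] [T2Space X]
    {F : CTensor 𝕜 H (CTensor 𝕜 H V) →L[𝕜] X} {G : CTensor 𝕜 H (CTensor 𝕜 H H) →L[𝕜] X}
    {t : CTensor 𝕜 H V}
    (hFG : ∀ a b c, G (ctmul 𝕜 a (ctmul 𝕜 b c)) =
      F (ctmul 𝕜 b (cmap (A.conj a c) (.id 𝕜 V) t))) (h : H) :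
    F (A.twist₁ V (ctmul 𝕜 h t)) = G (A.comul₃ h) := by
  simp only [twist₁, ContinuousLinearMap.comp_apply, rr_ctmul, comul₃]
  refine CTensor.congr
    (f := F ∘L A.sg (leg₁ V A.antiMulC) ∘L actFst (leg₁ V (mulOpC 𝕜 H)) ∘L tmulRight _ t)
    (g := G ∘L cmap (.id 𝕜 H) A.comul) (fun p q => ?_) (A.comul h)
  simp only [ContinuousLinearMap.comp_apply, tmulRight_apply, actFst_ctmul, sg_ctmul,
        cmap_ctmul, ContinuousLinearMap.id_apply]
  refine CTensor.congr (f := F ∘L actSnd (leg₁ V A.antiMulC) ∘L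
      tmulRight _ (leg₁ V (mulOpC 𝕜 H) (ctmul 𝕜 p t)))
    (g := G ∘L tmulLeft _ p) (fun b c => ?_) (A.comul q)
  simp only [ContinuousLinearMap.comp_apply, tmulRight_apply, tmulLeft_apply, actSnd_ctmul, hFG]
  congr 2
  exact CTensor.congr (f := leg₁ V A.antiMulC ∘L tmulLeft _ c ∘L leg₁ V (mulOpC 𝕜 H) ∘L tmulLeft _ p)
    (g := cmap (A.conj p c) (.id 𝕜 V)) (fun x v => by simp [mul_assoc]) t

/-- Multiplicativity of `Δ`: both sides send `h ⊗ (k ⊗ y)` to `h₁ k₁ ⊗ h₂ k₂ y`. -/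
theorem sg_mul (t : CTensor 𝕜 H (CTensor 𝕜 H H)) :
    A.sg (mulC 𝕜 H) (leg₁ H (mulC 𝕜 H) t) =
      leg₁ H (mulC 𝕜 H) (A.sg (leg₂ H (mulC 𝕜 H)) (cmap (.id 𝕜 H) (A.sg (mulC 𝕜 H)) t)) := by
  refine CTensor.congr₃ (f := A.sg (mulC 𝕜 H) ∘L leg₁ H (mulC 𝕜 H))
    (g := leg₁ H (mulC 𝕜 H) ∘L A.sg (leg₂ H (mulC 𝕜 H)) ∘L cmap (.id 𝕜 H) (A.sg (mulC 𝕜 H)))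
    (fun h k y => ?_) t
  simp only [ContinuousLinearMap.comp_apply, leg₁_ctmul, sg_ctmul, mulC_ctmul, A.comul_mul,
    tensorMul_eq, cmap_ctmul, ContinuousLinearMap.id_apply]
  refine CTensor.congr (f := actSnd (mulC 𝕜 H) ∘L tmulRight _ y ∘L tensorMulC 𝕜 H ∘L
      tmulRight _ (A.comul k)) (g := leg₁ H (mulC 𝕜 H) ∘L actSnd (leg₂ H (mulC 𝕜 H)) ∘L
      tmulRight _ (actSnd (mulC 𝕜 H) (ctmul 𝕜 (A.comul k) y))) (fun a b => ?_) (A.comul h)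
  exact CTensor.congr (f := actSnd (mulC 𝕜 H) ∘L tmulRight _ y ∘L tensorMulC 𝕜 H ∘L
      tmulLeft _ (ctmul 𝕜 a b)) (g := leg₁ H (mulC 𝕜 H) ∘L actSnd (leg₂ H (mulC 𝕜 H)) ∘L
      tmulLeft _ (ctmul 𝕜 a b) ∘L actSnd (mulC 𝕜 H) ∘L tmulRight _ y)
      (fun c d => by simp [mul_assoc]) (A.comul k)

/-- Both sides send `h ⊗ (k ⊗ y)` to `h₂ k₂ ⊗ y h₁ k₁`. -/
theorem rr_mul (t : CTensor 𝕜 H (CTensor 𝕜 H H)) :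
    A.rr (mulOpC 𝕜 H) (leg₁ H (mulC 𝕜 H) t) =
      leg₁ H (mulC 𝕜 H) (cmap (.id 𝕜 H) (A.rr (mulOpC 𝕜 H)) (A.rr (leg₂ H (mulOpC 𝕜 H)) t)) := by
  refine CTensor.congr₃ (f := A.rr (mulOpC 𝕜 H) ∘L leg₁ H (mulC 𝕜 H))
    (g := leg₁ H (mulC 𝕜 H) ∘L cmap (.id 𝕜 H) (A.rr (mulOpC 𝕜 H)) ∘L A.rr (leg₂ H (mulOpC 𝕜 H)))
    (fun h k y => ?_) t
  simp only [ContinuousLinearMap.comp_apply, leg₁_ctmul, rr_ctmul, mulC_ctmul, A.comul_mul,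
    tensorMul_eq]
  refine CTensor.congr (f := actFst (mulOpC 𝕜 H) ∘L tmulRight _ y ∘L tensorMulC 𝕜 H ∘L
      tmulRight _ (A.comul k)) (g := leg₁ H (mulC 𝕜 H) ∘L cmap (.id 𝕜 H) (A.rr (mulOpC 𝕜 H)) ∘L
      actFst (leg₂ H (mulOpC 𝕜 H)) ∘L tmulRight _ (ctmul 𝕜 k y)) (fun a b => ?_) (A.comul h)
  simp only [ContinuousLinearMap.comp_apply, tmulRight_apply, actFst_ctmul, leg₂_ctmul, cmap_ctmul,
    rr_ctmul, mulOpC_ctmul, ContinuousLinearMap.id_apply]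
  exact CTensor.congr (f := actFst (mulOpC 𝕜 H) ∘L tmulRight _ y ∘L tensorMulC 𝕜 H ∘L
      tmulLeft _ (ctmul 𝕜 a b)) (g := leg₁ H (mulC 𝕜 H) ∘L tmulLeft _ b ∘L
      actFst (mulOpC 𝕜 H) ∘L tmulRight _ (y * a)) (fun c d => by simp [mul_assoc]) (A.comul k)

theorem cmap_id_comp {E F G K : Type*} [AddCommGroup E] [Module 𝕜 E] [TopologicalSpace E]
    [ContinuousSMul 𝕜 E] [IsTopologicalAddGroup E] [AddCommGroup F] [Module 𝕜 F]
    [TopologicalSpace F] [ContinuousSMul 𝕜 F] [IsTopologicalAddGroup F]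
    [AddCommGroup G] [Module 𝕜 G] [TopologicalSpace G]
    [ContinuousSMul 𝕜 G] [IsTopologicalAddGroup G]
    [AddCommGroup K] [Module 𝕜 K] [TopologicalSpace K]
    [ContinuousSMul 𝕜 K] [IsTopologicalAddGroup K] (f : F →L[𝕜] G) (g : K →L[𝕜] F)
    (t : CTensor 𝕜 E K) :
    cmap (.id 𝕜 E) (f ∘L g) t = cmap (.id 𝕜 E) f (cmap (.id 𝕜 E) g t) := by
  rw [cmap_cmap]; rfl

/-- This is `sg_mul` with every map inverted; it replaces the anti-multiplicativity of `S`. -/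
theorem sg_anti_mul (t : CTensor 𝕜 H (CTensor 𝕜 H H)) :
    A.sg A.antiMulC (leg₁ H (mulC 𝕜 H) t) =
      leg₁ H (mulC 𝕜 H) (cmap (.id 𝕜 H) (A.sg A.antiMulC) (A.sg (leg₂ H A.antiMulC) t)) := by
  obtain ⟨s, rfl⟩ : ∃ s, t = A.sg (leg₂ H (mulC 𝕜 H)) (cmap (.id 𝕜 H) (A.sg (mulC 𝕜 H)) s) := by
    refine ⟨cmap (.id 𝕜 H) (A.sg A.antiMulC) (A.sg (leg₂ H A.antiMulC) t), ?_⟩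
    rw [← cmap_id_comp, show A.sg (mulC 𝕜 H) ∘L A.sg A.antiMulC = .id 𝕜 _ from
      ContinuousLinearMap.ext A.sg_sg_anti, cmap_id_id, sg_sg_anti₂]
  rw [← sg_mul, sg_anti_sg, sg_anti_sg₂, ← cmap_id_comp, show A.sg A.antiMulC ∘L A.sg (mulC 𝕜 H) =
    .id 𝕜 _ from ContinuousLinearMap.ext A.sg_anti_sg, cmap_id_id]

/-- Twisting by `h k` is twisting by `h` and then by `k`: combine `rr_mul` with `sg_anti_mul` and
use that left and right multiplications commute. -/
theorem twist_mul (t : CTensor 𝕜 H (CTensor 𝕜 H H)) :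
    A.twist (leg₁ H (mulC 𝕜 H) t) =
      leg₁ H (mulC 𝕜 H) (cmap (.id 𝕜 H) A.twist (A.twist₂ H t)) := by
  rw [twist, twist₂, ContinuousLinearMap.comp_apply, rr_mul, sg_anti_mul, cmap_id_comp,
    ContinuousLinearMap.comp_apply]
  congr 2
  refine A.sg_congr_cmap (fun a y => ?_) _
  refine CTensor.congr (f := leg₂ H A.antiMulC ∘L tmulLeft _ a ∘L A.rr (mulOpC 𝕜 H))
    (g := A.rr (mulOpC 𝕜 H) ∘L leg₂ H A.antiMulC ∘L tmulLeft _ a) (fun k y => ?_) y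
  simp only [ContinuousLinearMap.comp_apply, tmulLeft_apply, leg₂_ctmul, rr_ctmul]
  exact CTensor.congr (f := leg₂ H A.antiMulC ∘L tmulLeft _ a ∘L actFst (mulOpC 𝕜 H) ∘L
    tmulRight _ y) (g := actFst (mulOpC 𝕜 H) ∘L tmulRight _ (A.antiMulC (ctmul 𝕜 a y)))
    (fun c d => by simp [mul_assoc]) (A.comul k)

theorem rr_comul (t : CTensor 𝕜 H H) :
    cmap (.id 𝕜 H) A.comul (A.rr (mulOpC 𝕜 H) t) =
      A.rr (leg₂ H (mulOpC 𝕜 H)) (A.rr (leg₁ H (mulOpC 𝕜 H)) (cmap (.id 𝕜 H) A.comul t)) := by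
  rw [rr_rr, cmap_rr, rr_cmap]
  congr 2
  refine CTensor.ext fun h y => ?_
  simp only [ContinuousLinearMap.comp_apply, mulOpC_ctmul, A.comul_mul, tensorMul_eq, cmap_ctmul,
    rr_ctmul, ContinuousLinearMap.id_apply]
  refine CTensor.congr (f := tensorMulC 𝕜 H ∘L tmulRight _ (A.comul h))
    (g := leg₂ H (mulOpC 𝕜 H) ∘L actFst (leg₁ H (mulOpC 𝕜 H)) ∘L tmulLeft _ (A.comul h))
    (fun a b => ?_) (A.comul y)
  exact CTensor.congr (f := tensorMulC 𝕜 H ∘L tmulLeft _ (ctmul 𝕜 a b))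
    (g := leg₂ H (mulOpC 𝕜 H) ∘L actFst (leg₁ H (mulOpC 𝕜 H)) ∘L tmulRight _ (ctmul 𝕜 a b))
    (fun c d => by simp) (A.comul h)

theorem sg_comul (t : CTensor 𝕜 H H) :
    cmap (.id 𝕜 H) A.comul (A.sg (mulC 𝕜 H) t) =
      A.sg (leg₁ H (mulC 𝕜 H)) (A.sg (leg₂ H (mulC 𝕜 H)) (cmap (.id 𝕜 H) A.comul t)) := by
  rw [sg_sg, cmap_sg, sg_cmap]
  congr 2
  refine CTensor.ext fun h y => ?_
  simp only [ContinuousLinearMap.comp_apply, mulC_ctmul, A.comul_mul, tensorMul_eq, cmap_ctmul,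
    sg_ctmul, ContinuousLinearMap.id_apply]
  refine CTensor.congr (f := tensorMulC 𝕜 H ∘L tmulLeft _ (A.comul h))
    (g := leg₁ H (mulC 𝕜 H) ∘L actSnd (leg₂ H (mulC 𝕜 H)) ∘L tmulLeft _ (A.comul h))
    (fun a b => ?_) (A.comul y)
  exact CTensor.congr (f := tensorMulC 𝕜 H ∘L tmulRight _ (ctmul 𝕜 a b))
    (g := leg₁ H (mulC 𝕜 H) ∘L actSnd (leg₂ H (mulC 𝕜 H)) ∘L tmulRight _ (ctmul 𝕜 a b))
    (fun c d => by simp) (A.comul h)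

/-- Obtained by inverting `sg_comul`; it replaces the compatibility of `S` with `Δ`. -/
theorem sg_anti_comul (t : CTensor 𝕜 H H) :
    cmap (.id 𝕜 H) A.comul (A.sg A.antiMulC t) =
      A.sg (leg₂ H A.antiMulC) (A.sg (leg₁ H A.antiMulC) (cmap (.id 𝕜 H) A.comul t)) := by
  obtain ⟨s, rfl⟩ : ∃ s, t = A.sg (mulC 𝕜 H) s := ⟨_, (A.sg_sg_anti t).symm⟩
  rw [sg_comul, sg_anti_sg, sg_anti_sg₁, sg_anti_sg₂]

/-- Both sides are `h₃ ⊗ (S(h₅) y₁ h₁ ⊗ S(h₄) y₂ h₂)`: the outer legs twist the first factor of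
`Δ(y)`, the inner ones the second. -/
theorem twist_comul (t : CTensor 𝕜 H H) :
    cmap (.id 𝕜 H) A.comul (A.twist t) = A.twist₂ H (A.twist₁ H (cmap (.id 𝕜 H) A.comul t)) := by
  simp only [twist, twist₁, twist₂, ContinuousLinearMap.comp_apply, sg_anti_comul, rr_comul]
  congr 1
  refine (A.rr_sg (fun a b y => ?_) _).symm
  exact CTensor.congr
    (f := leg₂ H (mulOpC 𝕜 H) ∘L tmulLeft _ a ∘L leg₁ H A.antiMulC ∘L tmulLeft _ b)
    (g := leg₁ H A.antiMulC ∘L tmulLeft _ b ∘L leg₂ H (mulOpC 𝕜 H) ∘L tmulLeft _ a)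
    (fun c d => by simp) y

theorem antipode_one : A.antipode 1 = 1 := by
  simpa [A.comul_one, A.counit_one] using A.antipode_left' 1

theorem twist_one (y : H) : A.twist (ctmul 𝕜 1 y) = ctmul 𝕜 1 y := by
  simp [twist, A.comul_one, antipode_one]

theorem counit_twist (t : CTensor 𝕜 H H) :
    sliceRight A.counit (A.twist t) = sliceRight A.counit t := by
  have h1 : ∀ t, sliceRight A.counit (A.sg (mulC 𝕜 H) t) = sliceRight A.counit t := fun t => by
    refine CTensor.congr (f := sliceRight A.counit ∘L A.sg (mulC 𝕜 H)) (fun h y => ?_) t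
    have := CTensor.congr (f := sliceRight A.counit ∘L actSnd (mulC 𝕜 H) ∘L tmulRight _ y)
      (g := A.counit y • sliceRight A.counit) (fun a b => by simp [A.counit_mul, mul_comm, smul_smul]) (A.comul h)
    simpa [A.counit_right] using this
  have h2 : ∀ t, sliceRight A.counit (A.rr (mulOpC 𝕜 H) t) = sliceRight A.counit t := fun t => by
    refine CTensor.congr (f := sliceRight A.counit ∘L A.rr (mulOpC 𝕜 H)) (fun h y => ?_) t
    have := CTensor.congr (f := sliceRight A.counit ∘L actFst (mulOpC 𝕜 H) ∘L tmulRight _ y)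
      (g := A.counit y • sliceLeft A.counit) (fun a b => by simp [A.counit_mul, smul_smul]) (A.comul h)
    simpa [A.counit_left] using this
  -- The counit is invariant under `h ⊗ y ↦ h₁ ⊗ h₂ y`, hence under its inverse, so `ε ∘ S = ε` is
  -- not needed.
  rw [twist, ContinuousLinearMap.comp_apply, ← h1, sg_sg_anti, h2]

theorem twist₁_cmap_tmulRight (v : V) (t : CTensor 𝕜 H H) :
    A.twist₁ V (cmap (.id 𝕜 H) (tmulRight H v) t) =
      cmap (.id 𝕜 H) (tmulRight H v) (A.twist t) := by
  rw [twist₁, twist, ContinuousLinearMap.comp_apply, ContinuousLinearMap.comp_apply,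
    A.rr_congr_cmap (g' := tmulRight H v) (f' := mulOpC 𝕜 H) fun a y => by simp]
  exact A.sg_congr_cmap (fun a y => by simp) _

theorem twist₂_cmap (T : V →L[𝕜] Y) (t : CTensor 𝕜 H (CTensor 𝕜 V H)) :
    A.twist₂ Y (cmap (.id 𝕜 H) (cmap T (.id 𝕜 H)) t) =
      cmap (.id 𝕜 H) (cmap T (.id 𝕜 H)) (A.twist₂ V t) := by
  have key : ∀ (f : CTensor 𝕜 H H →L[𝕜] H) a y, leg₂ Y f (ctmul 𝕜 a (cmap T (.id 𝕜 H) y)) =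
      cmap T (.id 𝕜 H) (leg₂ V f (ctmul 𝕜 a y)) := fun f a y =>
    CTensor.congr (f := leg₂ Y f ∘L tmulLeft _ a ∘L cmap T (.id 𝕜 H))
      (g := cmap T (.id 𝕜 H) ∘L leg₂ V f ∘L tmulLeft _ a) (fun c d => by simp) y
  rw [twist₂, twist₂, ContinuousLinearMap.comp_apply, ContinuousLinearMap.comp_apply,
    A.rr_congr_cmap (key _), A.sg_congr_cmap (key _)]

end Twist
end TopHopfAlgebra

/-! ### The product of the double on operators -/

namespace TopHopfAlgebra
section Star

universe u v
variable {𝕜 : Type u} [RCLike 𝕜]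
variable {H : Type v} [Ring H] [Algebra 𝕜 H] [UniformSpace H] [IsUniformAddGroup H]
  [IsTopologicalRing H] [ContinuousSMul 𝕜 H] [PolynormableSpace 𝕜 H] [CompleteSpace H] [T2Space H]
  (A : TopHopfAlgebra 𝕜 H)
variable {V : Type*} [AddCommGroup V] [Module 𝕜 V] [UniformSpace V]
    [IsUniformAddGroup V] [ContinuousSMul 𝕜 V] [PolynormableSpace 𝕜 V] [CompleteSpace V]
    [T2Space V]

/-- The product of the anti-Drinfeld double, on operators. -/
noncomputable def star (T T' : H →L[𝕜] H) : H →L[𝕜] H :=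
  mulC 𝕜 H ∘L cmap (.id 𝕜 H) T' ∘L A.twist ∘L cmap T (.id 𝕜 H) ∘L A.comul

theorem star_apply (T T' : H →L[𝕜] H) (x : H) : A.star T T' x =
    mulC 𝕜 H (cmap (.id 𝕜 H) T' (A.twist (cmap T (.id 𝕜 H) (A.comul x)))) := rfl

/-- Coassociativity replaces `Δ(v₋₁)` in the product by a second coaction. With `N = Δ` this gives
associativity of `star`; with a comodule it gives associativity of the action. -/
theorem cmap_star_coact {N : V →L[𝕜] CTensor 𝕜 H V} {v : V}
    (hN : cassoc 𝕜 H H V (cmap (.id 𝕜 H) N (N v)) = cmap A.comul (.id 𝕜 V) (N v))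
    (T T' : H →L[𝕜] H) :
    cmap (A.star T T') (.id 𝕜 V) (N v) =
      leg₁ V (mulC 𝕜 H) (cmap (.id 𝕜 H) (cmap T' (.id 𝕜 V))
        (A.twist₁ V (cmap T N (N v)))) := by
  have h1 : cmap (A.star T T') (.id 𝕜 V) (N v) = cmap (mulC 𝕜 H ∘L cmap (.id 𝕜 H) T' ∘L A.twist ∘L
      cmap T (.id 𝕜 H)) (.id 𝕜 V) (cmap A.comul (.id 𝕜 V) (N v)) := by
    simp only [star, cmap_cmap, ContinuousLinearMap.comp_assoc, ContinuousLinearMap.comp_id]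
  have h2 : cmap T N (N v) = cmap T (.id 𝕜 _) (cmap (.id 𝕜 H) N (N v)) := by
    rw [cmap_cmap, ContinuousLinearMap.comp_id, ContinuousLinearMap.id_comp]
  rw [h1, h2, ← hN]
  refine CTensor.congr₃ (f := cmap (mulC 𝕜 H ∘L cmap (.id 𝕜 H) T' ∘L A.twist ∘L
      cmap T (.id 𝕜 H)) (.id 𝕜 V) ∘L cassoc 𝕜 H H V)
    (g := leg₁ V (mulC 𝕜 H) ∘L cmap (.id 𝕜 H) (cmap T' (.id 𝕜 V)) ∘L A.twist₁ V ∘L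
      cmap T (.id 𝕜 _)) (fun x y w => ?_) _
  have h3 : ctmul 𝕜 (T x) (ctmul 𝕜 y w) = cmap (.id 𝕜 H) (tmulRight H w) (ctmul 𝕜 (T x) y) := by
    simp
  simp only [ContinuousLinearMap.comp_apply, cassoc_ctmul, cmap_ctmul, ContinuousLinearMap.id_apply]
  rw [h3, twist₁_cmap_tmulRight]
  exact CTensor.congr (f := tmulRight H w ∘L mulC 𝕜 H ∘L cmap (.id 𝕜 H) T')
    (g := leg₁ V (mulC 𝕜 H) ∘L cmap (.id 𝕜 H) (cmap T' (.id 𝕜 V)) ∘L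
      cmap (.id 𝕜 H) (tmulRight H w)) (fun a b => by simp) _

/-- After `twist_mul` on the left and `twist_comul` on the right, both sides are evaluated on the
same triple tensor and differ by associativity of `H`. -/
theorem star_assoc (T T' T'' : H →L[𝕜] H) :
    A.star (A.star T T') T'' = A.star T (A.star T' T'') := by
  ext x
  rw [star_apply, A.cmap_star_coact (A.coassoc x), twist_mul, twist₂_cmap, star_apply]
  have h1 : cmap (.id 𝕜 H) (A.star T' T'') (A.twist (cmap T (.id 𝕜 H) (A.comul x))) =
      cmap (.id 𝕜 H) (mulC 𝕜 H ∘L cmap (.id 𝕜 H) T'') (cmap (.id 𝕜 H) A.twist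
        (cmap (.id 𝕜 H) (cmap T' (.id 𝕜 H)) (cmap (.id 𝕜 H) A.comul
        (A.twist (cmap T (.id 𝕜 H) (A.comul x)))))) := by
    simp only [star, cmap_id_comp]
  rw [h1, twist_comul, cmap_cmap (.id 𝕜 H) A.comul, ContinuousLinearMap.id_comp,
    ContinuousLinearMap.comp_id]
  generalize cmap (.id 𝕜 H) A.twist _ = t
  exact CTensor.congr₃ (f := mulC 𝕜 H ∘L cmap (.id 𝕜 H) T'' ∘L leg₁ H (mulC 𝕜 H))
    (g := mulC 𝕜 H ∘L cmap (.id 𝕜 H) (mulC 𝕜 H ∘L cmap (.id 𝕜 H) T''))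
    (fun a b c => by simp [mul_assoc]) t

theorem cmap_smulRight_id (φ : StrongDual 𝕜 H) (h : H) (t : CTensor 𝕜 H V) :
    cmap (φ.smulRight h) (.id 𝕜 V) t = ctmul 𝕜 h (sliceLeft φ t) :=
  CTensor.congr (f := cmap (φ.smulRight h) (.id 𝕜 V)) (g := tmulLeft V h ∘L sliceLeft φ)
    (fun a b => by simp [ctmul_smul_left]) t

theorem star_counit_left (T : H →L[𝕜] H) : A.star (A.counit.smulRight (1 : H)) T = T := by
  ext x
  rw [star_apply, cmap_smulRight_id, A.counit_left, twist_one]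
  simp

theorem star_counit_right (T : H →L[𝕜] H) : A.star T (A.counit.smulRight (1 : H)) = T := by
  ext x
  have h := fun t => CTensor.congr (f := mulC 𝕜 H ∘L cmap (.id 𝕜 H) (A.counit.smulRight (1 : H)))
    (g := sliceRight A.counit) (fun a b => by simp) t
  simp only [ContinuousLinearMap.comp_apply] at h
  rw [star_apply, h, counit_twist, sliceRight_cmap_id, A.counit_right]

/-- For rank-one operators `star` is the prescribed formula on elementary tensors, because the twist
unfolds to `h₂ ⊗ S(h₃) x₂ h₁`. -/
theorem toEnd_doubleProd (φ : StrongDual 𝕜 H) (h : H) (φ' : StrongDual 𝕜 H) (h' x : H) :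
    toEnd (A.doubleProd φ h φ' h') x = A.star (φ.smulRight h) (φ'.smulRight h') x := by
  rw [star_apply, cmap_smulRight_id]
  exact (A.twist_ctmul (F := mulC 𝕜 H ∘L cmap (.id 𝕜 H) (φ'.smulRight h'))
    (G := toEndEval x ∘L lift₃ (A.doubleTri φ φ' h') (A.doubleTri_bdd φ φ' h')) (fun a b c => by
      rw [ContinuousLinearMap.comp_apply, lift₃_ctmul]
      exact (toEnd_ctmul _ _ _).trans (by simp [conv_apply])) h).symm

/-- The product on operators as a bilinear map. -/
noncomputable def starₗ : (H →L[𝕜] H) →ₗ[𝕜] (H →L[𝕜] H) →ₗ[𝕜] (H →L[𝕜] H) :=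
  LinearMap.mk₂ 𝕜 A.star
    (fun T T' S => ContinuousLinearMap.ext fun x => by simp [star_apply, cmap_add_left])
    (fun c T S => ContinuousLinearMap.ext fun x => by simp [star_apply, cmap_smul_left])
    (fun T S S' => ContinuousLinearMap.ext fun x => by simp [star_apply, cmap_add_right])
    (fun c T S => ContinuousLinearMap.ext fun x => by simp [star_apply, cmap_smul_right])

/-- `star` is linear in `T ⊗̂ id` up to composition with fixed operators, and `T ↦ T ⊗̂ id` is
continuous by nuclearity. For the other variable the factors are flipped. -/
theorem continuous_star_left (hH : IsNuclearSpace 𝕜 H) (T' : H →L[𝕜] H) :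
    Continuous fun T => A.star T T' := by
  refine ((ContinuousLinearMap.postcomp H (mulC 𝕜 H ∘L cmap (.id 𝕜 H) T' ∘L A.twist)).continuous.comp
    ((ContinuousLinearMap.precomp (CTensor 𝕜 H H) A.comul).continuous.comp
    hH.continuous_cmap_id)).congr fun T => ?_
  ext x
  rfl

theorem cmap_id_left (T : H →L[𝕜] H) :
    cmap (.id 𝕜 H) T = cswap 𝕜 H H ∘L cmap T (.id 𝕜 H) ∘L cswap 𝕜 H H :=
  CTensor.ext fun a b => by simp

theorem continuous_star_right (hH : IsNuclearSpace 𝕜 H) (T : H →L[𝕜] H) :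
    Continuous fun T' => A.star T T' := by
  refine ((ContinuousLinearMap.postcomp H (mulC 𝕜 H ∘L cswap 𝕜 H H)).continuous.comp
    ((ContinuousLinearMap.precomp (CTensor 𝕜 H H) (cswap 𝕜 H H ∘L A.twist ∘L
      cmap T (.id 𝕜 H) ∘L A.comul)).continuous.comp hH.continuous_cmap_id)).congr fun T' => ?_
  ext x
  rw [star_apply, cmap_id_left T']
  rfl

variable [BarrelledSpace 𝕜 H] [CompleteSpace (StrongDual 𝕜 H)]

/-- Left multiplication by an operator. -/
noncomputable def starLeft (hH : IsNuclearSpace 𝕜 H) (T : H →L[𝕜] H) :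
    (H →L[𝕜] H) →L[𝕜] (H →L[𝕜] H) :=
  ⟨A.starₗ T, A.continuous_star_right hH T⟩

theorem starLeft_apply (hH : IsNuclearSpace 𝕜 H) (T T' : H →L[𝕜] H) :
    A.starLeft hH T T' = A.star T T' := rfl

theorem star_add_left (T S T' : H →L[𝕜] H) : A.star (T + S) T' = A.star T T' + A.star S T' :=
  A.starₗ.map_add₂ T S T'

theorem star_smul_left (c : 𝕜) (T T' : H →L[𝕜] H) : A.star (c • T) T' = c • A.star T T' :=
  A.starₗ.map_smul₂ c T T'

/-- The multiplication of the anti-Drinfeld double. -/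
noncomputable def doubleMul (hH : IsNuclearSpace 𝕜 H) :
    AYDDouble 𝕜 H →ₗ[𝕜] AYDDouble 𝕜 H →L[𝕜] AYDDouble 𝕜 H where
  toFun a := (doubleEquivEnd hH).symm.toContinuousLinearMap ∘L
    A.starLeft hH (doubleEquivEnd hH a) ∘L
      (doubleEquivEnd hH).toContinuousLinearMap
  map_add' a a' := by ext b; simp [starLeft_apply, star_add_left]
  map_smul' c a := by ext b; simp [starLeft_apply, star_smul_left]

theorem toEnd_doubleMul (hH : IsNuclearSpace 𝕜 H) (a b : AYDDouble 𝕜 H) :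
    doubleEquivEnd hH (A.doubleMul hH a b) =
      A.star (doubleEquivEnd hH a) (doubleEquivEnd hH b) :=
  (doubleEquivEnd hH).apply_symm_apply _

theorem doubleEquivEnd_ctmul (hH : IsNuclearSpace 𝕜 H) (φ : StrongDual 𝕜 H) (h : H) :
    doubleEquivEnd hH (ctmul 𝕜 φ h) = φ.smulRight h :=
  ContinuousLinearMap.ext fun x => toEnd_ctmul φ h x

theorem isDoubleMul_doubleMul (hH : IsNuclearSpace 𝕜 H) : A.IsDoubleMul (A.doubleMul hH) where
  continuous_left b := (doubleEquivEnd hH).symm.continuous.comp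
    ((A.continuous_star_left hH (doubleEquivEnd hH b)).comp (doubleEquivEnd hH).continuous)
  mul_ctmul φ h φ' h' := toEnd_ext hH fun x => by
    rw [toEnd_doubleProd, ← doubleEquivEnd_apply hH, toEnd_doubleMul, doubleEquivEnd_ctmul,
      doubleEquivEnd_ctmul]

variable {A}

theorem IsDoubleMul.unique {μ ν : AYDDouble 𝕜 H →ₗ[𝕜] AYDDouble 𝕜 H →L[𝕜] AYDDouble 𝕜 H}
    (hμ : A.IsDoubleMul μ) (hν : A.IsDoubleMul ν) : μ = ν := by
  ext a b
  refine CTensor.congr (f := ⟨(ContinuousLinearMap.coeLM 𝕜 ∘ₗ μ).flip b, hμ.continuous_left b⟩)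
    (g := ⟨(ContinuousLinearMap.coeLM 𝕜 ∘ₗ ν).flip b, hν.continuous_left b⟩) (fun φ h => ?_) a
  exact CTensor.congr (f := μ (ctmul 𝕜 φ h)) (g := ν (ctmul 𝕜 φ h)) (fun φ' h' => by
    rw [hμ.mul_ctmul, hν.mul_ctmul]) b

theorem IsDoubleMul.doubleEquivEnd_mul (hH : IsNuclearSpace 𝕜 H)
    {μ : AYDDouble 𝕜 H →ₗ[𝕜] AYDDouble 𝕜 H →L[𝕜] AYDDouble 𝕜 H} (hμ : A.IsDoubleMul μ)
    (a b : AYDDouble 𝕜 H) : doubleEquivEnd hH (μ a b) =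
      A.star (doubleEquivEnd hH a) (doubleEquivEnd hH b) := by
  rw [hμ.unique (A.isDoubleMul_doubleMul hH), toEnd_doubleMul]

theorem IsDoubleMul.assoc (hH : IsNuclearSpace 𝕜 H)
    {μ : AYDDouble 𝕜 H →ₗ[𝕜] AYDDouble 𝕜 H →L[𝕜] AYDDouble 𝕜 H} (hμ : A.IsDoubleMul μ)
    (a b c : AYDDouble 𝕜 H) : μ (μ a b) c = μ a (μ b c) :=
  (doubleEquivEnd hH).injective <| by simp only [hμ.doubleEquivEnd_mul hH, star_assoc]

theorem IsDoubleMul.one_mul (hH : IsNuclearSpace 𝕜 H)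
    {μ : AYDDouble 𝕜 H →ₗ[𝕜] AYDDouble 𝕜 H →L[𝕜] AYDDouble 𝕜 H} (hμ : A.IsDoubleMul μ)
    (a : AYDDouble 𝕜 H) : μ A.doubleOne a = a :=
  (doubleEquivEnd hH).injective <| by
    rw [hμ.doubleEquivEnd_mul hH, doubleOne, doubleEquivEnd_ctmul, star_counit_left]

theorem IsDoubleMul.mul_one (hH : IsNuclearSpace 𝕜 H)
    {μ : AYDDouble 𝕜 H →ₗ[𝕜] AYDDouble 𝕜 H →L[𝕜] AYDDouble 𝕜 H} (hμ : A.IsDoubleMul μ)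
    (a : AYDDouble 𝕜 H) : μ a A.doubleOne = a :=
  (doubleEquivEnd hH).injective <| by
    rw [hμ.doubleEquivEnd_mul hH, doubleOne, doubleEquivEnd_ctmul, star_counit_right]

/-- The map `φ ↦ φ ⊗ 1` is multiplicative. -/
theorem IsDoubleMul.dual_mul_dual (hH : IsNuclearSpace 𝕜 H)
    {μ : AYDDouble 𝕜 H →ₗ[𝕜] AYDDouble 𝕜 H →L[𝕜] AYDDouble 𝕜 H} (hμ : A.IsDoubleMul μ)
    (φ ψ : StrongDual 𝕜 H) :
    μ (ctmul 𝕜 φ 1) (ctmul 𝕜 ψ 1) = ctmul 𝕜 (A.conv φ ψ) 1 :=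
  (doubleEquivEnd hH).injective <| ContinuousLinearMap.ext fun x => by
    rw [hμ.doubleEquivEnd_mul hH]
    simp only [doubleEquivEnd_ctmul]
    rw [star_apply, cmap_smulRight_id, twist_one]
    simp [conv_apply]

/-- Factors every elementary tensor through `H°` and `H`, so an action of the double is determined
by its restrictions to these two subalgebras. -/
theorem IsDoubleMul.dual_mul_right (hH : IsNuclearSpace 𝕜 H)
    {μ : AYDDouble 𝕜 H →ₗ[𝕜] AYDDouble 𝕜 H →L[𝕜] AYDDouble 𝕜 H} (hμ : A.IsDoubleMul μ)
    (φ : StrongDual 𝕜 H) (h : H) :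
    μ (ctmul 𝕜 φ 1) (ctmul 𝕜 A.counit h) = ctmul 𝕜 φ h :=
  (doubleEquivEnd hH).injective <| ContinuousLinearMap.ext fun x => by
    rw [hμ.doubleEquivEnd_mul hH]
    simp only [doubleEquivEnd_ctmul]
    rw [star_apply, cmap_smulRight_id, twist_one]
    have h2 : A.counit (sliceLeft φ (A.comul x)) = φ (sliceRight A.counit (A.comul x)) :=
      CTensor.congr (f := A.counit ∘L sliceLeft φ) (g := φ ∘L sliceRight A.counit)
        (fun a b => by simp [mul_comm]) _
    simp [h2, A.counit_right]

/-- The product `(ε ⊗ h) b`, on operators. -/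
theorem IsDoubleMul.counit_mul (hH : IsNuclearSpace 𝕜 H)
    {μ : AYDDouble 𝕜 H →ₗ[𝕜] AYDDouble 𝕜 H →L[𝕜] AYDDouble 𝕜 H} (hμ : A.IsDoubleMul μ)
    (h : H) (b : AYDDouble 𝕜 H) (x : H) : toEnd (μ (ctmul 𝕜 A.counit h) b) x =
      mulC 𝕜 H (cmap (.id 𝕜 H) (doubleEquivEnd hH b) (A.twist (ctmul 𝕜 h x))) := by
  rw [← doubleEquivEnd_apply hH, hμ.doubleEquivEnd_mul hH]
  simp only [doubleEquivEnd_ctmul]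
  rw [star_apply, cmap_smulRight_id, A.counit_left]

theorem IsDoubleMul.counit_mul_counit (hH : IsNuclearSpace 𝕜 H)
    {μ : AYDDouble 𝕜 H →ₗ[𝕜] AYDDouble 𝕜 H →L[𝕜] AYDDouble 𝕜 H} (hμ : A.IsDoubleMul μ)
    (a b : H) : μ (ctmul 𝕜 A.counit a) (ctmul 𝕜 A.counit b) = ctmul 𝕜 A.counit (a * b) :=
  toEnd_ext hH fun x => by
    have h := fun t => CTensor.congr (f := mulC 𝕜 H ∘L cmap (.id 𝕜 H) (A.counit.smulRight b))
      (g := rmul 𝕜 b ∘L sliceRight A.counit) (fun a c => by simp; rfl) t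
    simp only [ContinuousLinearMap.comp_apply] at h
    rw [hμ.counit_mul hH, doubleEquivEnd_ctmul, h, counit_twist]
    simp
    rfl

end Star
end TopHopfAlgebra

/-! ### Separate continuity implies joint continuity -/

section SeparateContinuity

universe u v w
variable {𝕜 : Type u} [RCLike 𝕜]

/-- Otherwise there are null sequences `x n`, `y n` with `r (f (x n) (y n)) > 1`. The maps `f(·, y
n)` are pointwise bounded, hence equicontinuous, which contradicts `x n → 0`. -/
theorem bddNearZero₂_of_frechet {E F X : Type*} [AddCommGroup E] [Module 𝕜 E] [TopologicalSpace E]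
    [IsTopologicalAddGroup E] [ContinuousSMul 𝕜 E] [AddCommGroup F] [Module 𝕜 F]
    [TopologicalSpace F] [AddCommGroup X] [Module 𝕜 X] [TopologicalSpace X]
    [BarrelledSpace 𝕜 E] [FirstCountableTopology E] [FirstCountableTopology F]
    (f : E →ₗ[𝕜] F →ₗ[𝕜] X) (h₁ : ∀ x, Continuous (f x)) (h₂ : ∀ y, Continuous fun x => f x y) :
    BddNearZero₂ f := by
  intro r hr
  by_contra! hcon
  obtain ⟨U, hU⟩ := (𝓝 (0 : E)).exists_antitone_basis
  obtain ⟨W, hW⟩ := (𝓝 (0 : F)).exists_antitone_basis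
  choose x hx y hy hxy using fun n => hcon (U n) (hU.mem n) (W n) (hW.mem n)
  have hx0 : Filter.Tendsto x Filter.atTop (𝓝 0) := hU.tendsto hx
  have hy0 : Filter.Tendsto y Filter.atTop (𝓝 0) := hW.tendsto hy
  obtain ⟨p, hp, hpy⟩ := exists_seminorm_of_pointwise_bdd
    (fun n => (⟨f.flip (y n), h₂ (y n)⟩ : E →L[𝕜] X)) hr fun z => by
      have : Filter.Tendsto (fun n => r (f z (y n))) Filter.atTop (𝓝 (r (f z 0))) :=
        ((hr.comp (h₁ z)).tendsto 0).comp hy0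
      obtain ⟨C, hC⟩ := this.bddAbove_range
      exact ⟨C, fun n => hC ⟨n, rfl⟩⟩
  have hpx : Filter.Tendsto (fun n => p (x n)) Filter.atTop (𝓝 (p 0)) := (hp.tendsto 0).comp hx0
  rw [map_zero] at hpx
  obtain ⟨n, hn⟩ := (hpx.eventually (gt_mem_nhds one_pos)).exists
  exact absurd (hpy n (x n)) (not_le.2 (hn.trans (hxy n)))

/-- In a metrizable space, countably many bounded sets can be scaled to have a bounded union. -/
theorem exists_scale_bounded_iUnion {G : Type*} [AddCommGroup G] [Module 𝕜 G] [TopologicalSpace G]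
    [IsTopologicalAddGroup G] [ContinuousSMul 𝕜 G] [PolynormableSpace 𝕜 G]
    [FirstCountableTopology G] (S : ℕ → Set G) (hS : ∀ n, Bornology.IsVonNBounded 𝕜 (S n)) :
    ∃ ε : ℕ → ℝ, (∀ n, 0 < ε n) ∧
      Bornology.IsVonNBounded 𝕜 {x | ∃ n, ∃ a ∈ S n, ((ε n : ℝ) : 𝕜) • a = x} := by
  obtain ⟨Q, hQ⟩ := (𝓝 (0 : G)).exists_antitone_basis
  choose t ht htQ using fun n => exists_seminorm_of_mem_nhds (𝕜 := 𝕜) (hQ.mem n)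
  choose C hC hCS using fun n => Bornology.IsVonNBounded.exists_seminorm_le (hS n) (ht n)
  -- After scaling, the `n`-th set lies in the `n`-th basic neighbourhood. So a given seminorm is at
  -- most 1 on all but finitely many of them.
  refine ⟨fun n => (C n)⁻¹, fun n => inv_pos.2 (hC n), isVonNBounded_of_seminorm_le (𝕜 := 𝕜) fun p hp => ?_⟩
  choose c hc hcS using fun n => Bornology.IsVonNBounded.exists_seminorm_le (hS n) hp
  obtain ⟨N, -, hN⟩ := hQ.1.mem_iff.1 (seminorm_ball_mem_nhds hp one_pos)
  have hpos : ∀ n, 0 ≤ (C n)⁻¹ * c n := fun n => mul_nonneg (inv_pos.2 (hC n)).le (hc n).le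
  refine ⟨1 + ∑ n ∈ Finset.range N, (C n)⁻¹ * c n, ?_⟩
  rintro _ ⟨n, a, ha, rfl⟩
  have habs : ∀ q : Seminorm 𝕜 G, q ((((C n)⁻¹ : ℝ) : 𝕜) • a) = (C n)⁻¹ * q a := fun q => by
    rw [map_smul_eq_mul, RCLike.norm_ofReal, abs_of_pos (inv_pos.2 (hC n))]
  rcases lt_or_ge n N with hn | hn
  · rw [habs]
    have h1 : (C n)⁻¹ * p a ≤ (C n)⁻¹ * c n :=
      mul_le_mul_of_nonneg_left (hcS n a ha) (inv_pos.2 (hC n)).le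
    have h2 := Finset.single_le_sum (f := fun n => (C n)⁻¹ * c n) (fun n _ => hpos n)
      (Finset.mem_range.2 hn)
    linarith
  · have h1 : p ((((C n)⁻¹ : ℝ) : 𝕜) • a) ≤ 1 := hN (hQ.2 hn (htQ n _ (by
      rw [habs, inv_mul_le_iff₀ (hC n), mul_one]; exact hCS n a ha)))
    have h2 : 0 ≤ ∑ n ∈ Finset.range N, (C n)⁻¹ * c n := Finset.sum_nonneg fun n _ => hpos n
    linarith

/-- `F` is the union of the polars `Bₙ` of a neighbourhood basis of `F₀`, which are bounded.
Barrelledness of `E` gives seminorms `p n` bounding `f(·, y)` for all `y` in `Bₙ`, each at most 1 on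
the polar of a bounded set `S n` of the metrizable `E₀`. Scaled copies of the `S n` have bounded
union, whose polar is one neighbourhood of zero in `E` that works for all `n`; there the maps `f(x,
·)` are pointwise bounded, and barrelledness of `F` concludes. -/
theorem bddNearZero₂_of_dual {E E₀ : Type v} {F F₀ : Type w} {X : Type*} [AddCommGroup E] [Module 𝕜 E]
    [UniformSpace E] [IsUniformAddGroup E] [ContinuousSMul 𝕜 E] [PolynormableSpace 𝕜 E]
    [AddCommGroup F] [Module 𝕜 F]
    [UniformSpace F] [IsUniformAddGroup F] [ContinuousSMul 𝕜 F] [PolynormableSpace 𝕜 F]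
    [AddCommGroup X] [Module 𝕜 X] [TopologicalSpace X]
    [BarrelledSpace 𝕜 E] [BarrelledSpace 𝕜 F]
    [AddCommGroup E₀] [Module 𝕜 E₀] [UniformSpace E₀] [IsUniformAddGroup E₀]
    [ContinuousSMul 𝕜 E₀] [PolynormableSpace 𝕜 E₀] [FirstCountableTopology E₀]
    [AddCommGroup F₀] [Module 𝕜 F₀] [UniformSpace F₀] [IsUniformAddGroup F₀]
    [ContinuousSMul 𝕜 F₀] [PolynormableSpace 𝕜 F₀] [FirstCountableTopology F₀]
    (e : E ≃L[𝕜] StrongDual 𝕜 E₀) (e' : F ≃L[𝕜] StrongDual 𝕜 F₀)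
    (f : E →ₗ[𝕜] F →ₗ[𝕜] X) (h₁ : ∀ x, Continuous (f x)) (h₂ : ∀ y, Continuous fun x => f x y) :
    BddNearZero₂ f := by
  intro r hr
  obtain ⟨Q, hQ⟩ := (𝓝 (0 : F₀)).exists_antitone_basis
  choose s hs hsQ using fun n => exists_seminorm_of_mem_nhds (𝕜 := 𝕜) (hQ.mem n)
  have hB : ∀ n, ∃ p : Seminorm 𝕜 E, Continuous p ∧
      ∀ y : {y : F | ∀ z, ‖e' y z‖ ≤ s n z}, ∀ x, r (f x y) ≤ p x := fun n => by
    refine exists_seminorm_of_pointwise_bdd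
      (fun y : {y : F | ∀ z, ‖e' y z‖ ≤ s n z} => (⟨f.flip y, h₂ y⟩ : E →L[𝕜] X)) hr fun x => ?_
    obtain ⟨C, -, hC⟩ := Bornology.IsVonNBounded.exists_seminorm_le
      (isVonNBounded_dual_polar e' (hs n)) (p := r.comp (f x)) (hr.comp (h₁ x))
    exact ⟨C, fun y => hC y y.2⟩
  choose p hp hpB using hB
  have hA : ∀ n, ∃ S : Set E₀, Bornology.IsVonNBounded 𝕜 S ∧
      ∀ g : StrongDual 𝕜 E₀, (∀ a ∈ S, ‖g a‖ ≤ 1) → p n (e.symm g) ≤ 1 := fun n =>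
    exists_polar_subset (W := {g | p n (e.symm g) ≤ 1})
      (e.symm.continuous.continuousAt.preimage_mem_nhds
        (by rw [map_zero]; exact seminorm_ball_mem_nhds (hp n) one_pos))
  choose S hS hSp using hA
  obtain ⟨ε, hε, hD⟩ := exists_scale_bounded_iUnion S hS
  have hbd : ∀ y, ∃ C, ∀ x : {x : E | ∀ d ∈ {d | ∃ n, ∃ a ∈ S n, ((ε n : ℝ) : 𝕜) • a = d},
      ‖e x d‖ ≤ 1}, r (f x y) ≤ C := fun y => by
    obtain ⟨n, -, hn⟩ := hQ.1.mem_iff.1 (seminorm_ball_mem_nhds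
      (p := dualSeminorm (e' y).toLinearMap) (e' y).continuous.norm one_pos)
    have hy : ∀ z, ‖e' y z‖ ≤ s n z := norm_le_of_le_one (f := (e' y).toLinearMap)
      fun z hz => hn (hsQ n z hz)
    refine ⟨(ε n)⁻¹, fun x => (hpB n ⟨y, hy⟩ x).trans ?_⟩
    refine seminorm_le_of_smul_le (p n) (hε n) ?_
    have h1 := hSp n (e (((ε n : ℝ) : 𝕜) • (x : E))) fun a ha => by
      have := x.2 _ ⟨n, a, ha, rfl⟩
      rwa [map_smul] at this ⊢
    rwa [ContinuousLinearEquiv.symm_apply_apply] at h1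
  obtain ⟨q, hq, hqx⟩ := exists_seminorm_of_pointwise_bdd
    (fun x : {x : E | ∀ d ∈ {d | ∃ n, ∃ a ∈ S n, ((ε n : ℝ) : 𝕜) • a = d}, ‖e x d‖ ≤ 1} =>
      (⟨f x, h₁ x⟩ : F →L[𝕜] X)) hr hbd
  refine ⟨{x | ∀ d ∈ _, ‖e x d‖ ≤ 1}, e.continuous.continuousAt.preimage_mem_nhds
    (by rw [map_zero]; exact dual_polar_mem_nhds hD), _, seminorm_ball_mem_nhds hq one_pos,
    fun x hx y hy => (hqx ⟨x, hx⟩ y).trans hy⟩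

/-- A separately continuous bilinear map on two Fréchet spaces, or on two well-behaved duals of
Fréchet spaces, is jointly continuous. -/
theorem continuous_of_separately_continuous {E : Type v} [AddCommGroup E] [Module 𝕜 E]
    [UniformSpace E] [IsUniformAddGroup E] [ContinuousSMul 𝕜 E] [PolynormableSpace 𝕜 E]
    {F : Type w} [AddCommGroup F] [Module 𝕜 F]
    [UniformSpace F] [IsUniformAddGroup F] [ContinuousSMul 𝕜 F] [PolynormableSpace 𝕜 F]
    {X : Type*} [AddCommGroup X] [Module 𝕜 X] [TopologicalSpace X] [PolynormableSpace 𝕜 X]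
    [BarrelledSpace 𝕜 E] [BarrelledSpace 𝕜 F]
    (h : (IsFrechetSpace 𝕜 F ∧ IsFrechetSpace 𝕜 E) ∨ (IsDualOfFrechet 𝕜 F ∧ IsDualOfFrechet 𝕜 E))
    (f : E →ₗ[𝕜] F →ₗ[𝕜] X) (h₁ : ∀ x, Continuous (f x)) (h₂ : ∀ y, Continuous fun x => f x y) :
    Continuous fun p : E × F => f p.1 p.2 := by
  rcases h with ⟨hF, hE⟩ | ⟨⟨F₀, _, _, _, _, hF, ⟨e'⟩⟩, ⟨E₀, _, _, _, _, hE, ⟨e⟩⟩⟩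
  · have := hF.firstCountable
    have := hE.firstCountable
    exact (bddNearZero₂_of_frechet f h₁ h₂).continuous
  · have := hF.firstCountable
    have := hE.firstCountable
    have := hF.locallyConvex
    have := hE.locallyConvex
    have := hF.continuousSMul
    have := hE.continuousSMul
    exact (bddNearZero₂_of_dual e e' f h₁ h₂).continuous

end SeparateContinuity

/-! ### AYD modules and modules over the double -/

namespace TopHopfAlgebra
section Modules

universe u v w
variable {𝕜 : Type u} [RCLike 𝕜]
variable {H : Type v} [Ring H] [Algebra 𝕜 H] [UniformSpace H] [IsUniformAddGroup H]
  [IsTopologicalRing H] [ContinuousSMul 𝕜 H] [PolynormableSpace 𝕜 H] [CompleteSpace H] [T2Space H]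
  {A : TopHopfAlgebra 𝕜 H}
variable {V : Type w} [AddCommGroup V] [Module 𝕜 V] [UniformSpace V]
    [IsUniformAddGroup V] [ContinuousSMul 𝕜 V] [PolynormableSpace 𝕜 V] [CompleteSpace V]
    [T2Space V]

/-- The action of a right module as a map `h ⊗ v ↦ v · h`. -/
noncomputable def actC (M : TopRightModule 𝕜 H V) : CTensor 𝕜 H V →L[𝕜] V :=
  lift₂ M.act.flip (M.continuous_act.comp (continuous_snd.prodMk continuous_fst))

@[simp] theorem actC_ctmul (M : TopRightModule 𝕜 H V) (h : H) (v : V) :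
    actC M (ctmul 𝕜 h v) = M.act v h := lift₂_ctmul _ _ h v

theorem leg₂_actC (M : TopRightModule 𝕜 H V) (h : H) (t : CTensor 𝕜 H V) :
    leg₂ H (actC M) (ctmul 𝕜 h t) = cmap (.id 𝕜 H) (M.op h) t :=
  CTensor.congr (f := leg₂ H (actC M) ∘L tmulLeft _ h) (fun x w => by simp) t

/-- The AYD condition rewritten by the twist, for all tensors at once. -/
theorem coact_act {M : TopRightModule 𝕜 H V} {N : A.TopLeftComodule V} (hAYD : IsAYD M N)
    (t : CTensor 𝕜 H V) : N.coact (actC M t) =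
      leg₂ H (actC M) (A.twist₁ V (cmap (.id 𝕜 H) N.coact t)) := by
  refine CTensor.congr (f := N.coact ∘L actC M)
    (g := leg₂ H (actC M) ∘L A.twist₁ V ∘L cmap (.id 𝕜 H) N.coact) (fun h v => ?_) t
  simp only [ContinuousLinearMap.comp_apply, actC_ctmul, cmap_ctmul, ContinuousLinearMap.id_apply]
  rw [hAYD v h]
  refine (A.twist₁_ctmul (F := leg₂ H (actC M)) (fun a b c => ?_) h).symm
  rw [lift₃_ctmul, leg₂_actC, cmap_cmap, aydTri_apply, ContinuousLinearMap.comp_id,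
    ContinuousLinearMap.id_comp]

variable [BarrelledSpace 𝕜 H] [CompleteSpace (StrongDual 𝕜 H)]

/-- The action of the double on an AYD module. -/
noncomputable def doubleAct (hH : IsNuclearSpace 𝕜 H) (hV : IsNuclearSpace 𝕜 V)
    (M : TopRightModule 𝕜 H V) (N : V →L[𝕜] CTensor 𝕜 H V) : V →ₗ[𝕜] AYDDouble 𝕜 H →L[𝕜] V where
  toFun v :=
    -- The action is `v · b = v₀ · λ(b)(v₋₁)`; its continuity in `b` comes from nuclearity of `V`.
    { toFun := fun b => actC M (cmap (doubleEquivEnd hH b) (.id 𝕜 V) (N v))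
      map_add' := fun b b' => by rw [map_add, cmap_add_left, _root_.add_apply, map_add]
      map_smul' := fun c b => by
        rw [map_smul, cmap_smul_left, _root_.smul_apply, map_smul]; rfl
      cont := (actC M).continuous.comp ((continuous_eval_const (N v)).comp
        (hV.continuous_cmap_id.comp (doubleEquivEnd hH).continuous)) }
  map_add' v v' := ContinuousLinearMap.ext fun b => by
    change actC M _ = actC M _ + actC M _
    rw [map_add, map_add, map_add]
  map_smul' c v := ContinuousLinearMap.ext fun b => by
    change actC M _ = c • actC M _
    rw [map_smul, map_smul, map_smul]

theorem doubleAct_apply (hH : IsNuclearSpace 𝕜 H) (hV : IsNuclearSpace 𝕜 V)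
    (M : TopRightModule 𝕜 H V) (N : V →L[𝕜] CTensor 𝕜 H V) (v : V) (b : AYDDouble 𝕜 H) :
    doubleAct hH hV M N v b = actC M (cmap (doubleEquivEnd hH b) (.id 𝕜 V) (N v)) := rfl

theorem doubleAct_ctmul (hH : IsNuclearSpace 𝕜 H) (hV : IsNuclearSpace 𝕜 V)
    (M : TopRightModule 𝕜 H V) (N : V →L[𝕜] CTensor 𝕜 H V) (v : V) (φ : StrongDual 𝕜 H) (h : H) :
    doubleAct hH hV M N v (ctmul 𝕜 φ h) = M.act (sliceLeft φ (N v)) h := by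
  rw [doubleAct_apply, doubleEquivEnd_ctmul, cmap_smulRight_id, actC_ctmul]

variable {μ : AYDDouble 𝕜 H →ₗ[𝕜] AYDDouble 𝕜 H →L[𝕜] AYDDouble 𝕜 H}

/-- For `v · (a b)` use `cmap_star_coact`, for `(v · a) · b` use `coact_act`. Both reduce to the
same twisted tensor, and associativity of the `H`-action remains. -/
theorem isDoubleModule_doubleAct (hH : IsNuclearSpace 𝕜 H) (hV : IsNuclearSpace 𝕜 V)
    (hμ : A.IsDoubleMul μ) {M : TopRightModule 𝕜 H V} {N : A.TopLeftComodule V}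
    (hAYD : IsAYD M N) : A.IsDoubleModule μ (doubleAct hH hV M N.coact) where
  continuous_left b := ((actC M ∘L cmap (doubleEquivEnd hH b) (.id 𝕜 V)) ∘L N.coact).continuous
  act_one v := by rw [doubleOne, doubleAct_ctmul, N.counit, M.act_one]
  act_mul v a b := by
    rw [doubleAct_apply, doubleAct_apply, doubleAct_apply, hμ.doubleEquivEnd_mul hH,
      A.cmap_star_coact (N.coassoc v), coact_act hAYD, cmap_cmap, ContinuousLinearMap.comp_id,
      ContinuousLinearMap.id_comp]
    generalize A.twist₁ V _ = t
    exact CTensor.congr₃ (f := actC M ∘L leg₁ V (mulC 𝕜 H) ∘L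
        cmap (.id 𝕜 H) (cmap (doubleEquivEnd hH b) (.id 𝕜 V)))
      (g := actC M ∘L cmap (doubleEquivEnd hH b) (.id 𝕜 V) ∘L leg₂ H (actC M))
      (fun x y w => by simp [M.act_mul]) t

theorem existsUnique_doubleModule (hH : IsNuclearSpace 𝕜 H) (hV : IsNuclearSpace 𝕜 V)
    (hμ : A.IsDoubleMul μ) {M : TopRightModule 𝕜 H V} {N : A.TopLeftComodule V}
    (hAYD : IsAYD M N) : ∃! β : V →ₗ[𝕜] AYDDouble 𝕜 H →L[𝕜] V, A.IsDoubleModule μ β ∧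
      ∀ v φ h, β v (ctmul 𝕜 φ h) = M.act (sliceLeft φ (N.coact v)) h := by
  refine ⟨doubleAct hH hV M N.coact, ⟨isDoubleModule_doubleAct hH hV hμ hAYD,
    doubleAct_ctmul hH hV M N.coact⟩, fun β hβ => ?_⟩
  ext v b
  exact CTensor.congr (f := β v) (g := doubleAct hH hV M N.coact v)
    (fun φ h => (hβ.2 v φ h).trans (doubleAct_ctmul hH hV M N.coact v φ h).symm) b

theorem conv_counit_left (φ : StrongDual 𝕜 H) : A.conv A.counit φ = φ := by
  ext x; rw [conv_apply, A.counit_left]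

theorem sliceRight_eq_of_toEnd {ρ : AYDDouble 𝕜 H} (hρ : ∀ x, toEnd ρ x = x)
    (φ : StrongDual 𝕜 H) : sliceRight φ ρ = φ := by
  ext x; rw [← dual_toEnd, hρ]

@[simp] theorem swapMap_ctmul (g : StrongDual 𝕜 H →L[𝕜] V) (φ : StrongDual 𝕜 H) (x : H) :
    swapMap g (ctmul 𝕜 φ x) = ctmul 𝕜 x (g φ) := lift₂_ctmul _ _ φ x

/-- From `λ(ρ) = id` one gets `∑ φ(xᵢ) fⁱ = φ`, so slicing `∑ xᵢ ⊗ g(fⁱ)` recovers `g(φ)`. For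
nuclear `H` this characterizes the coaction by its slices `v · (φ ⊗ 1)`. -/
theorem sliceLeft_swapMap {ρ : AYDDouble 𝕜 H} (hρ : ∀ x, toEnd ρ x = x)
    (φ : StrongDual 𝕜 H) (g : StrongDual 𝕜 H →L[𝕜] V) : sliceLeft φ (swapMap g ρ) = g φ := by
  have h1 : sliceLeft φ (swapMap g ρ) = g (sliceRight φ ρ) :=
    CTensor.congr (f := sliceLeft φ ∘L swapMap g) (g := g ∘L sliceRight φ) (fun ψ x => by simp) ρ
  rw [h1, sliceRight_eq_of_toEnd hρ]

section FromDouble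

variable {β : V →ₗ[𝕜] AYDDouble 𝕜 H →L[𝕜] V}

variable (A) in
/-- The bilinear map `(v, h) ↦ v · (ε ⊗ h)`. -/
noncomputable def restrictAct (β : V →ₗ[𝕜] AYDDouble 𝕜 H →L[𝕜] V) : V →ₗ[𝕜] H →ₗ[𝕜] V where
  toFun v := (β v ∘L tmulLeft H A.counit).toLinearMap
  map_add' v v' := by ext h; simp
  map_smul' c v := by ext h; simp

@[simp] theorem restrictAct_apply (β : V →ₗ[𝕜] AYDDouble 𝕜 H →L[𝕜] V) (v : V) (h : H) :
    A.restrictAct β v h = β v (ctmul 𝕜 A.counit h) := rfl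

/-- The right `H`-module underlying a module over the double. -/
noncomputable def restrictModule (hH : IsNuclearSpace 𝕜 H) (hμ : A.IsDoubleMul μ)
    (hβ : A.IsDoubleModule μ β)
    (hc : Continuous (fun p : V × H => β p.1 (ctmul 𝕜 A.counit p.2))) : TopRightModule 𝕜 H V where
  act := A.restrictAct β
  continuous_act := hc
  act_one := hβ.act_one
  act_mul v a b := by
    simp only [restrictAct_apply]
    rw [← hβ.act_mul, hμ.counit_mul_counit hH]

/-- The coaction `v ↦ ∑ xᵢ ⊗ v · (fⁱ ⊗ 1)` as a linear map. -/
noncomputable def restrictCoactₗ (β : V →ₗ[𝕜] AYDDouble 𝕜 H →L[𝕜] V) (ρ : AYDDouble 𝕜 H) :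
    V →ₗ[𝕜] CTensor 𝕜 H V where
  toFun v := swapMap (β v ∘L dualIncl) ρ
  map_add' v v' := CTensor.congr (f := swapMap (β (v + v') ∘L dualIncl))
    (g := swapMap (β v ∘L dualIncl) + swapMap (β v' ∘L dualIncl))
    (fun φ x => by simp [ctmul_add_right]) ρ
  map_smul' c v := CTensor.congr (f := swapMap (β (c • v) ∘L dualIncl))
    (g := c • swapMap (β v ∘L dualIncl)) (fun φ x => by simp [ctmul_smul_right]) ρ

/-- For `ψ` dominated by `q` the operators `v ↦ v · (ψ ⊗ 1)` are pointwise bounded, hence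
equicontinuous since `V` is barrelled. They are the slices of the coaction, which nuclearity of `H`
bounds by them. -/
theorem continuous_restrictCoactₗ [BarrelledSpace 𝕜 V] (hH : IsNuclearSpace 𝕜 H)
    {ρ : AYDDouble 𝕜 H} (hρ : ∀ x, toEnd ρ x = x) (hβ : A.IsDoubleModule μ β) :
    Continuous (restrictCoactₗ β ρ) := by
  refine continuous_of_seminorm_le _ fun r hr => ?_
  obtain ⟨p, q, K, hp, hq, hK, h⟩ := hH.seminorm_le_slices_left hr
  obtain ⟨s, hs, hs'⟩ := exists_seminorm_of_pointwise_bdd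
    (fun ψ : {ψ : StrongDual 𝕜 H // ∀ y, ‖ψ y‖ ≤ q y} =>
      (⟨(ContinuousLinearMap.coeLM 𝕜 ∘ₗ β).flip (ctmul 𝕜 ψ.1 1), hβ.continuous_left _⟩ : V →L[𝕜] V))
    hp fun v => by
      obtain ⟨S, hS, hS'⟩ := exists_polar_subset (W := {ψ | p (β v (dualIncl ψ)) ≤ 1})
        ((β v ∘L dualIncl).continuous.continuousAt.preimage_mem_nhds
          (by rw [map_zero]; exact seminorm_ball_mem_nhds hp one_pos))
      obtain ⟨C, hC, hCS⟩ := Bornology.IsVonNBounded.exists_seminorm_le hS hq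
      refine ⟨C⁻¹⁻¹, fun ψ => seminorm_le_of_smul_le p (inv_pos.2 hC) ?_⟩
      have h1 := hS' (((C⁻¹ : ℝ) : 𝕜) • ψ.1) fun a ha => by
        rw [_root_.smul_apply, norm_smul, RCLike.norm_ofReal, abs_of_pos (inv_pos.2 hC),
          inv_mul_le_iff₀ hC, mul_one]
        exact (ψ.2 a).trans (hCS a ha)
      rw [Set.mem_ofPred_eq, map_smul, map_smul] at h1
      exact h1
  let k : NNReal := ⟨K, hK⟩
  refine ⟨k • s, continuous_const.mul hs, fun v => h _ (s v) fun ψ hψ => ?_⟩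
  have h1 : sliceLeft ψ (restrictCoactₗ β ρ v) = β v (ctmul 𝕜 ψ 1) :=
    sliceLeft_swapMap hρ ψ (β v ∘L dualIncl)
  rw [h1]
  exact hs' ⟨ψ, hψ⟩ v

theorem cassoc_cassocInv (t : CTensor 𝕜 (CTensor 𝕜 H H) V) :
    cassoc 𝕜 H H V (cassocInv 𝕜 H H V t) = t :=
  CTensor.congr (f := cassoc 𝕜 H H V ∘L cassocInv 𝕜 H H V) (g := .id 𝕜 _) (fun s v =>
    CTensor.congr (f := cassoc 𝕜 H H V ∘L cassocInv 𝕜 H H V ∘L tmulRight _ v)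
      (g := tmulRight _ v) (fun a b => by simp) s) t

theorem sliceLeft_cmap_id {W : Type*} [AddCommGroup W] [Module 𝕜 W] [UniformSpace W]
    [IsUniformAddGroup W] [ContinuousSMul 𝕜 W] [PolynormableSpace 𝕜 W] [CompleteSpace W]
    [T2Space W] (φ : StrongDual 𝕜 H) (g : V →L[𝕜] W) (t : CTensor 𝕜 H V) :
    sliceLeft φ (cmap (.id 𝕜 H) g t) = g (sliceLeft φ t) :=
  CTensor.congr (f := sliceLeft φ ∘L cmap (.id 𝕜 H) g) (g := g ∘L sliceLeft φ)
    (fun a b => by simp) t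

theorem sliceLeft_conv (φ ψ : StrongDual 𝕜 H) (t : CTensor 𝕜 H V) :
    sliceLeft ψ (sliceLeft φ (cassocInv 𝕜 H H V (cmap A.comul (.id 𝕜 V) t))) =
      sliceLeft (A.conv φ ψ) t :=
  CTensor.congr (f := sliceLeft ψ ∘L sliceLeft φ ∘L cassocInv 𝕜 H H V ∘L cmap A.comul (.id 𝕜 V))
    (g := sliceLeft (A.conv φ ψ)) (fun x v => by
      have := CTensor.congr (f := sliceLeft ψ ∘L sliceLeft φ ∘L cassocInv 𝕜 H H V ∘L tmulRight _ v)
        (g := (ψ ∘L sliceLeft φ).smulRight v) (fun a b => by simp [mul_smul]) (A.comul x)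
      simpa [conv_apply] using this) t

/-- The left `H`-comodule underlying a module over the double. -/
noncomputable def restrictComodule [BarrelledSpace 𝕜 V] (hH : IsNuclearSpace 𝕜 H)
    (hμ : A.IsDoubleMul μ) {ρ : AYDDouble 𝕜 H} (hρ : ∀ x, toEnd ρ x = x)
    (hβ : A.IsDoubleModule μ β) : A.TopLeftComodule V where
  coact := ⟨restrictCoactₗ β ρ, continuous_restrictCoactₗ hH hρ hβ⟩
  coassoc v := by
    have h : ∀ v ψ, sliceLeft ψ ((⟨restrictCoactₗ β ρ, continuous_restrictCoactₗ hH hρ hβ⟩ :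
      V →L[𝕜] CTensor 𝕜 H V) v) = β v (ctmul 𝕜 ψ 1) := fun v ψ =>
        sliceLeft_swapMap hρ ψ (β v ∘L dualIncl)
    -- With the triple tensor bracketed to the right, coassociativity can be tested by two
    -- successive slices; it becomes `(v · (φ ⊗ 1)) · (ψ ⊗ 1) = v · (φψ ⊗ 1)`.
    rw [← cassoc_cassocInv (cmap A.comul _ _)]
    congr 1
    refine hH.ext_slices_left fun φ => hH.ext_slices_left fun ψ => ?_
    rw [sliceLeft_cmap_id, sliceLeft_conv, h, h, h, ← hβ.act_mul, hμ.dual_mul_dual hH]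
  counit v := (sliceLeft_swapMap hρ A.counit (β v ∘L dualIncl)).trans (hβ.act_one v)

theorem sliceLeft_restrictComodule [BarrelledSpace 𝕜 V] (hH : IsNuclearSpace 𝕜 H)
    (hμ : A.IsDoubleMul μ) {ρ : AYDDouble 𝕜 H} (hρ : ∀ x, toEnd ρ x = x)
    (hβ : A.IsDoubleModule μ β) (v : V) (φ : StrongDual 𝕜 H) :
    sliceLeft φ ((restrictComodule hH hμ hρ hβ).coact v) = β v (ctmul 𝕜 φ 1) :=
  sliceLeft_swapMap hρ φ (β v ∘L dualIncl)

/-- The slice of the condition by `φ` is `(v · (ε ⊗ h)) · (φ ⊗ 1) = v · ((ε ⊗ h)(φ ⊗ 1))`, with the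
product expanded as `∑ (φ(S(h₃) · h₁) ⊗ 1)(ε ⊗ h₂)`. -/
theorem isAYD_restrict [BarrelledSpace 𝕜 V] (hH : IsNuclearSpace 𝕜 H)
    (hμ : A.IsDoubleMul μ) {ρ : AYDDouble 𝕜 H} (hρ : ∀ x, toEnd ρ x = x)
    (hβ : A.IsDoubleModule μ β)
    (hc : Continuous (fun p : V × H => β p.1 (ctmul 𝕜 A.counit p.2))) :
    IsAYD (restrictModule hH hμ hβ hc) (restrictComodule hH hμ hρ hβ) := by
  intro v h
  refine hH.ext_slices_left fun φ => ?_
  rw [sliceLeft_restrictComodule]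
  change β (β v (ctmul 𝕜 A.counit h)) (ctmul 𝕜 φ 1) = _
  rw [← hβ.act_mul, hμ.mul_ctmul, doubleProd]
  generalize A.comul₃ h = t
  refine CTensor.congr₃ (f := β v ∘L lift₃ (A.doubleTri A.counit φ 1) (A.doubleTri_bdd A.counit φ 1))
    (g := sliceLeft φ ∘L lift₃ _ _) (fun a b c => ?_) t
  rw [ContinuousLinearMap.comp_apply, ContinuousLinearMap.comp_apply, lift₃_ctmul, lift₃_ctmul,
    aydTri_apply]
  change β v (ctmul 𝕜 (A.conv A.counit (φ ∘L A.conj a c)) (b * 1)) = _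
  have h1 : ∀ g t, sliceLeft φ (cmap (A.conj a c) g t) =
      (g : V →L[𝕜] V) (sliceLeft (φ ∘L A.conj a c) t) := fun g t =>
    CTensor.congr (f := sliceLeft φ ∘L cmap (A.conj a c) g)
      (g := g ∘L sliceLeft (φ ∘L A.conj a c)) (fun x w => by simp) t
  rw [conv_counit_left, h1, sliceLeft_restrictComodule, mul_one]
  change _ = β (β v _) (ctmul 𝕜 A.counit b)
  rw [← hβ.act_mul, hμ.dual_mul_right hH]

/-- Taking `φ = ε` or `h = 1` gives one direction, the coaction being determined by its slices. The
factorization `φ ⊗ h = (φ ⊗ 1)(ε ⊗ h)` gives the other. -/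
theorem formula_iff (hH : IsNuclearSpace 𝕜 H)
    (hμ : A.IsDoubleMul μ) {ρ : AYDDouble 𝕜 H} (hρ : ∀ x, toEnd ρ x = x)
    (hβ : A.IsDoubleModule μ β) (M : TopRightModule 𝕜 H V) (N : A.TopLeftComodule V) :
    (∀ v φ h, β v (ctmul 𝕜 φ h) = M.act (sliceLeft φ (N.coact v)) h) ↔
      (∀ v h, M.act v h = β v (ctmul 𝕜 A.counit h)) ∧
        ∀ v, N.coact v = swapMap (β v ∘L dualIncl) ρ := by
  constructor
  · refine fun hf => ⟨fun v h => by rw [hf, N.counit], fun v => hH.ext_slices_left fun φ => ?_⟩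
    rw [sliceLeft_swapMap hρ]
    exact ((hf v φ 1).trans (M.act_one _)).symm
  · rintro ⟨h1, h2⟩ v φ h
    rw [h1, h2, sliceLeft_swapMap hρ, ← hμ.dual_mul_right hH, hβ.act_mul]
    rfl

end FromDouble

end Modules
end TopHopfAlgebra

end TopHopf

/-- Topological anti-Yetter-Drinfeld modules over a well-behaved topological Hopf algebra `H` and
right modules over the topological anti-Drinfeld double `H° ⊗̂_π H`. -/
theorem mainTheorem2 {𝕜 : Type*} [RCLike 𝕜]
    {H : Type*} [Ring H] [Algebra 𝕜 H] [UniformSpace H] [IsUniformAddGroup H]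
    [IsTopologicalRing H] [ContinuousSMul 𝕜 H] [PolynormableSpace 𝕜 H] [CompleteSpace H]
    [T2Space H] (A : TopHopfAlgebra 𝕜 H) (hH : IsWellBehaved 𝕜 H)
    {V : Type*} [AddCommGroup V] [Module 𝕜 V] [UniformSpace V] [IsUniformAddGroup V]
    [ContinuousSMul 𝕜 V] [PolynormableSpace 𝕜 V] [CompleteSpace V] [T2Space V]
    (hV : IsWellBehaved 𝕜 V) :
    -- the multiplication of the anti-Drinfeld double and the element `ρ` with `λ(ρ) = id` exist
    (∃! μ : AYDDouble 𝕜 H →ₗ[𝕜] AYDDouble 𝕜 H →L[𝕜] AYDDouble 𝕜 H, A.IsDoubleMul μ) ∧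
    (∃! ρ : AYDDouble 𝕜 H, ∀ x, toEnd ρ x = x) ∧
    ∀ μ : AYDDouble 𝕜 H →ₗ[𝕜] AYDDouble 𝕜 H →L[𝕜] AYDDouble 𝕜 H, A.IsDoubleMul μ →
    ∀ ρ : AYDDouble 𝕜 H, (∀ x, toEnd ρ x = x) →
      -- the double is a unital associative algebra
      ((∀ a b c, μ (μ a b) c = μ a (μ b c)) ∧
        ∀ a, μ A.doubleOne a = a ∧ μ a A.doubleOne = a) ∧
      -- every AYD module is a right module over the double by `v · (φ ⊗ h) = φ(v₋₁) v₀ · h`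
      (∀ (M : TopRightModule 𝕜 H V) (N : A.TopLeftComodule V), IsAYD M N →
        ∃! β : V →ₗ[𝕜] AYDDouble 𝕜 H →L[𝕜] V, A.IsDoubleModule μ β ∧
          ∀ v φ h, β v (ctmul 𝕜 φ h) = M.act (sliceLeft φ (N.coact v)) h) ∧
      -- every right module over the double is an AYD module by `v · h = v · (ε ⊗ h)` and
      -- `∇(v) = ∑ xᵢ ⊗ v · (fⁱ ⊗ 1)`, where `ρ = ∑ fⁱ ⊗ xᵢ`
      (∀ β : V →ₗ[𝕜] AYDDouble 𝕜 H →L[𝕜] V, A.IsDoubleModule μ β →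
        ((IsFrechetSpace 𝕜 H ∧ IsFrechetSpace 𝕜 V) ∨
          (IsDualOfFrechet 𝕜 H ∧ IsDualOfFrechet 𝕜 V) ∨
          Continuous (fun p : V × H => β p.1 (ctmul 𝕜 A.counit p.2))) →
        ∃ (M : TopRightModule 𝕜 H V) (N : A.TopLeftComodule V), IsAYD M N ∧
          (∀ v h, M.act v h = β v (ctmul 𝕜 A.counit h)) ∧
          ∀ v, N.coact v = swapMap (β v ∘L dualIncl) ρ) ∧
      -- the two constructions are inverse to each other
      (∀ (M : TopRightModule 𝕜 H V) (N : A.TopLeftComodule V)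
        (β : V →ₗ[𝕜] AYDDouble 𝕜 H →L[𝕜] V), IsAYD M N → A.IsDoubleModule μ β →
        ((∀ v φ h, β v (ctmul 𝕜 φ h) = M.act (sliceLeft φ (N.coact v)) h) ↔
          (∀ v h, M.act v h = β v (ctmul 𝕜 A.counit h)) ∧
          ∀ v, N.coact v = swapMap (β v ∘L dualIncl) ρ)) := by
  have := hH.barrelledSpace_and_completeSpace_dual.1
  have := hH.barrelledSpace_and_completeSpace_dual.2
  have := hV.barrelledSpace_and_completeSpace_dual.1
  refine ⟨⟨A.doubleMul hH.1, A.isDoubleMul_doubleMul hH.1,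
      fun ν hν => hν.unique (A.isDoubleMul_doubleMul hH.1)⟩,
    ⟨(doubleEquivEnd hH.1).symm (.id 𝕜 H), fun x =>
      DFunLike.congr_fun ((doubleEquivEnd hH.1).apply_symm_apply (.id 𝕜 H)) x,
      fun ρ hρ => (ContinuousLinearEquiv.eq_symm_apply _).2 (ContinuousLinearMap.ext hρ)⟩,
    fun μ hμ ρ hρ => ⟨⟨hμ.assoc hH.1, fun a => ⟨hμ.one_mul hH.1 a, hμ.mul_one hH.1 a⟩⟩,
      fun M N hAYD => existsUnique_doubleModule hH.1 hV.1 hμ hAYD, fun β hβ h => ?_,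
      fun M N β _ hβ => formula_iff hH.1 hμ hρ hβ M N⟩⟩
  -- The action is only separately continuous, so the unmixed cases need barrelledness of both `V`
  -- and `H`.
  have hc : Continuous (fun p : V × H => β p.1 (ctmul 𝕜 A.counit p.2)) := by
    rw [← or_assoc] at h
    exact h.elim (fun h => continuous_of_separately_continuous h (A.restrictAct β)
      (fun v => (β v ∘L tmulLeft H A.counit).continuous) fun x => hβ.continuous_left _) id
  exact ⟨restrictModule hH.1 hμ hβ hc, restrictComodule hH.1 hμ hρ hβ,
    isAYD_restrict hH.1 hμ hρ hβ hc, fun v x => rfl, fun v => rfl⟩
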